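/- Let $k$ be an algebraically closed field and $R=k[x_0,\dots,x_n]$. A closed subscheme $S\subseteq\mathbb P^n$ is given by its saturated homogeneous ideal $I_S\subseteq R$. A matrix over $R$ is homogeneous if all its minors are homogeneous polynomials. An ideal $I\subseteq R$ of height $c$ is standard determinantal if it is generated by the maximal ($t\times t$) minors of a homogeneous $t\times(t+c-1)$ matrix $M$ for some $t\ge 1$; such an $M$ is called a defining matrix of $I$. (For $c=0$ this means $I=0$.) The ideal $I$ is good determinantal if it has a defining matrix $M$ such that either $t=1$, or, after an invertible row operation over $R$ that turns $M$ into a homogeneous matrix, some row can be deleted so that the maximal minors of the remaining $(t-1)\times(t+c-1)$ matrix generate a standard determinantal ideal, that is, an ideal of height $c+1$. A scheme $S\subseteq\mathbb P^n$ is standard (good) determinantal if $I_S$ is, and a defining matrix of $S$ is a defining matrix of $I_S$. A hypersurface $F$ of degree $d\geq 1$ meets $S$ properly if it contains no irreducible component of $S$. For $C\subseteq S$ of codimension $1$ in $S$ and $F$ meeting $S$ properly, the basic double link of $C$ on $S$ via $F$ is the scheme $D=C\cup(S\cap F)\subseteq\mathbb P^n$ defined by the homogeneous ideal $I_S+F\cdot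 I_C$ (so $I_D$ is the saturation of $I_S+F\cdot I_C$). Theorem. Let $C\subseteq S\subseteq\mathbb P^n$ be standard determinantal schemes such that $C$ has codimension $1$ in $S$. Assume that there are defining matrices $M$ of $C$ and $N$ of $S$ such that either $M$ is obtained from $N$ by deleting a row or $N$ is obtained from $M$ by deleting a column. Then: (1) for every $d\ge 1$ and every hypersurface $F$ of degree $d$ that meets $S$ properly, the basic double link of $C$ on $S$ via $F$ is standard determinantal; (2) if $C$ is good determinantal, then for every $d\ge 1$ there is a nonempty Zariski open subset $U$ of the affine space of forms of degree $d$ in $R$ such that every $F\in U$ meets $S$ properly and the basic double link of $C$ on $S$ via $F$ is good determinantal. -/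

import Mathlib

open MvPolynomial

attribute [local instance] MvPolynomial.gradedAlgebra

namespace DetLinkage

/-- The homogeneous coordinate ring `k[x_0, …, x_n]` of `ℙⁿ`. -/
abbrev CoordRing (k : Type*) [Field k] (n : ℕ) := MvPolynomial (Fin (n + 1)) k

/-- The space of forms of degree `d` in `k[x_0, …, x_n]`. -/
abbrev Forms (k : Type*) [Field k] (n d : ℕ) : Submodule k (CoordRing k n) :=
  homogeneousSubmodule (Fin (n + 1)) k d

section Subschemes

variable {k : Type*} [Field k] {n : ℕ}

/-- An ideal is homogeneous for the standard grading of `k[x_0, …, x_n]`. -/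
abbrev IsHomIdeal (I : Ideal (CoordRing k n)) : Prop :=
  I.IsHomogeneous (homogeneousSubmodule (Fin (n + 1)) k)

/-- An ideal `I` is saturated if `I : (x_0, …, x_n) = I`. -/
def IsSaturated (I : Ideal (CoordRing k n)) : Prop :=
  ∀ f : CoordRing k n, (∀ i, X i * f ∈ I) → f ∈ I

/-- The saturation `⋃ N, J : (x_0, …, x_n)^N` of an ideal. -/
noncomputable def saturation (J : Ideal (CoordRing k n)) : Ideal (CoordRing k n) where
  carrier := {f | ∃ N : ℕ, ∀ g ∈ idealOfVars (Fin (n + 1)) k ^ N, g * f ∈ J}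
  zero_mem' := ⟨0, fun g _ => by simp⟩
  add_mem' := by
    rintro a b ⟨N, hN⟩ ⟨N', hN'⟩
    refine ⟨N + N', fun g hg => ?_⟩
    rw [mul_add]
    exact J.add_mem (hN g (Ideal.pow_le_pow_right (Nat.le_add_right _ _) hg))
      (hN' g (Ideal.pow_le_pow_right (Nat.le_add_left _ _) hg))
  smul_mem' := by
    rintro c a ⟨N, hN⟩
    refine ⟨N, fun g hg => ?_⟩
    rw [smul_eq_mul, mul_left_comm]
    exact J.mul_mem_left c (hN g hg)

theorem saturation_isSaturated (J : Ideal (CoordRing k n)) : IsSaturated (saturation J) := by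
  intro f hf
  choose N hN using hf
  refine ⟨(Finset.univ.sup N) + 1, fun g hg => ?_⟩
  rw [pow_succ] at hg
  refine Submodule.mul_induction_on hg (fun a ha b hb => ?_) (fun a b ha hb => ?_)
  · refine Submodule.span_induction (p := fun b _ => a * b * f ∈ J) ?_ (by simp) ?_ ?_ hb
    · rintro _ ⟨i, rfl⟩
      rw [mul_assoc]
      exact hN i a (Ideal.pow_le_pow_right (Finset.le_sup (Finset.mem_univ i)) ha)
    · intro u v _ _ hu hv
      rw [mul_add, add_mul]
      exact J.add_mem hu hv
    · intro c u _ hu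
      have h : a * (c • u) * f = c * (a * u * f) := by rw [smul_eq_mul]; ring
      rw [h]
      exact J.mul_mem_left c hu
  · rw [add_mul]
    exact J.add_mem ha hb

theorem isHomIdeal_iff (I : Ideal (CoordRing k n)) :
    IsHomIdeal I ↔ ∀ f ∈ I, ∀ d, homogeneousComponent d f ∈ I := by
  constructor
  · intro h f hf d
    have := h d hf
    rwa [← decomposition.decompose'_apply]
  · intro h d f hf
    have := h f hf d
    rwa [← decomposition.decompose'_apply] at this

theorem homogeneousComponent_monomial_mul (s : Fin (n + 1) →₀ ℕ) (f : CoordRing k n) (d : ℕ) :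
    homogeneousComponent (s.degree + d) (monomial s 1 * f) =
      monomial s 1 * homogeneousComponent d f := by
  classical
  ext u
  rw [coeff_homogeneousComponent, coeff_monomial_mul', coeff_monomial_mul',
    coeff_homogeneousComponent]
  by_cases hs : s ≤ u
  · obtain ⟨v, rfl⟩ := exists_add_of_le hs
    simp [map_add]
  · simp [hs]

theorem saturation_isHomIdeal {J : Ideal (CoordRing k n)} (hJ : IsHomIdeal J) :
    IsHomIdeal (saturation J) := by
  rw [isHomIdeal_iff] at hJ ⊢
  rintro f ⟨N, hN⟩ d
  refine ⟨N, fun g hg => ?_⟩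
  rw [pow_idealOfVars_eq_span] at hg
  refine Submodule.span_induction (p := fun g _ => g * homogeneousComponent d f ∈ J)
    ?_ (by simp) ?_ ?_ hg
  · rintro _ ⟨s, hs, rfl⟩
    have h := hJ _ (hN (monomial s 1) (by
      rw [pow_idealOfVars_eq_span]
      exact Ideal.subset_span ⟨s, hs, rfl⟩)) (s.degree + d)
    rwa [homogeneousComponent_monomial_mul] at h
  · intro u v _ _ hu hv
    rw [add_mul]
    exact J.add_mem hu hv
  · intro c u _ hu
    rw [smul_eq_mul, mul_assoc]
    exact J.mul_mem_left c hu

/-- A closed subscheme of `ℙⁿ`, given by its saturated homogeneous ideal. -/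
structure ProjSubscheme (k : Type*) [Field k] (n : ℕ) where
  /-- the saturated homogeneous ideal of the subscheme -/
  ideal : Ideal (CoordRing k n)
  homogeneous : IsHomIdeal ideal
  saturated : IsSaturated ideal

namespace ProjSubscheme

/-- The closed subscheme of `ℙⁿ` defined by an arbitrary homogeneous ideal. -/
noncomputable def ofIdeal (J : Ideal (CoordRing k n)) (hJ : IsHomIdeal J) : ProjSubscheme k n where
  ideal := saturation J
  homogeneous := saturation_isHomIdeal hJ
  saturated := saturation_isSaturated J

/-- `C ⊆ S` as closed subschemes of `ℙⁿ`. -/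
def IsSubscheme (C S : ProjSubscheme k n) : Prop := S.ideal ≤ C.ideal

/-- The codimension in `ℙⁿ`: the height of the saturated ideal (`⊤` for the empty scheme). -/
noncomputable def codim (S : ProjSubscheme k n) : ℕ∞ := S.ideal.height

/-- The hypersurface `F = 0` meets `S` properly: it contains no irreducible component of `S`. -/
def MeetsProperly {d : ℕ} (F : Forms k n d) (S : ProjSubscheme k n) : Prop :=
  ∀ p ∈ S.ideal.minimalPrimes, (F : CoordRing k n) ∉ p

end ProjSubscheme

theorem linkIdeal_isHomIdeal {d : ℕ} (C S : ProjSubscheme k n) (F : Forms k n d) :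
    IsHomIdeal (S.ideal ⊔ Ideal.span {(F : CoordRing k n)} * C.ideal) := by
  refine S.homogeneous.sup (Ideal.IsHomogeneous.mul ?_ C.homogeneous)
  refine Ideal.homogeneous_span _ _ ?_
  rintro x rfl
  exact ⟨d, F.2⟩

/-- The basic double link `D = C ∪ (S ∩ F)` of `C` on `S` via the hypersurface `F = 0`: the
closed subscheme of `ℙⁿ` defined by the ideal `I_S + F · I_C`. -/
noncomputable def basicDoubleLink {d : ℕ} (C S : ProjSubscheme k n) (F : Forms k n d) : ProjSubscheme k n :=
  ProjSubscheme.ofIdeal (S.ideal ⊔ Ideal.span {(F : CoordRing k n)} * C.ideal)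
    (linkIdeal_isHomIdeal C S F)

/-- `Q` holds for a generic form of degree `d`: it holds on a nonempty Zariski open subset of the
affine space of forms of degree `d`. It is no loss to take the nonvanishing locus of a single
polynomial `Φ` in the coefficients of the form. -/
def HoldsForGenericForm (d : ℕ) (Q : Forms k n d → Prop) : Prop :=
  ∃ Φ : MvPolynomial (Fin (n + 1) →₀ ℕ) k,
    (∃ F : Forms k n d, eval (fun s => coeff s (F : CoordRing k n)) Φ ≠ 0) ∧
    ∀ F : Forms k n d, eval (fun s => coeff s (F : CoordRing k n)) Φ ≠ 0 → Q F

end Subschemes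

section Determinantal

variable {k : Type*} [Field k] {n : ℕ} {t m : ℕ}

/-- A matrix of polynomials is homogeneous if all its minors (of all sizes) are homogeneous
polynomials. Repetitions of rows or columns are allowed; they only add zero. -/
def IsHomMatrix (M : Matrix (Fin t) (Fin m) (CoordRing k n)) : Prop :=
  ∀ (r : ℕ) (f : Fin r → Fin t) (g : Fin r → Fin m),
    ∃ d : ℕ, (M.submatrix f g).det.IsHomogeneous d

/-- The ideal generated by the maximal (`t × t`) minors of a matrix with `t` rows.
Repetitions of columns are allowed; they only add zero. -/
noncomputable def maxMinors (M : Matrix (Fin t) (Fin m) (CoordRing k n)) : Ideal (CoordRing k n) :=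
  Ideal.span (Set.range fun g : Fin t → Fin m => (M.submatrix id g).det)

/-- `M` is a defining matrix of the standard determinantal ideal `I`: it is homogeneous of size
`t × (t + c - 1)` with `t ≥ 1`, where `c` is the height of `I`, and its maximal minors generate
`I`. -/
def IsDefiningMatrix (M : Matrix (Fin t) (Fin m) (CoordRing k n)) (I : Ideal (CoordRing k n)) :
    Prop :=
  1 ≤ t ∧ IsHomMatrix M ∧ I = maxMinors M ∧ ∃ c : ℕ, I.height = c ∧ m + 1 = t + c

/-- Delete the `i`-th row. -/
noncomputable def deleteRow (M : Matrix (Fin (t + 1)) (Fin m) (CoordRing k n)) (i : Fin (t + 1)) :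
    Matrix (Fin t) (Fin m) (CoordRing k n) :=
  M.submatrix i.succAbove id

/-- Delete the `j`-th column. -/
noncomputable def deleteCol (M : Matrix (Fin t) (Fin (m + 1)) (CoordRing k n)) (j : Fin (m + 1)) :
    Matrix (Fin t) (Fin m) (CoordRing k n) :=
  M.submatrix id j.succAbove

/-- Standard determinantal ideals. -/
def IsStandardDetIdeal (I : Ideal (CoordRing k n)) : Prop :=
  ∃ (t m : ℕ) (M : Matrix (Fin t) (Fin m) (CoordRing k n)), IsDefiningMatrix M I

/-- Good determinantal ideals: for some defining matrix `M`, either `M` has a single row, or after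
an invertible row operation (to another homogeneous matrix) and the deletion of a row the maximal
minors of the remaining `(t - 1) × (t + c - 1)` matrix generate a standard determinantal ideal
(of height `c + 1`). Here `M` has `t + 1` rows. -/
def IsGoodDetIdeal (I : Ideal (CoordRing k n)) : Prop :=
  ∃ (t m : ℕ) (M : Matrix (Fin (t + 1)) (Fin m) (CoordRing k n)), IsDefiningMatrix M I ∧
    (t = 0 ∨ ∃ (P : GL (Fin (t + 1)) (CoordRing k n)) (i : Fin (t + 1)),
      IsHomMatrix (P.val * M) ∧
      IsDefiningMatrix (deleteRow (P.val * M) i) (maxMinors (deleteRow (P.val * M) i)))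

/-- Standard determinantal subschemes of `ℙⁿ`. -/
def ProjSubscheme.IsStandardDet (S : ProjSubscheme k n) : Prop := IsStandardDetIdeal S.ideal

/-- Good determinantal subschemes of `ℙⁿ`. -/
def ProjSubscheme.IsGoodDet (S : ProjSubscheme k n) : Prop := IsGoodDetIdeal S.ideal

/-- There are defining matrices `M` of `C` and `N` of `S` such that either `M` is obtained from
`N` by deleting a row, or `N` is obtained from `M` by deleting a column. -/
def HaveRelatedMatrices (C S : ProjSubscheme k n) : Prop :=
  (∃ (t m : ℕ) (M : Matrix (Fin t) (Fin m) (CoordRing k n))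
      (N : Matrix (Fin (t + 1)) (Fin m) (CoordRing k n)) (i : Fin (t + 1)),
      IsDefiningMatrix M C.ideal ∧ IsDefiningMatrix N S.ideal ∧ M = deleteRow N i) ∨
  (∃ (t m : ℕ) (M : Matrix (Fin t) (Fin (m + 1)) (CoordRing k n))
      (N : Matrix (Fin t) (Fin m) (CoordRing k n)) (j : Fin (m + 1)),
      IsDefiningMatrix M C.ideal ∧ IsDefiningMatrix N S.ideal ∧ N = deleteCol M j)

end Determinantal

end DetLinkage

/-! Both relations between the matrices lead to the same construction. If M is N without row i,
append to N the column F·e_i; if N is M without column j, append to N the column F times column j of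
M. Laplace expansion along the new column shows that the maximal minors of the enlarged matrix D
generate I_S + F·I_C (`HaveRelatedMatrices.exists_matrix`). D is homogeneous because homogeneity of
all minors amounts to the existence of row and column degrees (`exists_hasDegrees`).

Let c be the codimension of S. A prime over I_S + F·I_C contains I_C, or contains I_S and F; since F
meets S properly, its height is at least c+1 (`height_linkIdeal`). This is the expected codimension
for the size of D, so the quotient is Cohen-Macaulay (`codepthLE_quotient_maximalMinors`) and its
associated primes have height at most c+1. The irrelevant ideal has height at least c+2, because C
is saturated of codimension c+1; hence I_S + F·I_C is already saturated. This proves (1).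

For (2), goodness is traded for a local condition: at primes of height at most e, the ideal of
codimension e is generated by e elements (`IsCIUpTo`). A good ideal satisfies it by Cramer's rule.
Conversely, for e ≥ 2, a deformation argument (`lt_two_of_forall_mem_maximalIdeal`,
`not_minorIdeal_le_maximalIdeal`) shows that some submaximal minor is a unit at each minimal prime
of height e. A generic homogeneous row operation then makes the matrix with one row deleted have
codimension e+1 (`isGoodDetIdeal_maximalMinors`). The local condition passes from C to the link when
F avoids the minimal primes of C (`isCIUpTo_linkIdeal`): off F the link is C, and at the points of F
in question it is S cut by F, where S is locally a complete intersection because I_C lies in the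
ideal of submaximal minors of N. If c = 0, the matrix D is square and the link is a hypersurface. -/

namespace DetLinkage

universe u

/-! ### Depth defect measured by vanishing of Ext -/

section Codepth

open CategoryTheory Abelian

variable {A : Type u} [CommRing A]

/-- `N` has codepth at most `g` if `Ext^i(A/P, N)` vanishes for all primes `P` and all
`i < ht P - g`. -/
def CodepthLE (A : Type u) [CommRing A] (g : ℕ) (N : Type u) [AddCommGroup N] [Module A N] : Prop :=
  ∀ (P : Ideal A) [P.IsPrime] (i : ℕ), ((i + g : ℕ) : ℕ∞) < P.height →
    Subsingleton (Ext (ModuleCat.of A (A ⧸ P)) (ModuleCat.of A N) i)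

variable {N N₁ N₂ N₃ : Type u} [AddCommGroup N] [Module A N] [AddCommGroup N₁] [Module A N₁]
  [AddCommGroup N₂] [Module A N₂] [AddCommGroup N₃] [Module A N₃]

theorem exists_shortExact {f : N₁ →ₗ[A] N₂} {h : N₂ →ₗ[A] N₃} (hf : Function.Injective f)
    (hh : Function.Surjective h) (e : Function.Exact f h) :
    (ModuleCat.shortComplexOfCompEqZero f h e.linearMap_comp_eq_zero).ShortExact where
  exact := ModuleCat.shortComplex_exact _ e
  mono_f := by simpa [ModuleCat.mono_iff_injective] using! hf
  epi_g := by simpa [ModuleCat.epi_iff_surjective] using! hh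

/-- Ext^i into N₃ sits between Ext^i into N₂ and Ext^(i+1) into N₁; the step from g to g + 1 absorbs
the shift of degree. -/
theorem CodepthLE.right {g : ℕ} {f : N₁ →ₗ[A] N₂} {h : N₂ →ₗ[A] N₃} (hf : Function.Injective f)
    (hh : Function.Surjective h) (e : Function.Exact f h)
    (h₁ : CodepthLE A g N₁) (h₂ : CodepthLE A (g + 1) N₂) : CodepthLE A (g + 1) N₃ := by
  intro P _ i hi
  have s := exists_shortExact hf hh e
  have i₂ := h₂ P i hi
  have i₁ := h₁ P (i + 1) (by convert hi using 2; ring)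
  refine ⟨fun a b => ?_⟩
  have key : ∀ a : Ext (ModuleCat.of A (A ⧸ P)) (ModuleCat.of A N₃) i, a = 0 := by
    intro a
    obtain ⟨x, rfl⟩ := Ext.covariant_sequence_exact₃ _ s a rfl (i₁.elim _ _)
    rw [i₂.elim x 0, Ext.zero_comp]
  rw [key a, key b]

/-- Ext^i into N₁ sits between Ext^(i-1) into N₃ and Ext^i into N₂. In degree 0 only the injectivity
of N₁ → N₂ is needed. -/
theorem CodepthLE.left {g : ℕ} {f : N₁ →ₗ[A] N₂} {h : N₂ →ₗ[A] N₃} (hf : Function.Injective f)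
    (hh : Function.Surjective h) (e : Function.Exact f h)
    (h₂ : CodepthLE A g N₂) (h₃ : CodepthLE A (g + 1) N₃) : CodepthLE A g N₁ := by
  intro P _ i hi
  have s := exists_shortExact hf hh e
  have i₂ := h₂ P i hi
  have key : ∀ a : Ext (ModuleCat.of A (A ⧸ P)) (ModuleCat.of A N₁) i, a = 0 := by
    intro a
    rcases i with _ | i
    · have := s.mono_f
      refine Ext.postcomp_mk₀_injective_of_mono (ModuleCat.of A (A ⧸ P))
        (ModuleCat.shortComplexOfCompEqZero f h e.linearMap_comp_eq_zero).f (i₂.elim _ _)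
    · have i₃ := h₃ P i (by convert hi using 2; ring)
      obtain ⟨x, rfl⟩ := Ext.covariant_sequence_exact₁ _ s a (i₂.elim _ _) rfl
      rw [i₃.elim x 0, Ext.zero_comp]
  exact ⟨fun a b => by rw [key a, key b]⟩

theorem CodepthLE.of_subsingleton [Subsingleton N] (g : ℕ) : CodepthLE A g N := by
  intro P _ i _
  have hz : Limits.IsZero (ModuleCat.of A N) := ModuleCat.isZero_of_subsingleton _
  refine ⟨fun a b => ?_⟩
  rw [← Ext.comp_mk₀_id a, ← Ext.comp_mk₀_id b, hz.eq_zero_of_src (𝟙 _), Ext.mk₀_zero]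
  simp

theorem CodepthLE.of_equiv {g : ℕ} (e : N₁ ≃ₗ[A] N₂) (h : CodepthLE A g N₁) : CodepthLE A g N₂ :=
  CodepthLE.left (N₃ := PUnit) (f := e.symm.toLinearMap) (h := 0) e.symm.injective
    (fun _ => ⟨0, rfl⟩) (fun x => by simp) h (CodepthLE.of_subsingleton _)

theorem CodepthLE.mono {g g' : ℕ} (hg : g ≤ g') (h : CodepthLE A g N) : CodepthLE A g' N :=
  fun P _ i hi => h P i (lt_of_le_of_lt (by exact_mod_cast (by omega)) hi)

/-- An associated prime P gives a nonzero map A/P → N, so the vanishing must already fail in degree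
0. This is the source of unmixedness everywhere below. -/
theorem CodepthLE.height_le [IsNoetherianRing A] {g : ℕ} (h : CodepthLE A g N) {P : Ideal A}
    (hP : P ∈ associatedPrimes A N) : P.height ≤ g := by
  by_contra! hlt
  have hPp : P.IsPrime := hP.1
  have hs := h P 0 (by simpa using hlt)
  obtain ⟨_, φ, hφ⟩ := (isAssociatedPrime_iff_exists_injective_linearMap P N).1 hP
  have : Ext.mk₀ (ModuleCat.ofHom φ) = Ext.mk₀ (0 : ModuleCat.of A (A ⧸ P) ⟶ ModuleCat.of A N) :=
    hs.elim _ _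
  have h0 := congrArg ModuleCat.Hom.hom ((Ext.mk₀_bijective _ _).1 this)
  have h1 : φ 1 = φ 0 := by
    have : φ = 0 := h0
    rw [this]; simp
  exact hPp.ne_top ((Ideal.eq_top_iff_one _).2 (Ideal.Quotient.eq_zero_iff_mem.1 (hφ h1)))

theorem CodepthLE.height_le_of_minimalPrimes [IsNoetherianRing A] {g : ℕ} {I : Ideal A}
    (h : CodepthLE A g (A ⧸ I)) {P : Ideal A} (hP : P ∈ I.minimalPrimes) : P.height ≤ g := by
  refine h.height_le (Module.associatedPrimes.minimalPrimes_annihilator_subset_associatedPrimes A (A ⧸ I) ?_)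
  rwa [Ideal.annihilator_quotient]

/-- An element killed modulo `I` by an ideal of large height lies in `I`. -/
theorem CodepthLE.mem_of_forall_mul_mem [IsNoetherianRing A] {g : ℕ} {I J : Ideal A}
    (h : CodepthLE A g (A ⧸ I)) (hJ : ∀ P : Ideal A, P.IsPrime → I ≤ P → J ≤ P → g < P.height)
    {r : A} (hr : ∀ x ∈ J, x * r ∈ I) : r ∈ I := by
  by_contra hrI
  obtain ⟨P, hP, hle⟩ := exists_le_isAssociatedPrime_of_isNoetherianRing A
    (Ideal.Quotient.mk I r) (by rwa [Ne, Ideal.Quotient.eq_zero_iff_mem])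
  have hann : ∀ x, x * r ∈ I → x ∈ P := by
    intro x hx
    refine hle ?_
    rw [Submodule.mem_colon_singleton, Submodule.mem_bot, Algebra.smul_def,
      Ideal.Quotient.algebraMap_eq, ← map_mul, Ideal.Quotient.eq_zero_iff_mem]
    exact hx
  exact absurd (h.height_le hP) (not_le.2 (hJ P hP.1 (fun x hx => hann x (I.mul_mem_right _ hx))
    (fun x hx => hann x (hr x hx))))

/-- The first element x is injective on N but acts by zero on Ext(T, N), as it kills T. A class of
degree i therefore comes from degree i - 1 with values in N/xN, which vanishes by induction. -/
theorem subsingleton_ext_of_isWeaklyRegular (T : ModuleCat.{u} A) {rs : List A}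
    (hT : ∀ r ∈ rs, ∀ t : T, r • t = 0) (hN : RingTheory.Sequence.IsWeaklyRegular N rs) (i : ℕ)
    (hi : i < rs.length) : Subsingleton (Ext T (ModuleCat.of A N) i) := by
  induction rs generalizing N i with
  | nil => simp at hi
  | cons x rs ih =>
    rw [RingTheory.Sequence.isWeaklyRegular_cons_iff] at hN
    have s := IsSMulRegular.smulShortComplex_shortExact (M := ModuleCat.of A N) hN.1
    have hx : x • 𝟙 T = 0 := by
      ext t
      exact hT x (by simp) t
    have key : ∀ a : Ext T (ModuleCat.of A N) i, a = 0 := by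
      intro a
      have ha : a.comp (Ext.mk₀ (ModuleCat.smulShortComplex (ModuleCat.of A N) x).f)
          (add_zero i) = 0 := by
        have h1 : a.comp (x • Ext.mk₀ (𝟙 (ModuleCat.of A N))) (add_zero i) = x • a := by
          rw [Ext.comp_smul, Ext.comp_mk₀_id]
        have h2 : x • a = 0 := by
          rw [← Ext.mk₀_id_comp a, ← Ext.smul_comp, ← Ext.mk₀_smul, hx, Ext.mk₀_zero, Ext.zero_comp]
        rw [← Ext.mk₀_smul] at h1
        exact h1.trans h2
      rcases i with _ | i
      · have := s.mono_f
        refine Ext.postcomp_mk₀_injective_of_mono T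
          (ModuleCat.smulShortComplex (ModuleCat.of A N) x).f (ha.trans ?_)
        exact (map_zero _).symm
      · have := ih (fun r hr => hT r (by simp [hr])) hN.2 i (by simpa using hi)
        obtain ⟨y, hy⟩ := Ext.covariant_sequence_exact₁ _ s a ha rfl
        rw [show y = 0 from this.elim _ _] at hy
        exact hy.symm.trans (Ext.zero_comp _ _ s.extClass (i + 1) rfl)
    exact ⟨fun a b => by rw [key a, key b]⟩

open Pointwise in
theorem CodepthLE.quotSMulTop {g : ℕ} {x : A} (hx : IsSMulRegular N x) (h : CodepthLE A g N) :
    CodepthLE A (g + 1) (QuotSMulTop x N) :=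
  CodepthLE.right (f := LinearMap.lsmul A N x) (h := (x • (⊤ : Submodule A N)).mkQ) hx
    (Submodule.mkQ_surjective _) (LinearMap.exact_lsmul_mkQ_smul_top N x) h (h.mono (by omega))

theorem CodepthLE.quot_ofList {g : ℕ} {rs : List A} (hrs : RingTheory.Sequence.IsWeaklyRegular N rs)
    (h : CodepthLE A g N) :
    CodepthLE A (g + rs.length) (N ⧸ (Ideal.ofList rs • ⊤ : Submodule A N)) := by
  induction rs generalizing N g with
  | nil =>
    refine CodepthLE.of_equiv (Submodule.quotEquivOfEqBot _ ?_).symm h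
    simp
  | cons x rs ih =>
    rw [RingTheory.Sequence.isWeaklyRegular_cons_iff] at hrs
    have := ih hrs.2 (h.quotSMulTop hrs.1)
    have h2 := this.of_equiv (Submodule.quotOfListConsSMulTopEquivQuotSMulTopInner N x rs).symm
    rwa [List.length_cons, add_comm rs.length 1, ← add_assoc]

/-- A Cohen-Macaulay ring: every prime contains a regular sequence as long as its height. -/
def IsCM (A : Type u) [CommRing A] : Prop :=
  ∀ P : Ideal A, P.IsPrime → ∃ rs : List A, (∀ r ∈ rs, r ∈ P) ∧
    RingTheory.Sequence.IsWeaklyRegular A rs ∧ P.height ≤ rs.length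

theorem IsCM.codepthLE (h : IsCM A) : CodepthLE A 0 A := by
  intro P hP i hi
  obtain ⟨rs, hrs, hreg, hlen⟩ := h P hP
  refine subsingleton_ext_of_isWeaklyRegular _ (fun r hr t => ?_) hreg i ?_
  · obtain ⟨t, rfl⟩ := Ideal.Quotient.mk_surjective t
    change r • (Ideal.Quotient.mk P t) = 0
    rw [Algebra.smul_def, Ideal.Quotient.algebraMap_eq, ← map_mul, Ideal.Quotient.eq_zero_iff_mem]
    exact P.mul_mem_right _ (hrs r hr)
  · exact_mod_cast lt_of_lt_of_le hi hlen

theorem IsCM.codepthLE_quotient_ofList (h : IsCM A) {rs : List A}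
    (hrs : RingTheory.Sequence.IsWeaklyRegular A rs) :
    CodepthLE A rs.length (A ⧸ Ideal.ofList rs) := by
  have := h.codepthLE.quot_ofList hrs
  rw [zero_add] at this
  refine this.of_equiv (Submodule.quotEquivOfEq _ _ ?_)
  simp

end Codepth

/-! ### Polynomial rings over a field are Cohen-Macaulay -/

section CohenMacaulay

open RingTheory.Sequence

variable {A : Type u} [CommRing A]

theorem IsCM.exists_length_eq [IsNoetherianRing A] (h : IsCM A) (P : Ideal A) [P.IsPrime] :
    ∃ rs : List A, (∀ r ∈ rs, r ∈ P) ∧ IsWeaklyRegular A rs ∧ P.height = rs.length := by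
  obtain ⟨rs, h₁, h₂, h₃⟩ := h P ‹_›
  obtain ⟨d, hd⟩ := ENat.ne_top_iff_exists.1 (Ideal.height_ne_top_of_isPrime (I := P))
  rw [← hd] at h₃ ⊢
  have h₃ : d ≤ rs.length := by exact_mod_cast h₃
  refine ⟨rs.take d, fun r hr => h₁ r (List.mem_of_mem_take hr), ?_, by simp [h₃]⟩
  rw [← List.take_append_drop d rs, isWeaklyRegular_append_iff] at h₂
  exact h₂.1

theorem isCM_of_field (K : Type u) [Field K] : IsCM K := by
  intro P hP
  refine ⟨[], by simp, .nil K K, ?_⟩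
  rw [(Ideal.eq_bot_or_top P).resolve_right hP.ne_top, Ideal.height_bot]
  simp

theorem IsCM.of_ringEquiv {B : Type u} [CommRing B] (e : A ≃+* B) (h : IsCM A) : IsCM B := by
  intro P hP
  obtain ⟨rs, h₁, h₂, h₃⟩ := h (P.comap e) inferInstance
  refine ⟨rs.map e, by simpa using h₁, ?_, by simpa [RingEquiv.height_comap] using h₃⟩
  refine (AddEquiv.isWeaklyRegular_congr (e := e.toAddEquiv) ?_).1 h₂
  rw [List.forall₂_map_right_iff, List.forall₂_same]
  exact fun r _ x => map_mul e r x

theorem IsCM.of_isLocalization (h : IsCM A) (T : Submonoid A) (B : Type u) [CommRing B]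
    [Algebra A B] [IsLocalization T B] : IsCM B := by
  intro P hP
  obtain ⟨rs, h₁, h₂, h₃⟩ := h (P.under A) inferInstance
  refine ⟨rs.map (algebraMap A B), ?_, h₂.of_isLocalization B T, ?_⟩
  · simpa using h₁
  · rw [IsLocalization.height_under T] at h₃
    simpa using h₃

/-- The fibre over p is the spectrum of a polynomial ring in one variable over the residue field of
p, which has dimension at most one. -/
theorem not_chain_of_comap_C_eq {p : Ideal A} [p.IsPrime] {q₁ q₂ q₃ : Ideal (Polynomial A)}
    (p₁ : q₁.IsPrime) (p₂ : q₂.IsPrime) (p₃ : q₃.IsPrime)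
    (h₁ : q₁.comap Polynomial.C = p) (h₂ : q₂.comap Polynomial.C = p)
    (h₃ : q₃.comap Polynomial.C = p) (h₁₂ : q₁ < q₂) : ¬ q₂ < q₃ := by
  intro h₂₃
  let pp : PrimeSpectrum A := ⟨p, ‹_›⟩
  let e := PrimeSpectrum.preimageOrderIsoFiber A (Polynomial A) pp
  have hdim : Ring.KrullDimLE 1 (pp.asIdeal.Fiber (Polynomial A)) := by
    rw [Ring.krullDimLE_iff, ← ringKrullDim_eq_of_ringEquiv
      (polyEquivTensor A (p.ResidueField)).toRingEquiv, ← Ring.krullDimLE_iff]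
    infer_instance
  let x₁ : PrimeSpectrum.comap (algebraMap A (Polynomial A)) ⁻¹' {pp} :=
    ⟨⟨q₁, p₁⟩, PrimeSpectrum.ext h₁⟩
  let x₂ : PrimeSpectrum.comap (algebraMap A (Polynomial A)) ⁻¹' {pp} :=
    ⟨⟨q₂, p₂⟩, PrimeSpectrum.ext h₂⟩
  let x₃ : PrimeSpectrum.comap (algebraMap A (Polynomial A)) ⁻¹' {pp} :=
    ⟨⟨q₃, p₃⟩, PrimeSpectrum.ext h₃⟩
  have l₁₂ : e x₁ < e x₂ := e.lt_iff_lt.2 h₁₂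
  have l₂₃ : e x₂ < e x₃ := e.lt_iff_lt.2 h₂₃
  rcases Ring.krullDimLE_one_iff.1 hdim (e x₂).asIdeal (e x₂).2 with h | h
  · exact absurd (h.2 ⟨(e x₁).2, bot_le⟩ l₁₂.le) (not_le_of_gt l₁₂)
  · exact (e x₃).2.ne_top (h.1.2 (e x₃).asIdeal l₂₃)

theorem comap_lt_comap_of_surjective {B : Type*} [CommRing B] {f : A →+* B}
    (hf : Function.Surjective f) {I J : Ideal B} (h : I < J) : I.comap f < J.comap f :=
  lt_of_le_of_ne (Ideal.comap_mono h.le) fun e => h.ne (Ideal.comap_injective_of_surjective f hf e)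

theorem height_le_of_eq_map_C [IsNoetherianRing A] {P : Ideal (Polynomial A)} [P.IsPrime]
    (h : P = (P.comap Polynomial.C).map Polynomial.C) :
    P.height ≤ (P.comap Polynomial.C).height := by
  have : P.LiesOver (P.comap Polynomial.C) := ⟨rfl⟩
  refine (Ideal.height_le_height_add_of_liesOver (P.comap Polynomial.C) P).trans ?_
  rw [Polynomial.algebraMap_eq, ← h, Ideal.map_quotient_self, Ideal.height_bot, add_zero]

theorem height_le_height_comap_C_add_one [IsNoetherianRing A] {P : Ideal (Polynomial A)}
    [P.IsPrime] : P.height ≤ (P.comap Polynomial.C).height + 1 := by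
  have : P.LiesOver (P.comap Polynomial.C) := ⟨rfl⟩
  refine (Ideal.height_le_height_add_of_liesOver (P.comap Polynomial.C) P).trans ?_
  gcongr
  set p := P.comap Polynomial.C with hp
  have hpp : p.IsPrime := inferInstance
  rw [Polynomial.algebraMap_eq]
  have hle : p.map Polynomial.C ≤ P := Ideal.map_comap_le
  have hprime : (p.map Polynomial.C : Ideal (Polynomial A)).IsPrime :=
    Ideal.isPrime_map_C_of_isPrime
  have hP' : (P.map (Ideal.Quotient.mk (p.map Polynomial.C))).IsPrime :=
    Ideal.map_isPrime_of_surjective Ideal.Quotient.mk_surjective (by rwa [Ideal.mk_ker])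
  rw [← Nat.cast_one, Ideal.height_le_iff]
  intro q hq hlt
  have hcq : p ≤ (q.comap (Ideal.Quotient.mk (p.map Polynomial.C))).comap Polynomial.C := by
    intro x hx
    rw [Ideal.mem_comap, Ideal.mem_comap,
      Ideal.Quotient.eq_zero_iff_mem.2 (Ideal.mem_map_of_mem _ hx)]
    exact q.zero_mem
  have hcl : q.comap (Ideal.Quotient.mk (p.map Polynomial.C)) < P := by
    have := comap_lt_comap_of_surjective Ideal.Quotient.mk_surjective hlt
    rwa [Ideal.comap_map_of_surjective _ Ideal.Quotient.mk_surjective, ← RingHom.ker_eq_comap_bot,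
      Ideal.mk_ker, sup_eq_left.2 hle] at this
  have hq0 : q = ⊥ := by
    by_contra hne
    refine not_chain_of_comap_C_eq (p := p) hprime (Ideal.comap_isPrime _ q) ‹P.IsPrime›
      ?_ (le_antisymm ?_ hcq) rfl ?_ hcl
    · refine le_antisymm ?_ Ideal.le_comap_map
      exact Ideal.comap_mono hle
    · exact Ideal.comap_mono hcl.le
    · have := comap_lt_comap_of_surjective
        (Ideal.Quotient.mk_surjective (I := p.map Polynomial.C)) (bot_lt_iff_ne_bot.2 hne)
      rwa [← RingHom.ker_eq_comap_bot, Ideal.mk_ker] at this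
  rw [hq0, Ideal.height_bot]
  simp

/-- By McCoy's theorem and the choice of an associated prime, a zero divisor modulo I has all its
coefficients in one associated prime of A/I. An f₀ in P outside p·A[X] takes care of p itself.
Adding z·X^(deg f₀ + 1), with z in p outside the other associated primes, takes care of those
without disturbing the coefficients of f₀. -/
theorem exists_regular_mod_of_ne_map_C [IsNoetherianRing A] {P : Ideal (Polynomial A)} [P.IsPrime]
    (hne : P ≠ (P.comap Polynomial.C).map Polynomial.C) {I : Ideal A}
    (hI : ∀ q ∈ associatedPrimes A (A ⧸ I), P.comap Polynomial.C ≤ q → q = P.comap Polynomial.C) :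
    ∃ f ∈ P, ∀ b : Polynomial A, f * b ∈ I.map Polynomial.C → b ∈ I.map Polynomial.C := by
  set p := P.comap Polynomial.C with hp
  obtain ⟨f₀, hf₀, hf₀'⟩ : ∃ f₀ ∈ P, f₀ ∉ p.map Polynomial.C := by
    by_contra! h
    exact hne (le_antisymm h Ideal.map_comap_le)
  rw [Ideal.mem_map_C_iff] at hf₀'
  push Not at hf₀'
  obtain ⟨j, hj⟩ := hf₀'
  have hfin := associatedPrimes.finite A (A ⧸ I)
  obtain ⟨z, hz, hzq⟩ : ∃ z ∈ p, ∀ q ∈ associatedPrimes A (A ⧸ I), q ≠ p → z ∉ q := by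
    by_contra! h
    have hsub : (p : Set A) ⊆ ⋃ q ∈ ((hfin.toFinset.filter (· ≠ p) : Finset (Ideal A)) : Set (Ideal A)),
        ((id q : Ideal A) : Set A) := by
      intro z hz
      obtain ⟨q, h₁, h₂, h₃⟩ := h z hz
      simp only [Set.mem_iUnion]
      exact ⟨q, by simp [h₁, h₂], h₃⟩
    rw [Ideal.subset_union_prime (f := id) ⊤ ⊤ (fun q hq _ _ => by simp at hq; exact hq.1.1)] at hsub
    obtain ⟨q, hq, hle⟩ := hsub
    simp only [ne_eq, Finset.mem_filter, Set.Finite.mem_toFinset] at hq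
    exact hq.2 (hI q hq.1 hle)
  refine ⟨f₀ + Polynomial.C z * Polynomial.X ^ (f₀.natDegree + 1),
    P.add_mem hf₀ (P.mul_mem_right _ hz), fun b hb => ?_⟩
  set f := f₀ + Polynomial.C z * Polynomial.X ^ (f₀.natDegree + 1) with hf
  have hcoef : ∀ i, f.coeff i = f₀.coeff i + if i = f₀.natDegree + 1 then z else 0 := by
    intro i
    rw [hf, Polynomial.coeff_add, Polynomial.coeff_C_mul_X_pow]
  have hker : ∀ g : Polynomial A, g ∈ I.map Polynomial.C ↔
      g.map (Ideal.Quotient.mk I) = 0 := by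
    intro g
    rw [Ideal.mem_map_C_iff, Polynomial.ext_iff]
    simp [Ideal.Quotient.eq_zero_iff_mem]
  have hnzd : f.map (Ideal.Quotient.mk I) ∈ nonZeroDivisors (Polynomial (A ⧸ I)) := by
    rw [Polynomial.mem_nonZeroDivisors_iff]
    intro a ha
    by_contra ha0
    obtain ⟨q, hq, hle⟩ := exists_le_isAssociatedPrime_of_isNoetherianRing A a ha0
    have hmem : ∀ i, f.coeff i ∈ q := by
      intro i
      refine hle ?_
      rw [Submodule.mem_colon_singleton, Submodule.mem_bot, Algebra.smul_def,
        Ideal.Quotient.algebraMap_eq]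
      have := congrArg (fun g => g.coeff i) ha
      simpa [mul_comm] using this
    have hq' : q = p := by
      by_contra hne'
      refine hzq q hq hne' ?_
      have := hmem (f₀.natDegree + 1)
      rwa [hcoef, if_pos rfl, Polynomial.coeff_eq_zero_of_natDegree_lt (by omega), zero_add] at this
    refine hj ?_
    have := hmem j
    rw [hcoef, hq'] at this
    split_ifs at this
    · exact (Ideal.add_mem_iff_left _ hz).1 this
    · simpa using this
  rw [hker] at hb ⊢
  rw [Polynomial.map_mul] at hb
  exact (mul_left_mem_nonZeroDivisors_eq_zero_iff hnzd).1 hb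

/-- A regular sequence in P ∩ A stays regular in A[X] by flatness. Passing to P raises the height
only when P is not extended from A, and then by at most one, which is matched by one further regular
element. -/
theorem IsCM.polynomial [IsNoetherianRing A] (h : IsCM A) : IsCM (Polynomial A) := by
  intro P hP
  obtain ⟨rs, h₁, h₂, h₃⟩ := h.exists_length_eq (P.comap Polynomial.C)
  have hreg := h₂.of_flat (S := Polynomial A)
  rw [Polynomial.algebraMap_eq] at hreg
  by_cases hP' : P = (P.comap Polynomial.C).map Polynomial.C
  · refine ⟨rs.map Polynomial.C, by simpa using h₁, hreg, ?_⟩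
    rw [List.length_map, ← h₃]
    exact height_le_of_eq_map_C hP'
  · obtain ⟨f, hf, hf'⟩ := exists_regular_mod_of_ne_map_C hP' (I := Ideal.ofList rs) (by
      -- Modulo a regular sequence of length ht p all associated primes have height at most ht p, so
      -- none lies strictly above p.
      intro q hq hle
      have := hq.1
      refine (Ideal.eq_of_le_of_height_le _ hle ?_).symm
      rw [h₃]
      exact (h.codepthLE_quotient_ofList h₂).height_le hq)
    refine ⟨rs.map Polynomial.C ++ [f], ?_, ?_, ?_⟩
    · intro r hr
      rcases List.mem_append.1 hr with hr | hr
      · obtain ⟨y, hy, rfl⟩ := List.mem_map.1 hr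
        exact h₁ y hy
      · rwa [List.mem_singleton.1 hr]
    · rw [isWeaklyRegular_append_iff, isWeaklyRegular_singleton_iff,
        isSMulRegular_quotient_iff_mem_of_smul_mem]
      refine ⟨hreg, fun b hb => ?_⟩
      simp only [smul_eq_mul, Ideal.mul_top] at hb ⊢
      rw [← Ideal.map_ofList] at hb ⊢
      exact hf' b hb
    · simpa [h₃] using height_le_height_comap_C_add_one (P := P)

theorem isCM_mvPolynomial (k : Type u) [Field k] (n : ℕ) : IsCM (MvPolynomial (Fin n) k) := by
  induction n with
  | zero => exact (isCM_of_field k).of_ringEquiv (isEmptyRingEquiv k (Fin 0)).symm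
  | succ n ih => exact ih.polynomial.of_ringEquiv (finSuccEquiv k n).toRingEquiv.symm

end CohenMacaulay

/-! ### Heights along saturated chains in Cohen-Macaulay rings -/

section Catenary

open RingTheory.Sequence

variable {A : Type u} [CommRing A]

/-- After localizing at P the sequence is regular in a local ring, where each member lowers the
dimension by exactly one. -/
theorem length_le_height_of_isWeaklyRegular [IsNoetherianRing A] {rs : List A}
    (h : IsWeaklyRegular A rs) {P : Ideal A} [P.IsPrime] (hP : ∀ r ∈ rs, r ∈ P) :
    (rs.length : ℕ∞) ≤ P.height := by
  have hr := h.isRegular_of_isLocalization_of_mem (Localization.AtPrime P) P hP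
  have h1 := ringKrullDim_add_length_eq_ringKrullDim_of_isRegular _ hr
  rw [IsLocalization.AtPrime.ringKrullDim_eq_height P (Localization.AtPrime P), List.length_map] at h1
  have hnt : Nontrivial (Localization.AtPrime P ⧸
      Ideal.ofList (rs.map (algebraMap A (Localization.AtPrime P)))) := by
    refine Ideal.Quotient.nontrivial_iff.2 fun e => hr.2 ?_
    rw [e]; simp
  have h0 : (0 : WithBot ℕ∞) ≤ ringKrullDim (Localization.AtPrime P ⧸
      Ideal.ofList (rs.map (algebraMap A (Localization.AtPrime P)))) :=
    ringKrullDim_nonneg_of_nontrivial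
  have h2 : ((rs.length : ℕ∞) : WithBot ℕ∞) ≤ (P.height : WithBot ℕ∞) := by
    rw [← h1]
    exact le_add_of_nonneg_left h0
  exact WithBot.coe_le_coe.1 h2

theorem exists_regular_mod_of_forall_associatedPrimes [IsNoetherianRing A] {I P : Ideal A}
    (h : ∀ q ∈ associatedPrimes A (A ⧸ I), ¬ P ≤ q) :
    ∃ y ∈ P, (∀ q ∈ associatedPrimes A (A ⧸ I), y ∉ q) ∧ ∀ x, y * x ∈ I → x ∈ I := by
  have hfin := associatedPrimes.finite A (A ⧸ I)
  obtain ⟨y, hy, hyq⟩ : ∃ y ∈ P, ∀ q ∈ associatedPrimes A (A ⧸ I), y ∉ q := by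
    by_contra! hc
    have hsub : (P : Set A) ⊆ ⋃ q ∈ (hfin.toFinset : Set (Ideal A)), ((id q : Ideal A) : Set A) := by
      intro z hz
      obtain ⟨q, h₁, h₃⟩ := hc z hz
      simp only [Set.mem_iUnion]
      exact ⟨q, by simp [h₁], h₃⟩
    rw [Ideal.subset_union_prime (f := id) ⊤ ⊤ (fun q hq _ _ => by simp at hq; exact hq.1)] at hsub
    obtain ⟨q, hq, hle⟩ := hsub
    exact h q (by simpa using hq) hle
  refine ⟨y, hy, hyq, fun x hx => ?_⟩
  by_contra hxI
  obtain ⟨q, hq, hle⟩ := exists_le_isAssociatedPrime_of_isNoetherianRing A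
    (Ideal.Quotient.mk I x) (by rwa [Ne, Ideal.Quotient.eq_zero_iff_mem])
  refine hyq q hq (hle ?_)
  rw [Submodule.mem_colon_singleton, Submodule.mem_bot, Algebra.smul_def,
    Ideal.Quotient.algebraMap_eq, ← map_mul, Ideal.Quotient.eq_zero_iff_mem]
  exact hx

theorem mem_associatedPrimes_quotient_iff [IsNoetherianRing A] {I P : Ideal A} [P.IsPrime] :
    P ∈ associatedPrimes A (A ⧸ I) ↔ ∃ b, ∀ x, x ∈ P ↔ x * b ∈ I := by
  rw [AssociatedPrimes.mem_iff, isAssociatedPrime_iff]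
  constructor
  · rintro ⟨-, b, hb⟩
    obtain ⟨b, rfl⟩ := Ideal.Quotient.mk_surjective b
    refine ⟨b, fun x => ?_⟩
    rw [hb, Submodule.mem_colon_singleton, Submodule.mem_bot, Algebra.smul_def,
      Ideal.Quotient.algebraMap_eq, ← map_mul, Ideal.Quotient.eq_zero_iff_mem]
  · rintro ⟨b, hb⟩
    refine ⟨‹_›, Ideal.Quotient.mk I b, ?_⟩
    ext x
    rw [hb, Submodule.mem_colon_singleton, Submodule.mem_bot, Algebra.smul_def,
      Ideal.Quotient.algebraMap_eq, ← map_mul, Ideal.Quotient.eq_zero_iff_mem]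

theorem minimalPrimes_subset_associatedPrimes_quotient [IsNoetherianRing A] {I P : Ideal A}
    (h : P ∈ I.minimalPrimes) : P ∈ associatedPrimes A (A ⧸ I) := by
  refine Module.associatedPrimes.minimalPrimes_annihilator_subset_associatedPrimes A (A ⧸ I) ?_
  rwa [Ideal.annihilator_quotient]

/-- Otherwise the colon ideal J = (I : q) satisfies J ⊆ I + yJ at P, since division by y, regular
modulo I, stays in J. Nakayama's lemma then gives J ⊆ I at P. But b lies in J, and its annihilator
modulo I is q ⊆ P. -/
theorem exists_forall_mul_notMem_of_nakayama [IsNoetherianRing A] {q P I : Ideal A} [P.IsPrime]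
    {b y : A} (hqP : q ≤ P) (hb : ∀ x, x ∈ q ↔ x * b ∈ I) (hyP : y ∈ P)
    (hy : ∀ x, y * x ∈ I → x ∈ I) :
    ∃ c, (∀ x ∈ q, x * c ∈ I) ∧ ∀ u ∉ P, u * c ∉ I ⊔ Ideal.span {y} := by
  by_contra! hc
  let L := Localization.AtPrime P
  let J : Ideal A := I.colon (q : Set A)
  have hJ : ∀ c, c ∈ J ↔ ∀ x ∈ q, x * c ∈ I := by
    intro c
    rw [Submodule.mem_colon]
    simp only [SetLike.mem_coe, smul_eq_mul, mul_comm c]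
  have hle : J.map (algebraMap A L) ≤
      I.map (algebraMap A L) ⊔ (Ideal.span {algebraMap A L y}) • J.map (algebraMap A L) := by
    rw [Ideal.map_le_iff_le_comap]
    intro c hcJ
    obtain ⟨u, hu, hmem⟩ := hc c ((hJ c).1 hcJ)
    obtain ⟨i, hi, w, hw, hsum⟩ := Submodule.mem_sup.1 hmem
    obtain ⟨d, rfl⟩ := Ideal.mem_span_singleton'.1 hw
    have hd : d ∈ J := by
      rw [hJ]
      intro x hx
      refine hy _ ?_
      have : y * (x * d) = u * (x * c) - x * i := by linear_combination x * hsum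
      rw [this]
      exact I.sub_mem (I.mul_mem_left _ ((hJ c).1 hcJ x hx)) (I.mul_mem_left _ hi)
    rw [Ideal.mem_comap]
    have hu' : IsUnit (algebraMap A L u) := IsLocalization.map_units L (⟨u, hu⟩ : P.primeCompl)
    refine (Ideal.unit_mul_mem_iff_mem _ hu').1 ?_
    rw [← map_mul, ← hsum, map_add]
    refine Ideal.add_mem _ (Ideal.mem_sup_left (Ideal.mem_map_of_mem _ hi))
      (Ideal.mem_sup_right ?_)
    rw [map_mul, mul_comm]
    exact Ideal.mul_mem_mul (Ideal.mem_span_singleton_self _) (Ideal.mem_map_of_mem _ hd)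
  have hnak := Submodule.le_of_le_smul_of_le_jacobson_bot
    (IsNoetherian.noetherian (J.map (algebraMap A L))) (by
      rw [IsLocalRing.jacobson_eq_maximalIdeal _ bot_ne_top, Ideal.span_singleton_le_iff_mem]
      exact (IsLocalization.AtPrime.to_map_mem_maximal_iff L P y).2 hyP) hle
  have hbJ : b ∈ J := (hJ b).2 fun x hx => (hb x).1 hx
  have := hnak (Ideal.mem_map_of_mem _ hbJ)
  rw [IsLocalization.algebraMap_mem_map_algebraMap_iff P.primeCompl] at this
  obtain ⟨u, hu, hub⟩ := this
  exact hu (hqP ((hb u).2 hub))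

/-- Catenarity of Cohen-Macaulay rings. -/
theorem IsCM.height_le_add_one [IsNoetherianRing A] (h : IsCM A) {q P : Ideal A} [q.IsPrime]
    [P.IsPrime] (hlt : q < P) (hbetween : ∀ p : Ideal A, p.IsPrime → q < p → p ≤ P → p = P) :
    P.height ≤ q.height + 1 := by
  by_contra! hcon
  obtain ⟨rs, h₁, h₂, h₃⟩ := h.exists_length_eq q
  have hI : Ideal.ofList rs ≤ q := Ideal.span_le.2 h₁
  have hqmin : q ∈ (Ideal.ofList rs).minimalPrimes := by
    refine Ideal.mem_minimalPrimes_of_height_le hI ?_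
    rw [h₃, Ideal.height_eq_inf_minimalPrimes]
    refine le_iInf₂ fun p hp => ?_
    have := hp.1.1
    exact length_le_height_of_isWeaklyRegular h₂ fun r hr => hp.1.2 (Ideal.subset_span hr)
  obtain ⟨b, hb⟩ := mem_associatedPrimes_quotient_iff.1
    (minimalPrimes_subset_associatedPrimes_quotient hqmin)
  have hcod := h.codepthLE_quotient_ofList h₂
  obtain ⟨y, hyP, hyq, hyreg⟩ := exists_regular_mod_of_forall_associatedPrimes
    (I := Ideal.ofList rs) (P := P) (by
      intro p hp hle
      have h4 := (Ideal.height_mono hle).trans (hcod.height_le hp)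
      rw [h₃] at hcon
      exact absurd (h4.trans (by exact_mod_cast Nat.le_succ _)) (not_le.2 hcon))
  -- The aim is to exhibit P as an associated prime of the quotient by rs and y, whose associated
  -- primes have height at most ht q + 1.
  obtain ⟨c, hcq, hcP⟩ := exists_forall_mul_notMem_of_nakayama hlt.le hb hyP hyreg
  set K := Ideal.ofList rs ⊔ Ideal.span {y} with hK
  have hreg' : IsWeaklyRegular A (rs ++ [y]) := by
    rw [isWeaklyRegular_append_iff, isWeaklyRegular_singleton_iff,
      isSMulRegular_quotient_iff_mem_of_smul_mem]
    refine ⟨h₂, fun x hx => ?_⟩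
    simp only [smul_eq_mul, Ideal.mul_top] at hx ⊢
    exact hyreg x hx
  have hcodK : CodepthLE A (rs.length + 1) (A ⧸ K) := by
    have := h.codepthLE_quotient_ofList hreg'
    rwa [Ideal.ofList_append, Ideal.ofList_singleton, List.length_append,
      List.length_singleton] at this
  have hcolon : ∀ x, x ∈ K.colon ({c} : Set A) ↔ x * c ∈ K := by
    intro x; simp [Submodule.mem_colon_singleton]
  -- A prime between (K : c) and P contains q, because q·c ⊆ K, and also contains y, which is not in
  -- q. As nothing lies strictly between q and P, it equals P.
  have hPmin : P ∈ (K.colon ({c} : Set A)).minimalPrimes := by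
    have hleP : K.colon ({c} : Set A) ≤ P := by
      intro u hu
      by_contra huP
      exact hcP u huP ((hcolon u).1 hu)
    obtain ⟨p, hp, hpP⟩ := Ideal.exists_minimalPrimes_le hleP
    have := hp.1.1
    have hqp : q ≤ p := fun x hx => hp.1.2 ((hcolon x).2 (Ideal.mem_sup_left (hcq x hx)))
    have hyp : y ∈ p := hp.1.2 ((hcolon y).2
      (K.mul_mem_right _ (Ideal.mem_sup_right (Ideal.mem_span_singleton_self y))))
    have hne : q < p := lt_of_le_of_ne hqp fun e => hyq q
      (minimalPrimes_subset_associatedPrimes_quotient hqmin) (e ▸ hyp)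
    rwa [← hbetween p hp.1.1 hne hpP]
  obtain ⟨x₀, hx₀⟩ := mem_associatedPrimes_quotient_iff.1
    (minimalPrimes_subset_associatedPrimes_quotient hPmin)
  have hPass : P ∈ associatedPrimes A (A ⧸ K) := by
    refine mem_associatedPrimes_quotient_iff.2 ⟨x₀ * c, fun x => ?_⟩
    rw [hx₀, hcolon, mul_assoc]
  have := hcodK.height_le hPass
  rw [h₃] at hcon
  exact absurd this (not_le.2 (by exact_mod_cast hcon))

/-- In a Cohen-Macaulay ring, cutting with one element raises heights by at most one. -/
theorem IsCM.height_le_add_one_of_mem_minimalPrimes [IsNoetherianRing A] (h : IsCM A)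
    {q P : Ideal A} [q.IsPrime] {s : A} (hs : s ∉ q)
    (hP : P ∈ (q ⊔ Ideal.span {s}).minimalPrimes) : P.height ≤ q.height + 1 := by
  have := hP.1.1
  have hqP : q ≤ P := le_sup_left.trans hP.1.2
  have hsP : s ∈ P := hP.1.2 (Ideal.mem_sup_right (Ideal.mem_span_singleton_self s))
  refine h.height_le_add_one (lt_of_le_of_ne hqP fun e => hs (e ▸ hsP)) ?_
  intro p hp hqp hpP
  have h1 := Ideal.map_height_le_one_of_mem_minimalPrimes hP
  have hprime : (P.map (Ideal.Quotient.mk q)).IsPrime :=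
    Ideal.map_isPrime_of_surjective Ideal.Quotient.mk_surjective (by rwa [Ideal.mk_ker])
  rw [← Nat.cast_one, Ideal.height_le_iff] at h1
  by_contra hne
  have hpP' : p < P := lt_of_le_of_ne hpP hne
  have hprime' : (p.map (Ideal.Quotient.mk q)).IsPrime :=
    Ideal.map_isPrime_of_surjective Ideal.Quotient.mk_surjective (by rw [Ideal.mk_ker]; exact hqp.le)
  have hcm : ∀ J : Ideal A, q ≤ J → (J.map (Ideal.Quotient.mk q)).comap (Ideal.Quotient.mk q) = J := by
    intro J hJ
    rw [Ideal.comap_map_of_surjective _ Ideal.Quotient.mk_surjective, ← RingHom.ker_eq_comap_bot,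
      Ideal.mk_ker, sup_eq_left.2 hJ]
  have hlt2 : p.map (Ideal.Quotient.mk q) < P.map (Ideal.Quotient.mk q) := by
    refine lt_of_le_of_ne (Ideal.map_mono hpP) fun e => hne ?_
    rw [← hcm p hqp.le, ← hcm P hqP, e]
  have h2 := h1 _ hprime' hlt2
  rw [Nat.cast_one, Order.lt_one_iff, Ideal.height_eq_zero_iff_eq_bot] at h2
  have := hcm p hqp.le
  rw [h2, ← RingHom.ker_eq_comap_bot, Ideal.mk_ker] at this
  exact hqp.ne this

end Catenary

/-! ### Ideals of minors: Laplace, Cramer, Schur complement -/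

section Minors

section AddColumn

variable {α : Type*} {t m : ℕ}

/-- Adding a last column. -/
def snocCol (M : Matrix (Fin t) (Fin m) α) (v : Fin t → α) : Matrix (Fin t) (Fin (m + 1)) α :=
  Matrix.of fun i => Fin.snoc (M i) (v i)

@[simp] theorem snocCol_castSucc (M : Matrix (Fin t) (Fin m) α) (v : Fin t → α) (i : Fin t)
    (j : Fin m) : snocCol M v i j.castSucc = M i j := by
  simp [snocCol]

@[simp] theorem snocCol_last (M : Matrix (Fin t) (Fin m) α) (v : Fin t → α) (i : Fin t) :
    snocCol M v i (Fin.last m) = v i := by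
  simp [snocCol]

theorem updateCol_snocCol (M : Matrix (Fin t) (Fin m) α) (v w : Fin t → α) :
    (snocCol M v).updateCol (Fin.last m) w = snocCol M w := by
  ext i j
  refine Fin.lastCases ?_ (fun j => ?_) j
  · simp
  · rw [Matrix.updateCol_ne (Fin.castSucc_lt_last j).ne]; simp

end AddColumn

variable {R : Type*} [CommRing R] {t m : ℕ} {ι κ : Type*}

/-- The ideal of maximal minors of a matrix with `t` rows. -/
noncomputable def maximalMinors (M : Matrix (Fin t) ι R) : Ideal R :=
  Ideal.span (Set.range fun g : Fin t → ι => (M.submatrix id g).det)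

/-- The ideal of `r × r` minors. -/
noncomputable def minorIdeal (r : ℕ) (M : Matrix ι κ R) : Ideal R :=
  Ideal.span (Set.range fun p : (Fin r → ι) × (Fin r → κ) => (M.submatrix p.1 p.2).det)

theorem det_mem_maximalMinors (M : Matrix (Fin t) ι R) (g : Fin t → ι) :
    (M.submatrix id g).det ∈ maximalMinors M :=
  Ideal.subset_span ⟨g, rfl⟩

theorem det_mem_minorIdeal {r : ℕ} (M : Matrix ι κ R) (f : Fin r → ι) (g : Fin r → κ) :
    (M.submatrix f g).det ∈ minorIdeal r M :=
  Ideal.subset_span ⟨(f, g), rfl⟩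

theorem maximalMinors_le {M : Matrix (Fin t) ι R} {I : Ideal R} :
    maximalMinors M ≤ I ↔ ∀ g : Fin t → ι, (M.submatrix id g).det ∈ I := by
  rw [maximalMinors, Ideal.span_le, Set.range_subset_iff]
  rfl

theorem minorIdeal_le {r : ℕ} {M : Matrix ι κ R} {I : Ideal R} :
    minorIdeal r M ≤ I ↔ ∀ (f : Fin r → ι) (g : Fin r → κ), (M.submatrix f g).det ∈ I := by
  rw [minorIdeal, Ideal.span_le, Set.range_subset_iff, Prod.forall]
  rfl

theorem maximalMinors_le_minorIdeal (M : Matrix (Fin t) ι R) :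
    maximalMinors M ≤ minorIdeal t M :=
  maximalMinors_le.2 fun g => det_mem_minorIdeal M id g

theorem minorIdeal_submatrix_le {r : ℕ} (M : Matrix ι κ R) {ι' κ' : Type*} (f : ι' → ι)
    (g : κ' → κ) : minorIdeal r (M.submatrix f g) ≤ minorIdeal r M :=
  minorIdeal_le.2 fun f' g' => det_mem_minorIdeal M (f ∘ f') (g ∘ g')

theorem maximalMinors_submatrix_le (M : Matrix (Fin t) ι R) (g : κ → ι) :
    maximalMinors (M.submatrix id g) ≤ maximalMinors M :=
  maximalMinors_le.2 fun g' => det_mem_maximalMinors M (g ∘ g')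

theorem maximalMinors_submatrix_equiv (M : Matrix (Fin t) ι R) (g : κ ≃ ι) :
    maximalMinors (M.submatrix id g) = maximalMinors M := by
  refine le_antisymm (maximalMinors_submatrix_le M g) ?_
  have := maximalMinors_submatrix_le (M.submatrix id g) g.symm
  simpa [Matrix.submatrix_submatrix] using this

theorem maximalMinors_zero_rows (M : Matrix (Fin 0) ι R) : maximalMinors M = ⊤ := by
  rw [Ideal.eq_top_iff_one]
  simpa using det_mem_maximalMinors M Fin.elim0

theorem minorIdeal_zero (M : Matrix ι κ R) : minorIdeal 0 M = ⊤ := by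
  rw [Ideal.eq_top_iff_one]
  simpa using det_mem_minorIdeal M Fin.elim0 Fin.elim0

theorem maximalMinors_eq_bot_of_lt (M : Matrix (Fin t) (Fin m) R) (h : m < t) :
    maximalMinors M = ⊥ := by
  rw [eq_bot_iff, maximalMinors_le]
  intro g
  obtain ⟨i, j, hij, hg⟩ := Fintype.exists_ne_map_eq_of_card_lt g (by simpa using h)
  rw [Ideal.mem_bot]
  exact Matrix.det_zero_of_column_eq hij fun k => by simp [hg]

theorem map_maximalMinors {S : Type*} [CommRing S] (φ : R →+* S) (M : Matrix (Fin t) ι R) :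
    (maximalMinors M).map φ = maximalMinors (M.map φ) := by
  rw [maximalMinors, maximalMinors, Ideal.map_span, ← Set.range_comp]
  congr 2
  ext g
  simp [RingHom.map_det, Matrix.submatrix_map]

/-- Multilinear expansion in the rows: the Cauchy-Binet formula before equal index sets are
collected, which is enough for containments of ideals. -/
theorem det_mul_eq_sum [Fintype ι] (X : Matrix (Fin t) ι R) (Y : Matrix ι (Fin t) R) :
    (X * Y).det = ∑ f : Fin t → ι, (∏ j, X j (f j)) * (Y.submatrix f id).det := by
  classical
  have h := (Matrix.detRowAlternating (n := Fin t) (R := R)).toMultilinearMap.map_sum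
    (fun j i => X j i • Y i)
  have h1 : (X * Y).det = Matrix.detRowAlternating (fun j => ∑ i, X j i • Y i) := by
    change Matrix.det _ = Matrix.det _
    congr 1
    ext a b
    simp [Matrix.mul_apply, Finset.sum_apply]
  rw [h1]
  refine h.trans (Finset.sum_congr rfl fun f _ => ?_)
  exact (Matrix.detRowAlternating (n := Fin t) (R := R)).toMultilinearMap.map_smul_univ
    (fun j => X j (f j)) (fun j => Y (f j))

theorem det_mul_eq_sum' [Fintype ι] (X : Matrix (Fin t) ι R) (Y : Matrix ι (Fin t) R) :
    (X * Y).det = ∑ f : Fin t → ι, (∏ j, Y (f j) j) * (X.submatrix id f).det := by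
  rw [← Matrix.det_transpose, Matrix.transpose_mul, det_mul_eq_sum]
  refine Finset.sum_congr rfl fun f _ => ?_
  rw [← Matrix.det_transpose (X.submatrix id f)]
  rfl

theorem maximalMinors_mul_le [Fintype ι] (M : Matrix (Fin t) ι R) (Q : Matrix ι κ R) :
    maximalMinors (M * Q) ≤ maximalMinors M := by
  refine maximalMinors_le.2 fun g => ?_
  have : (M * Q).submatrix id g = M * Q.submatrix id g := by
    ext a b; simp [Matrix.mul_apply]
  rw [this, det_mul_eq_sum']
  exact Ideal.sum_mem _ fun f _ => Ideal.mul_mem_left _ _ (det_mem_maximalMinors M f)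

theorem maximalMinors_mul_of_mul_eq_one [Fintype ι] [DecidableEq ι] [Fintype κ]
    (M : Matrix (Fin t) ι R)
    {Q : Matrix ι κ R} {Q' : Matrix κ ι R} (h : Q * Q' = 1) :
    maximalMinors (M * Q) = maximalMinors M := by
  refine le_antisymm (maximalMinors_mul_le M Q) ?_
  conv_lhs => rw [← Matrix.mul_one M, ← h, ← Matrix.mul_assoc]
  exact maximalMinors_mul_le _ _

theorem maximalMinors_mul_left_le (P : Matrix (Fin t) (Fin t) R) (M : Matrix (Fin t) ι R) :
    maximalMinors (P * M) ≤ maximalMinors M := by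
  refine maximalMinors_le.2 fun g => ?_
  have : (P * M).submatrix id g = P * M.submatrix id g := by
    ext a b; simp [Matrix.mul_apply]
  rw [this, Matrix.det_mul]
  exact Ideal.mul_mem_left _ _ (det_mem_maximalMinors M g)

theorem maximalMinors_mul_left_of_mul_eq_one {P P' : Matrix (Fin t) (Fin t) R} (h : P' * P = 1)
    (M : Matrix (Fin t) ι R) : maximalMinors (P * M) = maximalMinors M := by
  refine le_antisymm (maximalMinors_mul_left_le P M) ?_
  conv_lhs => rw [← Matrix.one_mul M, ← h, Matrix.mul_assoc]
  exact maximalMinors_mul_left_le _ _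

/-- Laplace expansion along a row. -/
theorem maximalMinors_le_submatrix_succAbove (M : Matrix (Fin (t + 1)) ι R) (i : Fin (t + 1)) :
    maximalMinors M ≤ maximalMinors (M.submatrix i.succAbove id) := by
  refine maximalMinors_le.2 fun g => ?_
  rw [Matrix.det_succ_row _ i]
  exact Ideal.sum_mem _ fun j _ => Ideal.mul_mem_left _ _
    (det_mem_maximalMinors (M.submatrix i.succAbove id) (g ∘ j.succAbove))

/-- The minor of `M` with columns `f`, completed by the column `v`, as a linear form in `v`. -/
noncomputable def borderedMinor (M : Matrix (Fin (t + 1)) ι R) (f : Fin t → ι) :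
    (Fin (t + 1) → R) →ₗ[R] R :=
  (LinearMap.proj (Fin.last t)) ∘ₗ Matrix.cramer (snocCol (M.submatrix id f) 0)

theorem borderedMinor_apply (M : Matrix (Fin (t + 1)) ι R) (f : Fin t → ι) (v : Fin (t + 1) → R) :
    borderedMinor M f v = (snocCol (M.submatrix id f) v).det := by
  simp [borderedMinor, Matrix.cramer_apply, updateCol_snocCol]

theorem borderedMinor_col (M : Matrix (Fin (t + 1)) ι R) (f : Fin t → ι) (j : ι) :
    borderedMinor M f (fun i => M i j) ∈ maximalMinors M := by
  rw [borderedMinor_apply]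
  convert det_mem_maximalMinors M (Fin.snoc f j) using 2
  ext a b
  refine Fin.lastCases ?_ (fun b => ?_) b <;> simp

/-- Cramer's rule for the square matrix with columns `f` of M followed by v, applied to the
right-hand side w. -/
theorem borderedMinor_mul_apply (M : Matrix (Fin (t + 1)) ι R) (f : Fin t → ι)
    (v w : Fin (t + 1) → R) : ∃ c : Fin t → R, ∀ i,
      borderedMinor M f v * w i = ∑ l, c l * M i (f l) + borderedMinor M f w * v i := by
  refine ⟨fun l => Matrix.cramer (snocCol (M.submatrix id f) v) w l.castSucc, fun i => ?_⟩
  have := congrFun (Matrix.mulVec_cramer (snocCol (M.submatrix id f) v) w) i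
  rw [borderedMinor_apply, ← smul_eq_mul, ← Pi.smul_apply, ← this, Matrix.mulVec, dotProduct,
    Fin.sum_univ_castSucc]
  congr 1
  · refine Finset.sum_congr rfl fun l _ => ?_
    rw [snocCol_castSucc, mul_comm, Matrix.submatrix_apply, id]
  · rw [snocCol_last, mul_comm, Matrix.cramer_apply, updateCol_snocCol, borderedMinor_apply]

/-- Modulo the maximal minors of `M`, the bordered minors with respect to `v` and `w` are
proportional. -/
theorem borderedMinor_mul_sub_mem (M : Matrix (Fin (t + 1)) ι R) (f f' : Fin t → ι)
    (v w : Fin (t + 1) → R) :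
    borderedMinor M f v * borderedMinor M f' w - borderedMinor M f w * borderedMinor M f' v ∈
      maximalMinors M := by
  obtain ⟨c, hc⟩ := borderedMinor_mul_apply M f v w
  have h : borderedMinor M f v • w - borderedMinor M f w • v =
      ∑ l, c l • (fun i => M i (f l)) := by
    ext i
    simp [hc i]
  have h2 := congrArg (borderedMinor M f') h
  rw [map_sub, map_smul, map_smul, map_sum] at h2
  rw [← smul_eq_mul, ← smul_eq_mul, h2]
  refine Ideal.sum_mem _ fun l _ => ?_
  rw [map_smul, smul_eq_mul]
  exact Ideal.mul_mem_left _ _ (borderedMinor_col M f' _)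

theorem borderedMinor_single (M : Matrix (Fin (t + 1)) ι R) (f : Fin t → ι) (i : Fin (t + 1))
    (a : R) : borderedMinor M f (Pi.single i a) =
      (-1) ^ (i + t : ℕ) * a * (M.submatrix i.succAbove f).det := by
  rw [borderedMinor_apply, Matrix.det_succ_column _ (Fin.last t), Finset.sum_eq_single i]
  · rw [snocCol_last, Pi.single_eq_same, Fin.val_last]
    congr 2
    ext a b
    simp
  · intro j _ hj
    rw [snocCol_last, Pi.single_eq_of_ne hj]
    simp
  · simp

theorem borderedMinor_mem_minorIdeal (M : Matrix (Fin (t + 1)) ι R) (f : Fin t → ι)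
    (v : Fin (t + 1) → R) : borderedMinor M f v ∈ minorIdeal t M := by
  have h : v = ∑ i, Pi.single i (v i) := (Finset.univ_sum_single v).symm
  rw [h, map_sum]
  refine Ideal.sum_mem _ fun i _ => ?_
  rw [borderedMinor_single]
  exact Ideal.mul_mem_left _ _ (det_mem_minorIdeal _ _ _)

theorem exists_perm_of_unique_last {g : Fin (t + 1) → Fin (m + 1)} {j₀ : Fin (t + 1)}
    (h₀ : g j₀ = Fin.last m) (h : ∀ j ≠ j₀, g j ≠ Fin.last m) :
    ∃ (f : Fin t → Fin m) (σ : Equiv.Perm (Fin (t + 1))),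
      g = (Fin.snoc (fun j => (f j).castSucc) (Fin.last m) : Fin (t + 1) → Fin (m + 1)) ∘ σ := by
  have h1 : ∀ i : Fin t, ∃ y : Fin m, y.castSucc = g (j₀.succAbove i) := fun i =>
    Fin.exists_castSucc_eq.2 (h _ (Fin.succAbove_ne j₀ i))
  choose f hf using h1
  refine ⟨f, (finSuccEquiv' j₀).trans (finSuccEquiv' (Fin.last t)).symm, ?_⟩
  ext j
  refine Fin.succAboveCases j₀ ?_ (fun i => ?_) j
  · simp [h₀]
  · simp [hf]

/-- The maximal minors of a matrix with an added column. -/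
theorem maximalMinors_snocCol (M : Matrix (Fin (t + 1)) (Fin m) R) (v : Fin (t + 1) → R) :
    maximalMinors (snocCol M v) =
      maximalMinors M ⊔ Ideal.span (Set.range fun f : Fin t → Fin m => borderedMinor M f v) := by
  have hsub : ∀ g : Fin (t + 1) → Fin m,
      (snocCol M v).submatrix id (Fin.castSucc ∘ g) = M.submatrix id g := by
    intro g; ext a b; simp
  have hsn : ∀ f : Fin t → Fin m,
      (snocCol M v).submatrix id
        (Fin.snoc (fun j => (f j).castSucc) (Fin.last m) : Fin (t + 1) → Fin (m + 1)) =
      snocCol (M.submatrix id f) v := by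
    intro f; ext a b
    refine Fin.lastCases ?_ (fun b => ?_) b <;> simp
  refine le_antisymm (maximalMinors_le.2 fun g => ?_) (sup_le (maximalMinors_le.2 fun g => ?_) ?_)
  · by_cases hg : ∃ j₀, g j₀ = Fin.last m
    · obtain ⟨j₀, h₀⟩ := hg
      by_cases h : ∀ j ≠ j₀, g j ≠ Fin.last m
      · obtain ⟨f, σ, rfl⟩ := exists_perm_of_unique_last h₀ h
        have : (snocCol M v).submatrix id
            ((Fin.snoc (fun j => (f j).castSucc) (Fin.last m) : Fin (t + 1) → Fin (m + 1)) ∘ σ) =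
            (snocCol (M.submatrix id f) v).submatrix id σ := by
          rw [← hsn, Matrix.submatrix_submatrix]; rfl
        rw [this, Matrix.det_permute', ← borderedMinor_apply]
        exact Ideal.mul_mem_left _ _ (Ideal.mem_sup_right (Ideal.subset_span ⟨f, rfl⟩))
      · push Not at h
        obtain ⟨j, hj, hj'⟩ := h
        rw [Matrix.det_zero_of_column_eq hj fun k => by simp [h₀, hj']]
        exact Ideal.zero_mem _
    · push Not at hg
      choose f hf using fun j => Fin.exists_castSucc_eq.2 (hg j)
      obtain rfl : g = Fin.castSucc ∘ f := by ext j; simp [hf]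
      rw [hsub]
      exact Ideal.mem_sup_left (det_mem_maximalMinors M f)
  · rw [← hsub]
    exact det_mem_maximalMinors _ _
  · rw [Ideal.span_le]
    rintro _ ⟨f, rfl⟩
    change borderedMinor M f v ∈ maximalMinors (snocCol M v)
    rw [borderedMinor_apply, ← hsn]
    exact det_mem_maximalMinors _ _

/-- The Schur complement of the entry `(p, q)`, where `u` is an inverse of that entry. -/
def schur (M : Matrix (Fin (t + 1)) (Fin (m + 1)) R) (p : Fin (t + 1)) (q : Fin (m + 1)) (u : R) :
    Matrix (Fin t) (Fin m) R :=
  Matrix.of fun i j => M (p.succAbove i) (q.succAbove j) -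
    u * M (p.succAbove i) q * M p (q.succAbove j)

/-- Subtracting multiples of the pivot row clears the pivot column, and the remaining block is the
Schur complement. Minors of size r + 1 of M through the pivot thus control minors of size r of the
complement. -/
theorem det_submatrix_cons_eq_mul_schur (M : Matrix (Fin (t + 1)) (Fin (m + 1)) R)
    {p : Fin (t + 1)} {q : Fin (m + 1)} {u : R} (hu : u * M p q = 1) {r : ℕ} (f : Fin r → Fin t)
    (g : Fin r → Fin m) :
    (M.submatrix (Fin.cons p (p.succAbove ∘ f) : Fin (r + 1) → Fin (t + 1))
      (Fin.cons q (q.succAbove ∘ g) : Fin (r + 1) → Fin (m + 1))).det =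
    M p q * ((schur M p q u).submatrix f g).det := by
  set N : Matrix (Fin (r + 1)) (Fin (r + 1)) R :=
    M.submatrix (Fin.cons p (p.succAbove ∘ f) : Fin (r + 1) → Fin (t + 1))
      (Fin.cons q (q.succAbove ∘ g) : Fin (r + 1) → Fin (m + 1)) with hN
  let c : Fin (r + 1) → R := Fin.cons 0 fun i => - (u * M (p.succAbove (f i)) q)
  have h1 : (Matrix.of fun i j => N i j + c i * N 0 j).det = N.det :=
    Matrix.det_eq_of_forall_row_eq_smul_add_const c 0 (by simp [c]) (fun i j => rfl)
  rw [← h1, Matrix.det_succ_column_zero, Fin.sum_univ_succ]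
  rw [Finset.sum_eq_zero]
  · simp only [Fin.val_zero, pow_zero, one_mul, add_zero]
    congr 1
    · simp [hN, c]
    · congr 1
      ext i j
      simp [hN, c, schur]
      ring
  · intro i _
    have : N i.succ 0 + c i.succ * N 0 0 = 0 := by
      simp [hN, c]
      linear_combination (-M (p.succAbove (f i)) q) * hu
    simp [this]

theorem maximalMinors_schur (M : Matrix (Fin (t + 1)) (Fin (m + 1)) R)
    {p : Fin (t + 1)} {q : Fin (m + 1)} {u : R} (hu : u * M p q = 1) :
    maximalMinors (schur M p q u) = maximalMinors M := by
  have hunit : IsUnit (M p q) := IsUnit.of_mul_eq_one _ (by rwa [mul_comm])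
  refine le_antisymm (maximalMinors_le.2 fun g => ?_) (maximalMinors_le.2 fun g => ?_)
  · refine (Ideal.unit_mul_mem_iff_mem _ hunit).1 ?_
    rw [← det_submatrix_cons_eq_mul_schur M hu]
    let σ : Fin (t + 1) → Fin (t + 1) := Fin.cons p (p.succAbove ∘ id)
    have hσ : Function.Bijective σ := by
      rw [← Finite.injective_iff_bijective, Fin.cons_injective_iff]
      exact ⟨by simp, Fin.succAbove_right_injective⟩
    let e := Equiv.ofBijective σ hσ
    have : M.submatrix σ (Fin.cons q (q.succAbove ∘ g) : Fin (t + 1) → Fin (m + 1)) =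
      (M.submatrix id (Fin.cons q (q.succAbove ∘ g) : Fin (t + 1) → Fin (m + 1))).submatrix e id :=
      rfl
    change (M.submatrix σ _).det ∈ _
    rw [this, Matrix.det_permute]
    exact Ideal.mul_mem_left _ _ (det_mem_maximalMinors M _)
  · let c : Fin (t + 1) → R := fun i => if i = p then 0 else - (u * M i q)
    let N : Matrix (Fin (t + 1)) (Fin (m + 1)) R := Matrix.of fun i j => M i j + c i * M p j
    have h1 : (N.submatrix id g).det = (M.submatrix id g).det :=
      Matrix.det_eq_of_forall_row_eq_smul_add_const c p (by simp [c]) (fun i j => rfl)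
    have hc : ∀ i, c (p.succAbove i) = - (u * M (p.succAbove i) q) := fun i => by
      simp [c]
    rw [← h1, Matrix.det_succ_row _ p]
    refine Ideal.sum_mem _ fun j _ => Ideal.mul_mem_left _ _ ?_
    -- After elimination, column q vanishes off row p, so a minor not using row p is zero when it
    -- involves q and is a minor of the Schur complement when it does not.
    by_cases hj : ∃ l, g (j.succAbove l) = q
    · obtain ⟨l, hl⟩ := hj
      rw [Matrix.det_eq_zero_of_column_eq_zero l]
      · exact Ideal.zero_mem _
      · intro i
        simp only [Matrix.submatrix_apply, id, hl, N, Matrix.of_apply, hc]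
        linear_combination (-M (p.succAbove i) q) * hu
    · push Not at hj
      choose h hh using fun l => Fin.exists_succAbove_eq (hj l)
      convert det_mem_maximalMinors (schur M p q u) h using 2
      ext a b
      simp only [Matrix.submatrix_apply, id, N, Matrix.of_apply, hc, schur, hh]
      ring

theorem exists_perm_eq_succAbove_comp {f : Fin t → Fin (t + 1)} (hf : Function.Injective f) :
    ∃ (i : Fin (t + 1)) (σ : Equiv.Perm (Fin t)), f = i.succAbove ∘ σ := by
  obtain ⟨i, hi⟩ : ∃ i, ∀ x, f x ≠ i := by
    by_contra! h
    have := Fintype.card_le_of_surjective f h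
    simp at this
  choose σ hσ using fun x => Fin.exists_succAbove_eq (hi x)
  have hinj : Function.Injective σ := fun x y h => hf (by rw [← hσ, ← hσ, h])
  refine ⟨i, Equiv.ofBijective σ (Finite.injective_iff_bijective.1 hinj), ?_⟩
  ext x; simp [hσ]

theorem exists_succAbove_of_det_ne_zero {M : Matrix (Fin (t + 1)) ι R} {f : Fin t → Fin (t + 1)}
    {g : Fin t → ι} (h : (M.submatrix f g).det ≠ 0) :
    ∃ i : Fin (t + 1), Associated (M.submatrix f g).det (M.submatrix i.succAbove g).det := by
  have hf : Function.Injective f := by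
    intro x y hxy
    by_contra hne
    exact h (Matrix.det_zero_of_row_eq hne (by ext k; simp [hxy]))
  obtain ⟨i, σ, rfl⟩ := exists_perm_eq_succAbove_comp hf
  refine ⟨i, ?_⟩
  have : M.submatrix (i.succAbove ∘ σ) g = (M.submatrix i.succAbove g).submatrix σ id := rfl
  rw [this, Matrix.det_permute]
  refine associated_unit_mul_left _ _ ?_
  exact ((Equiv.Perm.sign σ).isUnit.map (Int.castRingHom R))

theorem minorIdeal_le_iff_succAbove {M : Matrix (Fin (t + 1)) ι R} {I : Ideal R} :
    minorIdeal t M ≤ I ↔ ∀ i : Fin (t + 1), maximalMinors (M.submatrix i.succAbove id) ≤ I := by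
  refine ⟨fun h i => (maximalMinors_le.2 fun g => h (det_mem_minorIdeal M i.succAbove g)),
    fun h => minorIdeal_le.2 fun f g => ?_⟩
  by_cases h0 : (M.submatrix f g).det = 0
  · rw [h0]; exact I.zero_mem
  · obtain ⟨i, hi⟩ := exists_succAbove_of_det_ne_zero h0
    exact Ideal.mem_of_dvd _ hi.symm.dvd
      (h i (det_mem_maximalMinors (M.submatrix i.succAbove id) g))

/-- If some submaximal minor is a unit, then few maximal minors generate. -/
theorem exists_finset_span_eq_maximalMinors [Nontrivial R] {M : Matrix (Fin (t + 1)) (Fin m) R}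
    {f : Fin t → Fin (t + 1)} {g : Fin t → Fin m} (h : IsUnit (M.submatrix f g).det) :
    ∃ s : Finset R, s.card + t ≤ m ∧ Ideal.span (s : Set R) = maximalMinors M := by
  classical
  obtain ⟨i, hi⟩ := exists_succAbove_of_det_ne_zero h.ne_zero
  have hu : IsUnit (borderedMinor M g (Pi.single i 1)) := by
    rw [borderedMinor_single, mul_one]
    exact (IsUnit.pow _ isUnit_one.neg).mul (hi.isUnit h)
  have hg : Function.Injective g := by
    intro x y hxy
    by_contra hne
    exact h.ne_zero (Matrix.det_zero_of_column_eq hne (by intro k; simp [hxy]))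
  let v : Fin (t + 1) → R := Pi.single i 1
  -- The generators are the bordered minors of the columns outside `g`; those of the columns in `g`
  -- vanish for having a repeated column. This leaves at most m - t of them.
  let b : Fin m → R := fun j => borderedMinor M g (fun i => M i j)
  let s : Finset R := ((Finset.univ.image g)ᶜ).image b
  have hb : ∀ j, b j ∈ Ideal.span (s : Set R) := by
    intro j
    by_cases hj : j ∈ Finset.univ.image g
    · obtain ⟨l, -, rfl⟩ := Finset.mem_image.1 hj
      have : b (g l) = 0 := by
        simp only [b]
        rw [borderedMinor_apply]
        refine Matrix.det_zero_of_column_eq (Fin.castSucc_lt_last l).ne fun k => ?_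
        simp
      rw [this]
      exact Ideal.zero_mem _
    · exact Ideal.subset_span (Finset.mem_coe.2 (Finset.mem_image_of_mem _ (by simpa using hj)))
  refine ⟨s, ?_, le_antisymm ?_ ?_⟩
  · have h1 : s.card ≤ ((Finset.univ.image g)ᶜ).card := Finset.card_image_le
    have h2 := Finset.card_add_card_compl (Finset.univ.image g)
    rw [Finset.card_image_of_injective _ hg] at h2
    simp only [Finset.card_univ, Fintype.card_fin] at h2
    omega
  · rw [Ideal.span_le]
    intro x hx
    obtain ⟨j, -, rfl⟩ := Finset.mem_image.1 (Finset.mem_coe.1 hx)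
    exact borderedMinor_col M g j
  · refine maximalMinors_le.2 fun h => ?_
    choose c hc using fun j => borderedMinor_mul_apply M g v (fun i => M i j)
    set w := borderedMinor M g v with hw
    -- Cramer's rule writes every column of M in terms of the columns `g` and the basis vector v,
    -- with unit denominator w and v-coefficients `b`. Expanding the second factor along its last
    -- row puts each maximal minor in the span of the `b`.
    have hfac : w • M.submatrix id h = snocCol (M.submatrix id g) v *
        Matrix.of (Fin.snoc (fun l j => c (h j) l) (fun j => b (h j)) :
          Fin (t + 1) → Fin (t + 1) → R) := by
      ext a j
      rw [Matrix.mul_apply, Fin.sum_univ_castSucc]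
      simp only [Matrix.smul_apply, Matrix.submatrix_apply, id, smul_eq_mul, hc, snocCol_castSucc,
        snocCol_last, Matrix.of_apply, Fin.snoc_castSucc, Fin.snoc_last]
      simp only [b, mul_comm]
    have hdet := congrArg Matrix.det hfac
    rw [Matrix.det_smul, Matrix.det_mul] at hdet
    refine (Ideal.unit_mul_mem_iff_mem _ (hu.pow (Fintype.card (Fin (t + 1))))).1 ?_
    rw [hdet]
    refine Ideal.mul_mem_left _ _ ?_
    rw [Matrix.det_succ_row _ (Fin.last t)]
    refine Ideal.sum_mem _ fun j _ => Ideal.mul_mem_right _ _ (Ideal.mul_mem_left _ _ ?_)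
    simpa using hb (h j)

end Minors

/-! ### General column combinations over an infinite field -/

section GeneralPosition

section Rank

variable {K : Type*} [Field K]

theorem exists_det_ne_zero_of_linearIndependent_row {r : ℕ} {κ : Type*} [Fintype κ]
    {X : Matrix (Fin r) κ K} (h : LinearIndependent K X.row) :
    ∃ g : Fin r → κ, (X.submatrix id g).det ≠ 0 := by
  have hr := h.rank_matrix
  rw [Matrix.rank_eq_finrank_span_cols, Fintype.card_fin] at hr
  obtain ⟨f, hf, -, hli⟩ := Submodule.exists_fun_fin_finrank_span_eq K (Set.range X.col)
  choose g hg using hf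
  refine ⟨g ∘ Fin.cast hr.symm, ?_⟩
  have : LinearIndependent K (X.submatrix id (g ∘ Fin.cast hr.symm)).col := by
    have h1 : (X.submatrix id (g ∘ Fin.cast hr.symm)).col = f ∘ Fin.cast hr.symm := by
      funext j
      exact hg _
    rw [h1]
    exact hli.comp _ (Fin.cast_injective _)
  rw [Matrix.linearIndependent_cols_iff_isUnit, Matrix.isUnit_iff_isUnit_det] at this
  exact this.ne_zero

theorem le_rank_iff_exists_det_ne_zero {ι κ : Type*} [Fintype ι] [Fintype κ] {X : Matrix ι κ K}
    {r : ℕ} : r ≤ X.rank ↔ ∃ (f : Fin r → ι) (g : Fin r → κ), (X.submatrix f g).det ≠ 0 := by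
  constructor
  · intro h
    obtain ⟨f, hf, -, hli⟩ := Submodule.exists_fun_fin_finrank_span_eq K (Set.range X.row)
    replace h := h.trans_eq (Matrix.rank_eq_finrank_span_row X)
    choose f' hf' using hf
    have : LinearIndependent K (X.submatrix (f' ∘ Fin.castLE h) id).row := by
      have h1 : (X.submatrix (f' ∘ Fin.castLE h) id).row = f ∘ Fin.castLE h := by
        funext j
        exact hf' _
      rw [h1]
      exact hli.comp _ (Fin.castLE_injective _)
    obtain ⟨g, hg⟩ := exists_det_ne_zero_of_linearIndependent_row this
    exact ⟨_, _, hg⟩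
  · rintro ⟨f, g, h⟩
    have := Matrix.rank_submatrix_le X f g
    rwa [Matrix.rank_of_det_ne_zero h, Fintype.card_fin] at this

/-- Turns conditions on heights of minor ideals into rank conditions over residue fields, where
genericity is avoidance of subspaces. -/
theorem minorIdeal_le_iff_rank_lt {A : Type*} [CommRing A] {ι κ : Type*} [Fintype ι] [Fintype κ]
    {M : Matrix ι κ A} {r : ℕ} (P : Ideal A) [P.IsPrime] :
    minorIdeal r M ≤ P ↔ (M.map (algebraMap A P.ResidueField)).rank < r := by
  rw [← not_le, le_rank_iff_exists_det_ne_zero, minorIdeal_le]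
  push Not
  refine forall₂_congr fun f g => ?_
  rw [← Ideal.algebraMap_residueField_eq_zero, RingHom.map_det]
  rfl

end Rank

theorem minorIdeal_le_maximalMinors {R : Type*} [CommRing R] {t : ℕ} {ι : Type*}
    (M : Matrix (Fin t) ι R) : minorIdeal t M ≤ maximalMinors M := by
  refine minorIdeal_le.2 fun f g => ?_
  by_cases hf : Function.Injective f
  · have : M.submatrix f g = (M.submatrix id g).submatrix
        (Equiv.ofBijective f (Finite.injective_iff_bijective.1 hf)) id := rfl
    rw [this, Matrix.det_permute]
    exact Ideal.mul_mem_left _ _ (det_mem_maximalMinors M g)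
  · simp only [Function.Injective, not_forall] at hf
    obtain ⟨x, y, hxy, hne⟩ := hf
    rw [Matrix.det_zero_of_row_eq hne (by ext k; simp [hxy])]
    exact Ideal.zero_mem _

theorem minorIdeal_eq_maximalMinors {R : Type*} [CommRing R] {t : ℕ} {ι : Type*}
    (M : Matrix (Fin t) ι R) : minorIdeal t M = maximalMinors M :=
  le_antisymm (minorIdeal_le_maximalMinors M) (maximalMinors_le_minorIdeal M)

section Avoid

variable {k E : Type*} [Field k] [Infinite k] [AddCommGroup E] [Module k E]

theorem exists_forall_notMem_of_finite (𝒱 : Set (Submodule k E)) (hfin : 𝒱.Finite)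
    (h : ∀ V ∈ 𝒱, V ≠ ⊤) : ∃ w : E, ∀ V ∈ 𝒱, w ∉ V := by
  have h1 := Subspace.biUnion_ne_univ_of_top_notMem (s := hfin.toFinset)
    (fun hV => h ⊤ (by simpa using hV) rfl)
  obtain ⟨w, hw⟩ := (Set.ne_univ_iff_exists_notMem _).1 h1
  exact ⟨w, fun V hV hwV => hw (Set.mem_biUnion (by simpa using hV) hwV)⟩

end Avoid

variable {k : Type*} [Field k] {A : Type u} [CommRing A] [Algebra k A] {t m l : ℕ}

/-- The matrix whose columns are the linear combinations of the columns of `M` with the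
coefficient vectors `W`. -/
def colComb {s : ℕ} (M : Matrix (Fin t) (Fin l) A) (W : Fin s → Fin l → k) :
    Matrix (Fin t) (Fin s) A :=
  M * (Matrix.of W).transpose.map (algebraMap k A)

theorem colComb_snoc {s : ℕ} (M : Matrix (Fin t) (Fin l) A) (W : Fin s → Fin l → k)
    (w : Fin l → k) : ∃ v, colComb M (Fin.snoc W w : Fin (s + 1) → Fin l → k) =
      snocCol (colComb M W) v := by
  refine ⟨fun i => colComb M (Fin.snoc W w : Fin (s + 1) → Fin l → k) i (Fin.last s), ?_⟩
  ext i j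
  refine Fin.lastCases ?_ (fun j => ?_) j
  · simp
  · simp [colComb, Matrix.mul_apply]

theorem colComb_map_col {s : ℕ} (M : Matrix (Fin t) (Fin l) A) (W : Fin s → Fin l → k)
    (P : Ideal A) [P.IsPrime] :
    ((colComb M W).map (algebraMap A P.ResidueField)).col =
      fun j => Fintype.linearCombination k (M.map (algebraMap A P.ResidueField)).col (W j) := by
  funext j i
  rw [Fintype.linearCombination_apply, Finset.sum_apply]
  simp [colComb, Matrix.mul_apply, Algebra.smul_def, mul_comm, ← IsScalarTower.algebraMap_apply]

variable [IsNoetherianRing A] [Infinite k]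

/-- Only finitely many primes can obstruct the new bound: minimal primes of the old minor ideals of
height below e. At each of them M has rank at least t but the chosen columns have smaller rank, so a
general combination of the columns of M raises that rank. The bounds for all r have to be carried
together, since the step for r uses the old bound for r - 1. -/
theorem exists_snoc_forall_height {s e : ℕ} (M : Matrix (Fin t) (Fin l) A)
    (hM : ∀ P : Ideal A, P.IsPrime → maximalMinors M ≤ P → (e : ℕ∞) ≤ P.height)
    (W : Fin s → Fin l → k) (hW : LinearIndependent k W) (hs : s < l)
    (hG : ∀ r ≤ t, ∀ P : Ideal A, P.IsPrime → minorIdeal r (colComb M W) ≤ P →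
      ((min (s + 1 - r) e : ℕ) : ℕ∞) ≤ P.height) :
    ∃ w : Fin l → k, LinearIndependent k (Fin.snoc W w : Fin (s + 1) → Fin l → k) ∧
      ∀ r ≤ t, ∀ P : Ideal A, P.IsPrime →
        minorIdeal r (colComb M (Fin.snoc W w : Fin (s + 1) → Fin l → k)) ≤ P →
        ((min (s + 1 + 1 - r) e : ℕ) : ℕ∞) ≤ P.height := by
  classical
  let Ps : Set (PrimeSpectrum A) := {P | P.asIdeal.height < e ∧ ∃ r ≤ t,
    P.asIdeal ∈ (minorIdeal r (colComb M W)).minimalPrimes}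
  have hPs : Ps.Finite := by
    have h1 : (⋃ r ∈ Finset.range (t + 1), (minorIdeal r (colComb M W)).minimalPrimes).Finite :=
      Set.Finite.biUnion (Finset.finite_toSet _)
        fun r _ => Ideal.finite_minimalPrimes_of_isNoetherianRing A _
    refine (h1.preimage (f := PrimeSpectrum.asIdeal)
      (fun x _ y _ h => PrimeSpectrum.ext h)).subset ?_
    rintro P ⟨-, r, hr, hP⟩
    exact Set.mem_biUnion (x := r) (by simpa [Nat.lt_succ_iff] using hr) hP
  -- Coefficient vectors whose combination of columns does not raise the rank at P.
  let V : PrimeSpectrum A → Submodule k (Fin l → k) := fun P =>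
    ((Submodule.span P.asIdeal.ResidueField (Set.range
      ((colComb M W).map (algebraMap A P.asIdeal.ResidueField)).col)).restrictScalars k).comap
      (Fintype.linearCombination k (M.map (algebraMap A P.asIdeal.ResidueField)).col)
  have hV : ∀ P ∈ Ps, V P ≠ ⊤ := by
    rintro P ⟨hPe, r, hr, hP⟩ htop
    have h1 := (minorIdeal_le_iff_rank_lt P.asIdeal).1 hP.1.2
    have h2 : ¬ minorIdeal t M ≤ P.asIdeal := fun h =>
      hPe.not_ge (hM _ P.2 ((maximalMinors_le_minorIdeal M).trans h))
    rw [minorIdeal_le_iff_rank_lt, not_lt, Matrix.rank_eq_finrank_span_cols] at h2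
    rw [Matrix.rank_eq_finrank_span_cols] at h1
    have h3 : Submodule.span P.asIdeal.ResidueField
        (Set.range (M.map (algebraMap A P.asIdeal.ResidueField)).col) ≤
        Submodule.span P.asIdeal.ResidueField (Set.range
      ((colComb M W).map (algebraMap A P.asIdeal.ResidueField)).col) := by
      rw [Submodule.span_le]
      rintro _ ⟨j, rfl⟩
      have : (Pi.single j 1 : Fin l → k) ∈ V P := by rw [htop]; trivial
      simpa [V] using! this
    have := Submodule.finrank_mono h3
    omega
  have hspan : Submodule.span k (Set.range W) ≠ ⊤ := by
    intro h
    have h1 := finrank_span_eq_card hW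
    rw [h, finrank_top] at h1
    simp at h1
    omega
  obtain ⟨w, hw⟩ := exists_forall_notMem_of_finite
    (insert (Submodule.span k (Set.range W)) (V '' Ps)) ((hPs.image V).insert _) (by
      rintro _ (rfl | ⟨P, hP, rfl⟩)
      · exact hspan
      · exact hV P hP)
  refine ⟨w, linearIndependent_finSnoc.2 ⟨hW, hw _ (Set.mem_insert _ _)⟩, ?_⟩
  intro r hr P hPp hP
  by_contra! hlt
  have hsub : colComb M W =
      (colComb M (Fin.snoc W w : Fin (s + 1) → Fin l → k)).submatrix id Fin.castSucc := by
    ext i j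
    simp [colComb, Matrix.mul_apply]
  have hP' : minorIdeal r (colComb M W) ≤ P := by
    rw [hsub]
    exact (minorIdeal_submatrix_le _ _ _).trans hP
  have hPe : P.height < e := hlt.trans_le (by exact_mod_cast min_le_right _ _)
  -- If P were not minimal over the old minor ideal, the old bound at a smaller prime plus one would
  -- already give the new bound.
  have hmin : P ∈ (minorIdeal r (colComb M W)).minimalPrimes := by
    obtain ⟨Q, hQ, hQP⟩ := Ideal.exists_minimalPrimes_le hP'
    rcases hQP.eq_or_lt with rfl | hQP
    · exact hQ
    · exfalso
      have := hQ.1.1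
      have h1 := hG r hr Q hQ.1.1 hQ.1.2
      have h2 : Q.height + 1 ≤ P.height := by
        exact Ideal.height_add_one_le_of_lt_of_isPrime hQP
      have h3 := (add_le_add_left h1 1).trans_lt (h2.trans_lt hlt)
      norm_cast at h3
      omega
  have hmem : (⟨P, hPp⟩ : PrimeSpectrum A) ∈ Ps := ⟨hPe, r, hr, hmin⟩
  have hwP := hw (V ⟨P, hPp⟩) (Set.mem_insert_of_mem _ ⟨_, hmem, rfl⟩)
  obtain _ | r := r
  · rw [minorIdeal_zero] at hP
    exact hPp.ne_top (top_le_iff.1 hP)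
  -- With r + 1 in the role of r, the old bound for r-minors is exactly the bound that P violates.
  -- Hence the old columns have rank exactly r at P, and the new one raises it to r + 1.
  have hr1 : ¬ minorIdeal r (colComb M W) ≤ P := fun h => by
    have := (hG r (by omega) P hPp h).trans_lt hlt
    norm_cast at this
    omega
  rw [minorIdeal_le_iff_rank_lt, not_lt, Matrix.rank_eq_finrank_span_cols] at hr1
  rw [minorIdeal_le_iff_rank_lt, Matrix.rank_eq_finrank_span_cols] at hP
  have hlt2 : Submodule.span P.ResidueField (Set.range
      ((colComb M W).map (algebraMap A P.ResidueField)).col) <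
      Submodule.span P.ResidueField (Set.range
      ((colComb M (Fin.snoc W w : Fin (s + 1) → Fin l → k)).map
        (algebraMap A P.ResidueField)).col) := by
    refine lt_of_le_of_ne (Submodule.span_mono ?_) fun heq => hwP ?_
    · rintro _ ⟨j, rfl⟩
      refine ⟨j.castSucc, ?_⟩
      rw [colComb_map_col, colComb_map_col]
      simp
    · change _ ∈ Submodule.span P.ResidueField (Set.range
        ((colComb M W).map (algebraMap A P.ResidueField)).col)
      rw [heq]
      refine Submodule.subset_span ⟨Fin.last s, ?_⟩
      rw [colComb_map_col]
      simp
  have := Submodule.finrank_lt_finrank_of_lt hlt2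
  omega

theorem exists_forall_height_colComb {e : ℕ} (M : Matrix (Fin t) (Fin l) A)
    (hM : ∀ P : Ideal A, P.IsPrime → maximalMinors M ≤ P → (e : ℕ∞) ≤ P.height) (s : ℕ)
    (hs : s ≤ l) : ∃ W : Fin s → Fin l → k, LinearIndependent k W ∧
      ∀ r ≤ t, ∀ P : Ideal A, P.IsPrime → minorIdeal r (colComb M W) ≤ P →
      ((min (s + 1 - r) e : ℕ) : ℕ∞) ≤ P.height := by
  induction s with
  | zero =>
    refine ⟨Fin.elim0, linearIndependent_empty_type, fun r hr P hP hle => ?_⟩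
    obtain _ | r := r
    · rw [minorIdeal_zero] at hle
      exact absurd (top_le_iff.1 hle) hP.ne_top
    · simp
  | succ s ih =>
    obtain ⟨W, hW, hG⟩ := ih (by omega)
    obtain ⟨w, hw, hw'⟩ := exists_snoc_forall_height M hM W hW hs hG
    exact ⟨_, hw, hw'⟩

/-- After an invertible column operation over `k`, the last column can be removed such that the
codimension of the ideal of maximal minors drops by at most one. -/
theorem exists_snocCol_forall_height (k : Type*) [Field k] [Algebra k A] [Infinite k] {e : ℕ} (M : Matrix (Fin t) (Fin (m + 1)) A)
    (hM : ∀ P : Ideal A, P.IsPrime → maximalMinors M ≤ P → ((e + 1 : ℕ) : ℕ∞) ≤ P.height)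
    (he : e + t ≤ m + 1) :
    ∃ (φ : Matrix (Fin t) (Fin m) A) (v : Fin t → A),
      maximalMinors (snocCol φ v) = maximalMinors M ∧
      ∀ P : Ideal A, P.IsPrime → maximalMinors φ ≤ P → (e : ℕ∞) ≤ P.height := by
  obtain ⟨W, hW, hG⟩ := exists_forall_height_colComb (k := k) M hM m (by omega)
  obtain ⟨w, hw, -⟩ := exists_snoc_forall_height M hM W hW (by omega) hG
  obtain ⟨v, hv⟩ := colComb_snoc M W w
  refine ⟨colComb M W, v, ?_, fun P hP hle => ?_⟩
  · rw [← hv]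
    have hu : IsUnit (Matrix.of (Fin.snoc W w : Fin (m + 1) → Fin (m + 1) → k)).transpose := by
      rw [Matrix.isUnit_transpose, ← Matrix.linearIndependent_rows_iff_isUnit]
      exact hw
    obtain ⟨Q, hQ⟩ := hu
    refine maximalMinors_mul_of_mul_eq_one M (Q' := (Q⁻¹).val.map (algebraMap k A)) ?_
    rw [← hQ, ← Matrix.map_mul, Units.mul_inv]
    simp
  · have := hG t le_rfl P hP (by rwa [minorIdeal_eq_maximalMinors])
    refine le_trans ?_ this
    norm_cast
    omega

end GeneralPosition

/-! ### Generic row elimination -/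

section RowElimination

variable {R : Type*} [CommRing R] {t m : ℕ} {ι : Type*}

/-- The unipotent matrix subtracting `c i` times the last row from the `i`-th row, for all `i`
but the last. -/
def elimRow (c : Fin (t + 1) → R) : Matrix (Fin (t + 1)) (Fin (t + 1)) R :=
  (1 : Matrix (Fin (t + 1)) (Fin (t + 1)) R).updateCol (Fin.last t)
    (fun i => if i = Fin.last t then 1 else - c i)

theorem det_elimRow (c : Fin (t + 1) → R) : (elimRow c).det = 1 := by
  rw [elimRow, ← Matrix.cramer_apply, Matrix.cramer_one]
  simp

theorem elimRow_mulVec (c v : Fin (t + 1) → R) (i : Fin (t + 1)) :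
    (elimRow c).mulVec v i = if i = Fin.last t then v i else v i - c i * v (Fin.last t) := by
  rw [Matrix.mulVec, dotProduct, Fin.sum_univ_castSucc]
  have h : ∀ j : Fin t, elimRow c i j.castSucc = (1 : Matrix _ _ R) i j.castSucc := fun j => by
    rw [elimRow, Matrix.updateCol_ne (Fin.castSucc_lt_last j).ne]
  simp only [h]
  refine Fin.lastCases ?_ (fun i => ?_) i
  · simp [elimRow, (Fin.castSucc_lt_last _).ne']
  · simp [elimRow, Matrix.one_apply, (Fin.castSucc_lt_last _).ne]
    ring

theorem elimRow_mul_apply (c : Fin (t + 1) → R) (M : Matrix (Fin (t + 1)) ι R) (i : Fin (t + 1))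
    (j : ι) : (elimRow c * M) i j =
      if i = Fin.last t then M i j else M i j - c i * M (Fin.last t) j :=
  elimRow_mulVec c (fun i => M i j) i

theorem maximalMinors_elimRow_mul (c : Fin (t + 1) → R) (M : Matrix (Fin (t + 1)) ι R) :
    maximalMinors (elimRow c * M) = maximalMinors M :=
  maximalMinors_mul_left_of_mul_eq_one
    (Matrix.nonsing_inv_mul _ (by rw [det_elimRow]; exact isUnit_one)) M

theorem mul_snocCol (P : Matrix (Fin t) (Fin t) R) (M : Matrix (Fin t) (Fin m) R) (v : Fin t → R) :
    P * snocCol M v = snocCol (P * M) (P.mulVec v) := by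
  ext i j
  refine Fin.lastCases ?_ (fun j => ?_) j <;> simp [Matrix.mul_apply, Matrix.mulVec, dotProduct]

/-- The elimination matrix has determinant one and sends c to the last basis vector. So the minors
left after deleting the last row are linear in c, and genericity of c again means avoiding
subspaces. -/
theorem borderedMinor_eq_det_elimRow {c : Fin (t + 1) → R} (hc : c (Fin.last t) = 1)
    (M : Matrix (Fin (t + 1)) ι R) (f : Fin t → ι) :
    borderedMinor M f c = ((elimRow c * M).submatrix (Fin.last t).succAbove f).det := by
  have h1 : (elimRow c).mulVec c = Pi.single (Fin.last t) 1 := by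
    ext i
    rw [elimRow_mulVec, hc]
    refine Fin.lastCases ?_ (fun i => ?_) i
    · simp [hc]
    · simp [(Fin.castSucc_lt_last _).ne]
  have h2 : borderedMinor M f c = borderedMinor (elimRow c * M) f (Pi.single (Fin.last t) 1) := by
    have h3 : snocCol ((elimRow c * M).submatrix id f) (Pi.single (Fin.last t) 1) =
        elimRow c * snocCol (M.submatrix id f) c := by
      rw [mul_snocCol, h1]
      rfl
    rw [borderedMinor_apply, borderedMinor_apply, h3, Matrix.det_mul, det_elimRow, one_mul]
  rw [h2, borderedMinor_single]
  simp [← two_mul]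

variable {k : Type*} [Field k] [Infinite k] {A : Type*} [CommRing A] [Algebra k A]

/-- Generic row elimination keeps a submaximal minor out of finitely many primes. -/
theorem exists_elimRow_forall_not_le (M : Matrix (Fin (t + 1)) ι A) (Ps : Set (Ideal A))
    (hfin : Ps.Finite) (hPs : ∀ P ∈ Ps, P.IsPrime ∧ ¬ minorIdeal t M ≤ P)
    (V : Submodule k (Fin (t + 1) → A))
    (hV : ∀ P ∈ Ps, ∀ i, ∃ x ∉ P, Pi.single i x ∈ V) (hlast : Pi.single (Fin.last t) 1 ∈ V)
    (hk : ∀ c ∈ V, ∃ a : k, c (Fin.last t) = algebraMap k A a) :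
    ∃ c ∈ V, c (Fin.last t) = 1 ∧ ∀ P ∈ Ps,
      ¬ maximalMinors ((elimRow c * M).submatrix (Fin.last t).succAbove id) ≤ P := by
  rcases subsingleton_or_nontrivial A with hA | hA
  · refine ⟨_, hlast, Subsingleton.elim _ _, fun P hP => ?_⟩
    exact absurd (Subsingleton.elim _ _) (hPs P hP).1.ne_top
  have hf : ∀ P : Ps, ∃ f : Fin t → ι, ∃ i : Fin (t + 1),
      (M.submatrix i.succAbove f).det ∉ P.1 := by
    rintro ⟨P, hP⟩
    have := (hPs P hP).2
    rw [minorIdeal_le_iff_succAbove] at this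
    push Not at this
    obtain ⟨i, hi⟩ := this
    rw [maximalMinors_le] at hi
    push Not at hi
    obtain ⟨f, hf⟩ := hi
    exact ⟨f, i, hf⟩
  choose f i hfi using hf
  have : Finite Ps := hfin
  -- Each prime forbids one subspace of V, proper because V contains a vector x·e_i with x outside
  -- P, where i is the row omitted by a minor outside P. The subspace `L0` keeps the last coordinate
  -- nonzero, so that it can be scaled to 1.
  let L : Ps → Submodule k V := fun P =>
    ((P.1.restrictScalars k).comap ((borderedMinor M (f P)).restrictScalars k)).comap V.subtype
  let L0 : Submodule k V := LinearMap.ker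
    (((LinearMap.proj (Fin.last t) : (Fin (t + 1) → A) →ₗ[A] A).restrictScalars k) ∘ₗ V.subtype)
  obtain ⟨c, hc⟩ := exists_forall_notMem_of_finite (insert L0 (Set.range L))
    ((Set.finite_range L).insert _) (by
      rintro _ (rfl | ⟨P, rfl⟩) htop
      · have : (⟨_, hlast⟩ : V) ∈ L0 := by rw [htop]; trivial
        simp [L0] at this
      · obtain ⟨x, hx, hxV⟩ := hV P.1 P.2 (i P)
        have : (⟨_, hxV⟩ : V) ∈ L P := by rw [htop]; trivial
        have h1 : borderedMinor M (f P) (Pi.single (i P) x) ∈ P.1 := this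
        have hp := (hPs P.1 P.2).1
        rw [borderedMinor_single] at h1
        rcases hp.mem_or_mem h1 with h2 | h2
        · rcases hp.mem_or_mem h2 with h3 | h3
          · exact hp.ne_top (Ideal.eq_top_of_isUnit_mem _ h3 (IsUnit.pow _ isUnit_one.neg))
          · exact hx h3
        · exact hfi P h2)
  obtain ⟨a, ha⟩ := hk c.1 c.2
  have ha0 : a ≠ 0 := by
    rintro rfl
    exact hc L0 (Set.mem_insert _ _) (by simpa [L0] using ha)
  have hlast1 : (a⁻¹ • c.1) (Fin.last t) = 1 := by
    rw [Pi.smul_apply, ha, Algebra.smul_def, ← map_mul, inv_mul_cancel₀ ha0, map_one]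
  refine ⟨a⁻¹ • c.1, V.smul_mem _ c.2, hlast1, fun P hP hle => ?_⟩
  refine hc (L ⟨P, hP⟩) (Set.mem_insert_of_mem _ ⟨_, rfl⟩) ?_
  have h1 : borderedMinor M (f ⟨P, hP⟩) (a⁻¹ • c.1) ∈ P := by
    rw [borderedMinor_eq_det_elimRow hlast1]
    have h := hle (det_mem_maximalMinors
      ((elimRow (a⁻¹ • c.1) * M).submatrix (Fin.last t).succAbove id) (f ⟨P, hP⟩))
    rwa [Matrix.submatrix_submatrix, Function.comp_id, Function.id_comp] at h
  have h2 : c.1 = algebraMap k A a • (a⁻¹ • c.1) := by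
    rw [algebraMap_smul, smul_smul, mul_inv_cancel₀ ha0, one_smul]
  change borderedMinor M (f ⟨P, hP⟩) c.1 ∈ P
  rw [h2, map_smul]
  exact Ideal.mul_mem_left _ _ h1

end RowElimination

/-! ### Ideals with proportional generators -/

section ProportionalIdeals

variable {B : Type*} [CommRing B] {X : Type*}

/-- Proportional families without annihilator span isomorphic ideals. -/
theorem nonempty_linearEquiv_span_range {α β : X → B} (h : ∀ x y, α x * β y = β x * α y)
    (hα : ∀ b : B, (∀ x, α x * b = 0) → b = 0) (hβ : ∀ b : B, (∀ x, β x * b = 0) → b = 0) :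
    Nonempty (Ideal.span (Set.range α) ≃ₗ[B] Ideal.span (Set.range β)) := by
  let f : (X →₀ B) →ₗ[B] B := Finsupp.linearCombination B α
  let g : (X →₀ B) →ₗ[B] B := Finsupp.linearCombination B β
  have hf : LinearMap.range f = Ideal.span (Set.range α) := Finsupp.range_linearCombination B
  have hg : LinearMap.range g = Ideal.span (Set.range β) := Finsupp.range_linearCombination B
  have hfg : ∀ (r : X →₀ B) y, β y * f r = α y * g r := by
    intro r y
    simp only [f, g, Finsupp.linearCombination_apply, Finsupp.sum, Finset.mul_sum, smul_eq_mul]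
    refine Finset.sum_congr rfl fun x _ => ?_
    -- Proportionality gives β_y·f(r) = α_y·g(r); in the absence of annihilators both families
    -- therefore have the same relations.
    linear_combination r x * h x y
  have hker : LinearMap.ker f = LinearMap.ker g := by
    ext r
    rw [LinearMap.mem_ker, LinearMap.mem_ker]
    exact ⟨fun h0 => hα _ fun x => by rw [← hfg, h0, mul_zero],
      fun h0 => hβ _ fun x => by rw [hfg, h0, mul_zero]⟩
  exact ⟨(LinearEquiv.ofEq _ _ hf.symm).trans <| f.quotKerEquivRange.symm.trans <|
    (Submodule.quotEquivOfEq _ _ hker).trans <| g.quotKerEquivRange.trans <|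
    LinearEquiv.ofEq _ _ hg⟩

end ProportionalIdeals

/-! ### Cohen-Macaulayness of determinantal quotients -/

section EagonNorthcott

variable {A : Type u} [CommRing A]

/-- The sequence 0 → K/I → A/I → A/K → 0 gives K/I codepth at most g. Through the isomorphism this
passes to J/I, and the corresponding sequence for J gives A/J. -/
theorem CodepthLE.of_map_mk_equiv {g : ℕ} {I J K : Ideal A} (hI : CodepthLE A g (A ⧸ I))
    (hJI : I ≤ J) (hKI : I ≤ K) (hK : CodepthLE A (g + 1) (A ⧸ K))
    (e : (J.map (Ideal.Quotient.mk I)) ≃ₗ[A ⧸ I] (K.map (Ideal.Quotient.mk I))) :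
    CodepthLE A (g + 1) (A ⧸ J) := by
  have key : ∀ L : Ideal A, I ≤ L → ∃ (f : (L.map (Ideal.Quotient.mk I)) →ₗ[A] A ⧸ I)
      (h : (A ⧸ I) →ₗ[A] A ⧸ L), Function.Injective f ∧ Function.Surjective h ∧
        Function.Exact f h := by
    intro L hL
    refine ⟨(Submodule.subtype (L.map (Ideal.Quotient.mk I))).restrictScalars A,
      (Ideal.Quotient.factorₐ A hL).toLinearMap, Subtype.val_injective,
      Ideal.Quotient.factor_surjective hL, fun x => ?_⟩
    obtain ⟨x, rfl⟩ := Ideal.Quotient.mk_surjective x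
    change Ideal.Quotient.factor hL (Ideal.Quotient.mk I x) = 0 ↔ _
    rw [Ideal.Quotient.factor_mk, Ideal.Quotient.eq_zero_iff_mem]
    have : x ∈ L ↔ Ideal.Quotient.mk I x ∈ L.map (Ideal.Quotient.mk I) := by
      rw [← Ideal.mem_comap, Ideal.comap_map_of_surjective _ Ideal.Quotient.mk_surjective,
        ← RingHom.ker_eq_comap_bot, Ideal.mk_ker, sup_eq_left.2 hL]
    rw [this]
    simp
  obtain ⟨f, h, hf, hh, hfh⟩ := key K hKI
  obtain ⟨f', h', hf', hh', hfh'⟩ := key J hJI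
  have h1 := CodepthLE.left hf hh hfh hI hK
  have h2 := h1.of_equiv (e.symm.restrictScalars A)
  exact CodepthLE.right hf' hh' hfh' h2 (hI.mono (by omega))

/-- The quotient by the maximal minors of a matrix of the expected codimension is
Cohen-Macaulay. -/
theorem codepthLE_quotient_maximalMinors [IsNoetherianRing A] (k : Type*) [Field k] [Infinite k] [Algebra k A]
    (hA : IsCM A) {m : ℕ} : ∀ {t e : ℕ} (_ : e + t = m + 1) (M : Matrix (Fin t) (Fin m) A)
    (_ : ∀ P : Ideal A, P.IsPrime → maximalMinors M ≤ P → (e : ℕ∞) ≤ P.height),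
    CodepthLE A e (A ⧸ maximalMinors M) := by
  have h0 : ∀ {m e : ℕ} (M : Matrix (Fin 0) (Fin m) A), CodepthLE A e (A ⧸ maximalMinors M) := by
    intro m e M
    rw [maximalMinors_zero_rows]
    have : Subsingleton (A ⧸ (⊤ : Ideal A)) := Ideal.Quotient.subsingleton_iff.2 rfl
    exact CodepthLE.of_subsingleton e
  have h1 : ∀ {m e t : ℕ} (_ : m < t) (M : Matrix (Fin t) (Fin m) A),
      CodepthLE A e (A ⧸ maximalMinors M) := by
    intro m e t h M
    rw [maximalMinors_eq_bot_of_lt M h]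
    exact (hA.codepthLE.mono (Nat.zero_le _)).of_equiv (AlgEquiv.quotientBot A A).symm.toLinearEquiv
  induction m with
  | zero =>
    intro t e h M hM
    obtain _ | t := t
    · exact h0 M
    · exact h1 (by omega) M
  | succ m ih =>
    intro t e h M hM
    obtain _ | t := t
    · exact h0 M
    by_cases htm : m + 1 < t + 1
    · exact h1 htm M
    obtain ⟨e, rfl⟩ : ∃ e', e = e' + 1 := ⟨e - 1, by omega⟩
    -- Induction on the number of columns. After a general column operation, φ is M without its last
    -- column, of codimension at least e. Deleting also a row gives ψ of codimension at least e + 1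
    -- with m columns, so induction applies to both φ and ψ.
    obtain ⟨φ, v, hφv, hφ⟩ := exists_snocCol_forall_height k M hM (by omega)
    have hI := ih (by omega) φ hφ
    -- The submaximal minors of φ generate an ideal containing all maximal minors of M, so it has
    -- height at least e + 1 and the row elimination can avoid the components of height at most e.
    have hsub : ∀ P : Ideal A, P.IsPrime → minorIdeal t φ ≤ P → ((e + 1 : ℕ) : ℕ∞) ≤ P.height := by
      intro P hP hle
      refine hM P hP ?_
      rw [← hφv, maximalMinors_snocCol, sup_le_iff]
      have h2 : maximalMinors φ ≤ minorIdeal t φ := by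
        rw [maximalMinors_le]
        intro g
        rw [Matrix.det_succ_row _ 0]
        exact Ideal.sum_mem _ fun j _ => Ideal.mul_mem_left _ _
          (det_mem_minorIdeal φ (Fin.succAbove 0) (g ∘ j.succAbove))
      refine ⟨h2.trans hle, ?_⟩
      rw [Ideal.span_le]
      rintro _ ⟨f, rfl⟩
      exact hle (borderedMinor_mem_minorIdeal φ f v)
    obtain ⟨c, -, hc1, hc⟩ := exists_elimRow_forall_not_le φ
      {P | P ∈ (maximalMinors φ).minimalPrimes ∧ P.height < ((e + 1 : ℕ) : ℕ∞)}
      ((Ideal.finite_minimalPrimes_of_isNoetherianRing A (maximalMinors φ)).subset fun P hP => hP.1)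
      (fun P hP => ⟨hP.1.1.1, fun hle => (hsub P hP.1.1.1 hle).not_gt hP.2⟩)
      (LinearMap.range (((Algebra.linearMap k A).compLeft (Fin (t + 1)))))
      (fun P hP i => ⟨1, hP.1.1.1.one_notMem, ⟨Pi.single i 1, by
        ext j; by_cases hj : j = i
        · subst hj; simp
        · simp [Pi.single_eq_of_ne hj]⟩⟩)
      ⟨Pi.single (Fin.last t) 1, by
        ext j; by_cases hj : j = Fin.last t
        · subst hj; simp
        · simp [Pi.single_eq_of_ne hj]⟩
      (by rintro _ ⟨c, rfl⟩; exact ⟨c _, rfl⟩)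
    set φ' := elimRow c * φ with hφ'
    set v' := (elimRow c).mulVec v with hv'
    have hJ : maximalMinors (snocCol φ' v') = maximalMinors M := by
      rw [hφ', hv', ← mul_snocCol, maximalMinors_elimRow_mul, hφv]
    have hIφ : maximalMinors φ' = maximalMinors φ := maximalMinors_elimRow_mul _ _
    rw [← hIφ] at hI hφ
    set ψ := φ'.submatrix (Fin.last t).succAbove id with hψ
    have hψh : ∀ P : Ideal A, P.IsPrime → maximalMinors ψ ≤ P → ((e + 1 : ℕ) : ℕ∞) ≤ P.height := by
      intro P hP hle
      have hle' := (maximalMinors_le_submatrix_succAbove φ' (Fin.last t)).trans hle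
      obtain ⟨Q, hQ, hQP⟩ := Ideal.exists_minimalPrimes_le hle'
      rcases hQP.eq_or_lt with rfl | hQP
      · by_contra! hlt
        exact hc _ ⟨by rwa [← hIφ], hlt⟩ hle
      · have := hQ.1.1
        have h3 := Ideal.height_add_one_le_of_lt_of_isPrime hQP
        refine le_trans ?_ h3
        push_cast
        gcongr
        exact hφ Q hQ.1.1 hQ.1.2
    have hK := ih (by omega) ψ hψh
    rw [← hJ]
    have hIJ : maximalMinors φ' ≤ maximalMinors (snocCol φ' v') := by
      rw [maximalMinors_snocCol]; exact le_sup_left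
    have hIK : maximalMinors φ' ≤ maximalMinors ψ := maximalMinors_le_submatrix_succAbove _ _
    have hβ : ∀ f, borderedMinor φ' f (Pi.single (Fin.last t) 1) = (ψ.submatrix id f).det := by
      intro f
      rw [borderedMinor_single]
      simp [← two_mul, hψ]
    have hmapJ : (maximalMinors (snocCol φ' v')).map (Ideal.Quotient.mk (maximalMinors φ')) =
        Ideal.span (Set.range fun f : Fin t → Fin m =>
          Ideal.Quotient.mk (maximalMinors φ') (borderedMinor φ' f v')) := by
      rw [maximalMinors_snocCol, Ideal.map_sup, Ideal.map_quotient_self, bot_sup_eq, Ideal.map_span,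
        ← Set.range_comp]
      rfl
    have hmapK : (maximalMinors ψ).map (Ideal.Quotient.mk (maximalMinors φ')) =
        Ideal.span (Set.range fun f : Fin t → Fin m => Ideal.Quotient.mk (maximalMinors φ')
          (borderedMinor φ' f (Pi.single (Fin.last t) 1))) := by
      simp only [hβ]
      rw [show maximalMinors ψ = Ideal.span _ from rfl, Ideal.map_span, ← Set.range_comp]
      rfl
    have hann : ∀ L : Ideal A, (∀ P : Ideal A, P.IsPrime → L ≤ P → ((e + 1 : ℕ) : ℕ∞) ≤ P.height) →
        ∀ α : (Fin t → Fin m) → A ⧸ maximalMinors φ',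
        L.map (Ideal.Quotient.mk (maximalMinors φ')) = Ideal.span (Set.range α) →
        ∀ b : A ⧸ maximalMinors φ', (∀ x, α x * b = 0) → b = 0 := by
      intro L hL α hα b hb
      obtain ⟨b, rfl⟩ := Ideal.Quotient.mk_surjective b
      rw [Ideal.Quotient.eq_zero_iff_mem]
      refine hI.mem_of_forall_mul_mem (J := L) (fun P hP _ hLP =>
        lt_of_lt_of_le (by exact_mod_cast Nat.lt_succ_self e) (hL P hP hLP)) fun x hx => ?_
      rw [← Ideal.Quotient.eq_zero_iff_mem, map_mul]
      have hx' := Ideal.mem_map_of_mem (Ideal.Quotient.mk (maximalMinors φ')) hx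
      rw [hα] at hx'
      refine Submodule.span_induction (p := fun y _ => y * Ideal.Quotient.mk _ b = 0) ?_ (by simp)
        (fun y z _ _ hy hz => by rw [add_mul, hy, hz, add_zero])
        (fun r y _ hy => by rw [smul_eq_mul, mul_assoc, hy, mul_zero]) hx'
      rintro _ ⟨f, rfl⟩
      exact hb f
    -- Modulo the maximal minors of φ', the ideals of (φ' | v') and of ψ are generated by the
    -- bordered minors of v' and of the last basis vector. These are proportional, and neither
    -- family has an annihilator because A/I has codepth at most e and both ideals have height at
    -- least e + 1.
    obtain ⟨iso⟩ := nonempty_linearEquiv_span_range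
      (α := fun f : Fin t → Fin m =>
          Ideal.Quotient.mk (maximalMinors φ') (borderedMinor φ' f v'))
      (β := fun f : Fin t → Fin m => Ideal.Quotient.mk (maximalMinors φ')
          (borderedMinor φ' f (Pi.single (Fin.last t) 1)))
      (fun f f' => by
        rw [← map_mul, ← map_mul, Ideal.Quotient.eq]
        exact borderedMinor_mul_sub_mem φ' f f' _ _)
      (hann _ (by rw [hJ]; exact hM) _ hmapJ) (hann _ hψh _ hmapK)
    exact CodepthLE.of_map_mk_equiv hI hIJ hIK hK
      ((LinearEquiv.ofEq _ _ hmapJ).trans (iso.trans (LinearEquiv.ofEq _ _ hmapK.symm)))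

end EagonNorthcott

/-! ### Determinantal ideals generated by as many elements as their codimension -/

section FewGenerators

/-- Going down for A → A[X] gives ht p ≤ ht p·A[X], and X lies in P but not in p·A[X]. -/
theorem height_comap_C_add_one_le {A : Type*} [CommRing A] [IsNoetherianRing A]
    {P : Ideal (Polynomial A)} [P.IsPrime] (hX : Polynomial.X ∈ P) :
    (P.comap Polynomial.C).height + 1 ≤ P.height := by
  set p := P.comap Polynomial.C with hp
  have hpp : (p.map Polynomial.C).IsPrime := (Ideal.isPrime_map_C_iff_isPrime p).2 inferInstance
  have hlies : (p.map Polynomial.C).LiesOver p := by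
    refine ⟨?_⟩
    ext a
    change a ∈ p ↔ Polynomial.C a ∈ p.map Polynomial.C
    refine ⟨fun h => Ideal.mem_map_of_mem _ h, fun h => ?_⟩
    simpa using (Ideal.mem_map_C_iff.1 h) 0
  have h1 : p.height ≤ (p.map Polynomial.C).height := by
    have := Ideal.height_eq_height_add_of_liesOver_of_hasGoingDown p (p.map Polynomial.C)
    rw [this]
    exact le_self_add
  have h2 : p.map Polynomial.C < P := by
    refine lt_of_le_of_ne (Ideal.map_le_iff_le_comap.2 le_rfl) fun h => ?_
    rw [← h, Ideal.mem_map_C_iff] at hX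
    exact (Ideal.IsPrime.one_notMem (inferInstance : p.IsPrime)) (by simpa using hX 1)
  exact (add_le_add_left h1 1).trans (Ideal.height_add_one_le_of_lt_of_isPrime h2)

/-- For t = 1 or e = 1 the two numbers are equal, which is why hypersurfaces need separate
treatment. -/
theorem lt_choose_of_two_le {t e m : ℕ} (ht : 2 ≤ t) (he : 2 ≤ e) (hm : m + 1 = t + e) :
    e < m.choose t := by
  obtain ⟨t, rfl⟩ := Nat.exists_eq_add_of_le ht
  obtain ⟨e, rfl⟩ := Nat.exists_eq_add_of_le he
  obtain rfl : m = 3 + t + e := by omega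
  have h1 : (3 + t + e).choose (2 + t) = (3 + t + e).choose (e + 1) :=
    Nat.choose_symm_of_eq_add (by omega)
  have h2 : (3 + e).choose (e + 1) ≤ (3 + t + e).choose (e + 1) := Nat.choose_le_choose _ (by omega)
  have h3 : (3 + e).choose (e + 1) = (3 + e).choose 2 := Nat.choose_symm_of_eq_add (by omega)
  have h4 : (3 + e).choose 2 * 2 = (3 + e) * (2 + e) := by
    rw [Nat.choose_two_right, Nat.div_mul_cancel]
    · rw [show 3 + e - 1 = 2 + e by omega]
    · exact (Nat.even_mul_pred_self _).two_dvd
  nlinarith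

variable {A : Type u} [CommRing A] {t m : ℕ}

/-- More elements of an ideal than it has generators satisfy a nontrivial relation modulo the
maximal ideal. -/
theorem exists_sum_mul_mem_of_card_lt [IsLocalRing A] {ι : Type*} [Fintype ι] {s : Finset A}
    (hs : s.card < Fintype.card ι) (x : ι → A) (hx : ∀ i, x i ∈ Ideal.span (s : Set A)) :
    ∃ a : ι → A, (∃ i, IsUnit (a i)) ∧
      ∑ i, a i * x i ∈ IsLocalRing.maximalIdeal A * Ideal.span (s : Set A) := by
  have h1 : ∀ i, ∃ b : s → A, ∑ j, b j * j = x i := fun i => by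
    have := hx i
    rw [← Subtype.range_coe (s := (s : Set A))] at this
    simpa using! (Ideal.mem_span_range_iff_exists_fun.1 this)
  choose b hb using h1
  let K := IsLocalRing.ResidueField A
  have h2 : ¬ LinearIndependent K (fun (i : ι) (j : s) => IsLocalRing.residue A (b i j)) := by
    intro h
    have := h.fintype_card_le_finrank
    rw [Module.finrank_fintype_fun_eq_card, Fintype.card_coe] at this
    omega
  obtain ⟨g, hg, i, hi⟩ := Fintype.not_linearIndependent_iff.1 h2
  choose a ha using fun i => IsLocalRing.residue_surjective (g i)
  refine ⟨a, ⟨i, ?_⟩, ?_⟩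
  · rw [← IsLocalRing.residue_ne_zero_iff_isUnit, ha]
    exact hi
  · have h3 : ∑ i, a i * x i = ∑ j : s, (∑ i, a i * b i j) * j := by
      simp_rw [← hb, Finset.mul_sum, Finset.sum_mul]
      rw [Finset.sum_comm]
      simp_rw [mul_assoc]
    rw [h3]
    refine Ideal.sum_mem _ fun j _ => Ideal.mul_mem_mul ?_ (Ideal.subset_span j.2)
    rw [← IsLocalRing.residue_eq_zero_iff]
    have := congrFun hg j
    simpa [Finset.sum_apply, ← ha] using this

/-- The matrix with an identity block in the columns `g`. -/
def colUnit (R : Type*) [CommRing R] (g : Fin t → Fin m) : Matrix (Fin t) (Fin m) R :=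
  Matrix.of fun i j => if j = g i then 1 else 0

theorem det_colUnit_submatrix_self (R : Type*) [CommRing R] {g : Fin t → Fin m}
    (hg : Function.Injective g) : ((colUnit R g).submatrix id g).det = 1 := by
  have : (colUnit R g).submatrix id g = 1 := by
    ext i j
    simp [colUnit, Matrix.one_apply, hg.eq_iff, eq_comm]
  rw [this, Matrix.det_one]

theorem det_colUnit_submatrix_of_notMem (R : Type*) [CommRing R] {g h : Fin t → Fin m} {j : Fin t}
    (hj : h j ∉ Set.range g) : ((colUnit R g).submatrix id h).det = 0 := by
  refine Matrix.det_eq_zero_of_column_eq_zero j fun i => ?_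
  simp only [colUnit, Matrix.submatrix_apply, id, Matrix.of_apply]
  exact if_neg fun h => hj ⟨i, h.symm⟩

/-- A one-parameter deformation of a matrix. -/
noncomputable def deform (M E : Matrix (Fin t) (Fin m) A) :
    Matrix (Fin t) (Fin m) (Polynomial A) :=
  M.map Polynomial.C + (Polynomial.X : Polynomial A) • E.map Polynomial.C

theorem eval_zero_det_deform (M E : Matrix (Fin t) (Fin m) A) (g : Fin t → Fin m) :
    (((deform M E).submatrix id g).det).eval 0 = (M.submatrix id g).det := by
  rw [← Polynomial.coe_evalRingHom, RingHom.map_det]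
  congr 1
  ext i j
  simp [deform]

/-- All entries of M die under φ, which leaves the matrix X·E of size t. -/
theorem map_det_deform {K : Type*} [CommRing K] (φ : A →+* K) {M : Matrix (Fin t) (Fin m) A}
    (hM : ∀ i j, φ (M i j) = 0) (E : Matrix (Fin t) (Fin m) A) (g : Fin t → Fin m) :
    (((deform M E).submatrix id g).det).map φ =
      Polynomial.X ^ t * Polynomial.C (φ (E.submatrix id g).det) := by
  rw [← Polynomial.coe_mapRingHom, RingHom.map_det, RingHom.map_det, RingHom.map_det]
  have : (Polynomial.mapRingHom φ).mapMatrix ((deform M E).submatrix id g) =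
      (Polynomial.X : Polynomial K) • Polynomial.C.mapMatrix (φ.mapMatrix (E.submatrix id g)) := by
    ext1 i j
    simp [deform, hM]
  rw [this, Matrix.det_smul, Fintype.card_fin]

/-- The family of deformed quotients is flat near X = 0: M having the expected codimension, the
deformed ideal has it too at the closed point, so its quotient is Cohen-Macaulay there and X is a
nonzerodivisor. The factor u comes from localizing. -/
theorem mul_mem_maximalMinors_deform [IsLocalRing A] [IsNoetherianRing A] (k : Type*) [Field k] [Infinite k]
    [Algebra k A] (hA : IsCM A) {e : ℕ} (h : e + t = m + 1) (M E : Matrix (Fin t) (Fin m) A)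
    (hM : ∀ P : Ideal A, P.IsPrime → maximalMinors M ≤ P → (e : ℕ∞) ≤ P.height)
    {r : Polynomial A} (hr : Polynomial.X * r ∈ maximalMinors (deform M E)) :
    ∃ u : Polynomial A, IsUnit (u.eval 0) ∧ u * r ∈ maximalMinors (deform M E) := by
  -- The point X = 0 over the closed point of Spec A; its complement consists of the u with u(0) a
  -- unit.
  let Q : Ideal (Polynomial A) := RingHom.ker ((IsLocalRing.residue A).comp
    (Polynomial.evalRingHom (0 : A)))
  have hQp : Q.IsPrime := RingHom.ker_isPrime _
  let B := Localization.AtPrime Q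
  have hB : IsCM B := hA.polynomial.of_isLocalization Q.primeCompl B
  set I := (maximalMinors (deform M E)).map (algebraMap (Polynomial A) B) with hI
  set s := algebraMap (Polynomial A) B Polynomial.X with hs
  have hImap : I = maximalMinors ((deform M E).map (algebraMap (Polynomial A) B)) :=
    map_maximalMinors _ _
  have hsQ : s ∈ IsLocalRing.maximalIdeal B := by
    change Polynomial.X ∈ (IsLocalRing.maximalIdeal B).under (Polynomial A)
    rw [IsLocalization.AtPrime.under_maximalIdeal B Q]
    simp [Q, RingHom.mem_ker]
  have h1 : ∀ P : Ideal B, P.IsPrime → I ≤ P → s ∈ P → ((e + 1 : ℕ) : ℕ∞) ≤ P.height := by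
    intro P hP hIP hsP
    rw [← IsLocalization.height_under Q.primeCompl P]
    have hXP : Polynomial.X ∈ P.under (Polynomial A) := hsP
    refine le_trans ?_ (height_comap_C_add_one_le hXP)
    push_cast
    gcongr
    refine hM _ inferInstance (maximalMinors_le.2 fun g => ?_)
    have h3 : ((deform M E).submatrix id g).det ∈ P.under (Polynomial A) :=
      Ideal.map_le_iff_le_comap.1 hIP (det_mem_maximalMinors _ g)
    rw [Ideal.mem_comap]
    have h4 := Polynomial.X_mul_divX_add (((deform M E).submatrix id g).det)
    rw [Polynomial.coeff_zero_eq_eval_zero, eval_zero_det_deform] at h4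
    rw [← h4] at h3
    exact (Ideal.add_mem_iff_right _ (Ideal.mul_mem_right _ _ hXP)).1 h3
  have h2 : ∀ P : Ideal B, P.IsPrime → I ≤ P → (e : ℕ∞) ≤ P.height := by
    intro P hP hIP
    by_cases hsP : s ∈ P
    · exact le_trans (by exact_mod_cast Nat.le_succ e) (h1 P hP hIP hsP)
    -- As X is in the maximal ideal, P + (X) is proper. A minimal prime over it has height at least
    -- e + 1 by the previous case and at most ht P + 1 by catenarity.
    · have hle : P ⊔ Ideal.span {s} ≤ IsLocalRing.maximalIdeal B :=
        sup_le (IsLocalRing.le_maximalIdeal hP.ne_top)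
          ((Ideal.span_singleton_le_iff_mem _).2 hsQ)
      obtain ⟨P', hP', -⟩ := Ideal.exists_minimalPrimes_le hle
      have h3 := hB.height_le_add_one_of_mem_minimalPrimes hsP hP'
      have h4 := h1 P' hP'.1.1 (hIP.trans (le_sup_left.trans hP'.1.2))
        (hP'.1.2 (Ideal.mem_sup_right (Ideal.mem_span_singleton_self s)))
      have h5 := h4.trans h3
      push_cast at h5
      exact (ENat.add_le_add_iff_right (by simp)).1 h5
  have hcod : CodepthLE B e (B ⧸ I) := by
    rw [hImap] at h2 ⊢
    exact codepthLE_quotient_maximalMinors k hB h _ h2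
  have hrI : algebraMap (Polynomial A) B r ∈ I := by
    refine hcod.mem_of_forall_mul_mem (J := Ideal.span {s}) (fun P hP hIP hsP => ?_) fun x hx => ?_
    · exact lt_of_lt_of_le (by exact_mod_cast Nat.lt_succ_self e)
        (h1 P hP hIP ((Ideal.span_singleton_le_iff_mem _).1 hsP))
    · obtain ⟨y, rfl⟩ := Ideal.mem_span_singleton'.1 hx
      rw [mul_assoc, hs, ← map_mul]
      exact Ideal.mul_mem_left _ _ (Ideal.mem_map_of_mem _ hr)
  rw [hI, IsLocalization.algebraMap_mem_map_algebraMap_iff Q.primeCompl] at hrI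
  obtain ⟨u, hu, hur⟩ := hrI
  refine ⟨u, ?_, hur⟩
  rw [← IsLocalRing.residue_ne_zero_iff_isUnit]
  exact hu

/-- A matrix with entries in the maximal ideal whose ideal of maximal minors has the expected
codimension at least two and as few generators has one row. -/
theorem lt_two_of_forall_mem_maximalIdeal [IsLocalRing A] [IsNoetherianRing A] (k : Type*) [Field k] [Infinite k]
    [Algebra k A] (hA : IsCM A) {e : ℕ} (h : e + t = m + 1) (he : 2 ≤ e)
    (M : Matrix (Fin t) (Fin m) A)
    (hM : ∀ P : Ideal A, P.IsPrime → maximalMinors M ≤ P → (e : ℕ∞) ≤ P.height)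
    (hmem : ∀ i j, M i j ∈ IsLocalRing.maximalIdeal A) {s : Finset A} (hs : s.card ≤ e)
    (hspan : Ideal.span (s : Set A) = maximalMinors M) : t < 2 := by
  classical
  by_contra! ht
  let S := {σ : Finset (Fin m) // σ.card = t}
  have hS : Fintype.card S = m.choose t := by
    rw [Fintype.card_finset_len, Fintype.card_fin]
  let g : S → Fin t → Fin m := fun σ => σ.1.orderEmbOfFin σ.2
  have hg : ∀ σ, Set.range (g σ) = σ.1 := fun σ => Finset.range_orderEmbOfFin _ _
  -- There are more than e maximal minors, so Nakayama-type counting yields a relation modulo the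
  -- maximal ideal times I in which the minor of `σ₀` has a unit coefficient.
  obtain ⟨a, ⟨σ₀, hσ₀⟩, ha⟩ := exists_sum_mul_mem_of_card_lt (ι := S) (s := s)
    (by rw [hS]; exact hs.trans_lt (lt_choose_of_two_le ht he (by omega)))
    (fun σ => (M.submatrix id (g σ)).det)
    (fun σ => by rw [hspan]; exact det_mem_maximalMinors M _)
  rw [hspan, maximalMinors, ← smul_eq_mul,
    Submodule.mem_ideal_smul_span_iff_exists_sum] at ha
  obtain ⟨b, hb, hsum⟩ := ha
  rw [Finsupp.sum_fintype _ _ (by simp)] at hsum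
  -- The deformation direction is an identity block in the columns of `σ₀`, so that over the residue
  -- field the other chosen minors vanish. F lifts the relation to the deformation; it vanishes at X
  -- = 0, hence is divisible by X.
  let E := colUnit A (g σ₀)
  let D : (Fin t → Fin m) → Polynomial A := fun f => ((deform M E).submatrix id f).det
  let F : Polynomial A := ∑ σ, Polynomial.C (a σ) * D (g σ) - ∑ f, Polynomial.C (b f) * D f
  have hF0 : F.eval 0 = 0 := by
    simp only [F, Polynomial.eval_sub, Polynomial.eval_finsetSum, Polynomial.eval_mul,
      Polynomial.eval_C, D, eval_zero_det_deform]
    rw [sub_eq_zero, ← hsum]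
    rfl
  have hFI : F ∈ maximalMinors (deform M E) :=
    Ideal.sub_mem _ (Ideal.sum_mem _ fun σ _ => Ideal.mul_mem_left _ _ (det_mem_maximalMinors _ _))
      (Ideal.sum_mem _ fun σ _ => Ideal.mul_mem_left _ _ (det_mem_maximalMinors _ _))
  have hFX : F = Polynomial.X * F.divX := by
    conv_lhs => rw [← Polynomial.X_mul_divX_add F, Polynomial.coeff_zero_eq_eval_zero, hF0]
    simp
  rw [hFX] at hFI
  obtain ⟨u, hu, huF⟩ := mul_mem_maximalMinors_deform k hA h M E hM hFI
  let φ := IsLocalRing.residue A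
  have hφM : ∀ i j, φ (M i j) = 0 := fun i j => (IsLocalRing.residue_eq_zero_iff _).2 (hmem i j)
  have hmapI : ∀ x ∈ maximalMinors (deform M E), Polynomial.X ^ t ∣ x.map φ := by
    intro x hx
    refine Submodule.span_induction (p := fun x _ => Polynomial.X ^ t ∣ x.map φ) ?_ (by simp)
      (fun x y _ _ hx hy => by rw [Polynomial.map_add]; exact dvd_add hx hy)
      (fun c x _ hx => by rw [smul_eq_mul, Polynomial.map_mul]; exact Dvd.dvd.mul_left hx _) hx
    rintro _ ⟨f, rfl⟩
    dsimp only
    rw [map_det_deform φ hφM]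
    exact dvd_mul_right _ _
  have hFmap : F.map φ = Polynomial.X ^ t * Polynomial.C (φ (a σ₀)) := by
    simp only [F, Polynomial.map_sub, Polynomial.map_sum, Polynomial.map_mul, Polynomial.map_C, D,
      map_det_deform φ hφM]
    rw [Finset.sum_eq_single σ₀, Finset.sum_eq_zero (s := (Finset.univ : Finset (Fin t → Fin m)))]
    · rw [det_colUnit_submatrix_self A (g := g σ₀) (σ₀.1.orderEmbOfFin σ₀.2).injective]
      rw [map_one, Polynomial.C_1, mul_one, sub_zero, mul_comm]
    · intro f _
      have : φ (b f) = 0 := (IsLocalRing.residue_eq_zero_iff _).2 (hb f)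
      rw [this, Polynomial.C_0, zero_mul]
    · intro σ _ hσ
      obtain ⟨j, hj⟩ : ∃ j, g σ j ∉ Set.range (g σ₀) := by
        by_contra! hall
        have h1 : σ.1 ⊆ σ₀.1 := by
          rw [← Finset.coe_subset, ← hg, ← hg]
          rintro _ ⟨j, rfl⟩
          exact hall j
        exact hσ (Subtype.ext (Finset.eq_of_subset_of_card_le h1 (by rw [σ.2, σ₀.2])))
      rw [det_colUnit_submatrix_of_notMem A hj]
      simp
    · simp
  obtain ⟨y, hy⟩ := hmapI _ huF
  -- Over the residue field F is X^t times a nonzero constant, whereas u·F/X is still divisible by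
  -- X^t. After cancellation, X = 0 gives u(0)·a(σ₀) = 0 in the residue field, although both factors
  -- are units.
  have h1 : Polynomial.X ^ t * (u.map φ * Polynomial.C (φ (a σ₀))) =
      Polynomial.X ^ t * (Polynomial.X * y) := by
    rw [mul_left_comm, ← hFmap, hFX, Polynomial.map_mul, Polynomial.map_X, mul_left_comm (u.map φ),
      ← Polynomial.map_mul, hy]
    ring
  have h2 := congrArg (Polynomial.eval 0) (mul_left_cancel₀ (pow_ne_zero t Polynomial.X_ne_zero) h1)
  rw [Polynomial.eval_mul, Polynomial.eval_C, Polynomial.eval_mul, Polynomial.eval_X, zero_mul,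
    ← map_zero φ, Polynomial.eval_map_apply] at h2
  rcases mul_eq_zero.1 (h2.trans (map_zero φ)) with h3 | h3
  · exact (hu.map φ).ne_zero h3
  · exact (hσ₀.map φ).ne_zero h3

/-- If the ideal of maximal minors is locally generated by as many elements as its codimension,
then some submaximal minor is a unit. -/
theorem not_minorIdeal_le_maximalIdeal [IsLocalRing A] [IsNoetherianRing A] (k : Type*) [Field k] [Infinite k]
    [Algebra k A] (hA : IsCM A) {e : ℕ} (he : 2 ≤ e) {s : Finset A} (hs : s.card ≤ e) {m : ℕ} :
    ∀ {t : ℕ} (_ : e + t = m)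
    (M : Matrix (Fin (t + 1)) (Fin m) A)
    (_ : ∀ P : Ideal A, P.IsPrime → maximalMinors M ≤ P → (e : ℕ∞) ≤ P.height)
    (_ : Ideal.span (s : Set A) = maximalMinors M),
    ¬ minorIdeal t M ≤ IsLocalRing.maximalIdeal A := by
  induction m with
  | zero => intro t h; omega
  | succ m ih =>
    intro t h M hM hspan hle
    obtain _ | t := t
    · rw [minorIdeal_zero] at hle
      exact (IsLocalRing.maximalIdeal.isMaximal A).ne_top (top_le_iff.1 hle)
    -- Entries all in the maximal ideal would force a single row; otherwise a unit entry is removed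
    -- by a Schur complement, which preserves the ideal.
    by_cases hmem : ∀ i j, M i j ∈ IsLocalRing.maximalIdeal A
    · have := lt_two_of_forall_mem_maximalIdeal k hA (by omega) he M hM hmem hs hspan
      omega
    push Not at hmem
    obtain ⟨p, q, hpq⟩ := hmem
    rw [IsLocalRing.mem_maximalIdeal, mem_nonunits_iff, not_not] at hpq
    obtain ⟨u, hu⟩ := hpq.exists_left_inv
    have hI := maximalMinors_schur M hu
    refine ih (by omega) (schur M p q u) (by rwa [hI]) (by rwa [hI]) (minorIdeal_le.2 fun f g => ?_)
    have h1 := det_submatrix_cons_eq_mul_schur M hu f g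
    refine (Ideal.unit_mul_mem_iff_mem _ hpq).1 ?_
    rw [← h1]
    exact hle (det_mem_minorIdeal _ _ _)

end FewGenerators

/-! ### Row and column degrees of homogeneous matrices -/

section Degrees

variable {σ k : Type*} [Field k] {ι κ : Type*}

/-- The rows and columns of `M` have degrees such that every nonzero entry is homogeneous, of degree
the difference of those of its column and of its row. -/
def HasDegrees (M : Matrix ι κ (MvPolynomial σ k)) (a : ι → ℤ) (b : κ → ℤ) : Prop :=
  ∀ i j, M i j ≠ 0 → ∃ d : ℕ, (d : ℤ) = b j - a i ∧ (M i j).IsHomogeneous d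

theorem HasDegrees.isHomogeneous {M : Matrix ι κ (MvPolynomial σ k)} {a : ι → ℤ} {b : κ → ℤ}
    (h : HasDegrees M a b) (i : ι) (j : κ) : (M i j).IsHomogeneous (b j - a i).toNat := by
  by_cases h0 : M i j = 0
  · rw [h0]; exact isHomogeneous_zero _ _ _
  · obtain ⟨d, hd, hM⟩ := h i j h0
    rw [← hd]
    exact hM

theorem HasDegrees.submatrix {M : Matrix ι κ (MvPolynomial σ k)} {a : ι → ℤ} {b : κ → ℤ}
    (h : HasDegrees M a b) {ι' κ' : Type*} (f : ι' → ι) (g : κ' → κ) :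
    HasDegrees (M.submatrix f g) (a ∘ f) (b ∘ g) := fun i j => h (f i) (g j)

theorem HasDegrees.exists_isHomogeneous_det {M : Matrix ι κ (MvPolynomial σ k)} {a : ι → ℤ}
    {b : κ → ℤ} (h : HasDegrees M a b) {r : ℕ} (f : Fin r → ι) (g : Fin r → κ) :
    ∃ d : ℕ, (M.submatrix f g).det.IsHomogeneous d := by
  refine ⟨(∑ q, b (g q) - ∑ q, a (f q)).toNat, ?_⟩
  rw [Matrix.det_apply']
  refine IsHomogeneous.sum _ _ _ fun τ _ => ?_
  by_cases h0 : ∏ q, M.submatrix f g (τ q) q = 0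
  · rw [h0, mul_zero]; exact isHomogeneous_zero _ _ _
  choose d hd hM using fun q => h (f (τ q)) (g q) (Finset.prod_ne_zero_iff.1 h0 q (Finset.mem_univ q))
  have h1 : (∑ q, b (g q) - ∑ q, a (f q)).toNat = 0 + ∑ q, d q := by
    have : ∑ q, b (g q) - ∑ q, a (f q) = ((∑ q, d q : ℕ) : ℤ) := by
      push_cast
      simp_rw [hd, Finset.sum_sub_distrib]
      rw [Equiv.sum_comp τ (fun q => a (f q))]
    rw [this, Int.toNat_natCast, zero_add]
  rw [h1]
  refine IsHomogeneous.mul ?_ (IsHomogeneous.prod _ _ _ fun q _ => hM q)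
  have : ((Equiv.Perm.sign τ : ℤ) : MvPolynomial σ k) = C ((Equiv.Perm.sign τ : ℤ) : k) := by
    simp
  rw [this]
  exact isHomogeneous_C _ _

theorem eq_of_isHomogeneous_add {p q : MvPolynomial σ k} {d₁ d₂ e : ℕ} (hp : p.IsHomogeneous d₁)
    (hq : q.IsHomogeneous d₂) (hp0 : p ≠ 0) (hq0 : q ≠ 0) (h : (p + q).IsHomogeneous e) :
    d₁ = d₂ := by
  by_contra hne
  have h1 : homogeneousComponent d₁ (p + q) = p := by
    rw [map_add, homogeneousComponent_of_mem (n := d₁) hp, homogeneousComponent_of_mem (n := d₂) hq,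
      if_pos rfl, if_neg hne, add_zero]
  have h2 : homogeneousComponent d₂ (p + q) = q := by
    rw [map_add, homogeneousComponent_of_mem (n := d₁) hp, homogeneousComponent_of_mem (n := d₂) hq,
      if_pos rfl, if_neg (Ne.symm hne), zero_add]
  rw [homogeneousComponent_of_mem (n := e) h] at h1 h2
  split_ifs at h1 h2 with h3 h4 h4
  · exact hne (h3.trans h4.symm)
  · exact hq0 h2.symm
  · exact hp0 h1.symm
  · exact hp0 h1.symm

/-- The determinant of a matrix supported on a cycle has two terms. -/
theorem det_of_cycle {R : Type*} [CommRing R] {r : ℕ} (M : Matrix ι κ R) (x : ι) (i : ℕ → ι)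
    (v : ℕ → κ) (hx : ∀ q, 0 < q → q < r + 1 → M x (v q) = 0)
    (hi : ∀ q < r + 1, ∀ p ≤ r + 1, p ≠ q → p ≠ q + 1 → M (i q) (v p) = 0) :
    (M.submatrix (Fin.cons x (fun q : Fin (r + 1) => i q) : Fin (r + 2) → ι)
      (fun p : Fin (r + 2) => v p)).det =
    M x (v 0) * (∏ q : Fin (r + 1), M (i q) (v (q + 1))) +
      (-1) ^ (r + 1) * (M x (v (r + 1)) * ∏ q : Fin (r + 1), M (i q) (v q)) := by
  rw [Matrix.det_succ_row_zero, Fin.sum_univ_succ, Fin.sum_univ_castSucc, Finset.sum_eq_zero]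
  · rw [zero_add]
    congr 1
    · rw [Matrix.det_of_isLowerTriangular]
      · simp
      · intro p q hpq
        simp only [OrderDual.toDual_lt_toDual] at hpq
        have := Fin.lt_def.1 hpq
        simp only [Matrix.submatrix_apply, Fin.cons_succ, Fin.zero_succAbove, Fin.val_succ]
        exact hi p p.2 _ (by omega) (by omega) (by omega)
    · rw [Matrix.det_of_isUpperTriangular]
      · simp [mul_assoc]
      · intro p q hpq
        have := Fin.lt_def.1 hpq
        simp only [Matrix.submatrix_apply, Fin.cons_succ, Fin.succ_last, Fin.succAbove_last,
          Fin.val_castSucc]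
        exact hi p p.2 _ (by omega) (by simp at *; omega) (by simp at *; omega)
  · intro q _
    simp only [Matrix.submatrix_apply, Fin.cons_zero, Fin.val_succ, Fin.val_castSucc]
    rw [hx _ (by omega) (by omega)]
    simp

/-- A path in the bipartite graph of nonzero entries of `M`, through rows satisfying `p`. -/
def IsPath {R : Type*} [Zero R] (M : Matrix ι κ R) (p : ι → Prop) (r : ℕ) (i : ℕ → ι)
    (v : ℕ → κ) : Prop :=
  ∀ q < r, p (i q) ∧ M (i q) (v q) ≠ 0 ∧ M (i q) (v (q + 1)) ≠ 0

variable {M : Matrix ι κ (MvPolynomial σ k)}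

/-- If row x closes the path to a cycle without chords, the minor on that cycle has just two nonzero
terms, and homogeneity equates their degrees. A chord allows the path to be split or shortened,
whence strong induction on its length. -/
theorem IsPath.degree_sub_eq
    (hM : ∀ (r : ℕ) (f : Fin r → ι) (g : Fin r → κ), ∃ d : ℕ, (M.submatrix f g).det.IsHomogeneous d)
    {D : ι → κ → ℕ} (hD : ∀ i j, (M i j).IsHomogeneous (D i j)) {p : ι → Prop} {a : ι → ℤ}
    {b : κ → ℤ} (hab : ∀ i, p i → ∀ j, M i j ≠ 0 → (D i j : ℤ) = b j - a i) {x : ι} (r : ℕ) :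
    ∀ {i : ℕ → ι} {v : ℕ → κ}, IsPath M p r i v → M x (v 0) ≠ 0 → M x (v r) ≠ 0 →
      (D x (v 0) : ℤ) - b (v 0) = D x (v r) - b (v r) := by
  induction r using Nat.strong_induction_on with
  | _ r ih =>
  intro i v hp h0 hr
  obtain _ | r := r
  · rfl
  -- A nonzero entry of row x at an inner column splits the path into two shorter ones.
  by_cases hx : ∀ q, 0 < q → q < r + 1 → M x (v q) = 0
  swap
  · push Not at hx
    obtain ⟨q, hq0, hqr, hq⟩ := hx
    have h1 := ih q hqr (i := i) (v := v) (fun s hs => hp s (by omega)) h0 hq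
    have h2 := ih (r + 1 - q) (by omega) (i := fun s => i (q + s)) (v := fun s => v (q + s))
      (fun s hs => hp (q + s) (by omega)) hq
      (by simpa only [show q + (r + 1 - q) = r + 1 by omega] using hr)
    simp only [show q + (r + 1 - q) = r + 1 by omega, add_zero] at h2
    exact h1.trans h2
  by_cases hi : ∀ q < r + 1, ∀ s ≤ r + 1, s ≠ q → s ≠ q + 1 → M (i q) (v s) = 0
  swap
  · push Not at hi
    obtain ⟨q, hq, s, hs, hsq, hsq1, hne⟩ := hi
    -- A chord in row i q is a shortcut: from v s directly to v (q + 1) if s < q, and from v q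
    -- directly to v s if s > q + 1.
    rcases lt_or_gt_of_ne hsq with hlt | hgt
    · have h1 := ih (r + 1 - (q - s)) (by omega)
        (i := fun l => if l < s then i l else i (l + (q - s)))
        (v := fun l => if l ≤ s then v l else v (l + (q - s))) (fun l hl => by
          rcases lt_trichotomy l s with h | rfl | h
          · simp only [if_pos h, if_pos h.le, if_pos (show l + 1 ≤ s by omega)]
            exact hp l (by omega)
          · simp only [lt_irrefl, if_false, le_refl, if_true, if_neg (show ¬ l + 1 ≤ l by omega),
              show l + (q - l) = q by omega, show l + 1 + (q - l) = q + 1 by omega]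
            exact ⟨(hp q hq).1, hne, (hp q hq).2.2⟩
          · simp only [if_neg h.not_gt, if_neg h.not_ge, if_neg (show ¬ l + 1 ≤ s by omega)]
            rw [show l + 1 + (q - s) = l + (q - s) + 1 by omega]
            exact hp (l + (q - s)) (by omega)) (by simpa using h0)
          (by simpa only [if_neg (show ¬ r + 1 - (q - s) ≤ s by omega),
            show r + 1 - (q - s) + (q - s) = r + 1 by omega] using hr)
      simpa only [if_neg (show ¬ r + 1 - (q - s) ≤ s by omega), zero_le, if_true,
            show r + 1 - (q - s) + (q - s) = r + 1 by omega] using h1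
    · have h1 := ih (r + 1 - (s - q - 1)) (by omega)
        (i := fun l => if l ≤ q then i l else i (l + (s - q - 1)))
        (v := fun l => if l ≤ q then v l else v (l + (s - q - 1))) (fun l hl => by
          rcases lt_trichotomy l q with h | rfl | h
          · simp only [if_pos h.le, if_pos (show l + 1 ≤ q by omega)]
            exact hp l (by omega)
          · simp only [le_refl, if_true, if_neg (show ¬ l + 1 ≤ l by omega),
              show l + 1 + (s - l - 1) = s by omega]
            exact ⟨(hp l hq).1, (hp l hq).2.1, hne⟩
          · simp only [if_neg h.not_ge, if_neg (show ¬ l + 1 ≤ q by omega)]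
            rw [show l + 1 + (s - q - 1) = l + (s - q - 1) + 1 by omega]
            exact hp (l + (s - q - 1)) (by omega)) (by simpa using h0)
          (by simpa only [if_neg (show ¬ r + 1 - (s - q - 1) ≤ q by omega),
            show r + 1 - (s - q - 1) + (s - q - 1) = r + 1 by omega] using hr)
      simpa only [if_neg (show ¬ r + 1 - (s - q - 1) ≤ q by omega), zero_le, if_true,
            show r + 1 - (s - q - 1) + (s - q - 1) = r + 1 by omega] using h1
  obtain ⟨e, he⟩ := hM (r + 2) (Fin.cons x (fun q : Fin (r + 1) => i q))
    (fun p : Fin (r + 2) => v p)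
  rw [det_of_cycle M x i v hx hi] at he
  have hd1 : (M x (v 0) * ∏ q : Fin (r + 1), M (i q) (v (q + 1))).IsHomogeneous
      (D x (v 0) + ∑ q : Fin (r + 1), D (i q) (v (q + 1))) :=
    (hD _ _).mul (IsHomogeneous.prod _ _ _ fun _ _ => hD _ _)
  have hd2 : ((-1) ^ (r + 1) * (M x (v (r + 1)) * ∏ q : Fin (r + 1), M (i q) (v q))).IsHomogeneous
      (0 + (D x (v (r + 1)) + ∑ q : Fin (r + 1), D (i q) (v q))) := by
    refine IsHomogeneous.mul ?_ ((hD _ _).mul (IsHomogeneous.prod _ _ _ fun _ _ => hD _ _))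
    have : ((-1) ^ (r + 1) : MvPolynomial σ k) = C ((-1) ^ (r + 1)) := by simp
    rw [this]
    exact isHomogeneous_C _ _
  have h1 := eq_of_isHomogeneous_add hd1 hd2
    (mul_ne_zero h0 (Finset.prod_ne_zero_iff.2 fun q _ => (hp q q.2).2.2))
    (mul_ne_zero (pow_ne_zero _ (neg_ne_zero.2 one_ne_zero))
      (mul_ne_zero hr (Finset.prod_ne_zero_iff.2 fun q _ => (hp q q.2).2.1))) he
  have h2 : ∑ q : Fin (r + 1), ((D (i q) (v (q + 1)) : ℤ) - D (i q) (v q)) =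
      ∑ q : Fin (r + 1), (b (v (q + 1)) - b (v q)) := by
    refine Finset.sum_congr rfl fun q _ => ?_
    obtain ⟨hq1, hq2, hq3⟩ := hp q q.2
    rw [hab _ hq1 _ hq2, hab _ hq1 _ hq3]
    ring
  rw [Fin.sum_univ_eq_sum_range (fun q => b (v (q + 1)) - b (v q)) (r + 1),
    Finset.sum_range_sub (fun q => b (v q)), Finset.sum_sub_distrib] at h2
  have h3 : (D x (v 0) : ℤ) + ∑ q : Fin (r + 1), (D (i q) (v (q + 1)) : ℤ) =
      D x (v (r + 1)) + ∑ q : Fin (r + 1), (D (i q) (v q) : ℤ) := by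
    rw [zero_add] at h1
    exact_mod_cast h1
  linarith

/-- Two columns have nonzero entries in a common row satisfying `p`. -/
def IsLinked {R : Type*} [Zero R] (M : Matrix ι κ R) (p : ι → Prop) (j j' : κ) : Prop :=
  ∃ i, p i ∧ M i j ≠ 0 ∧ M i j' ≠ 0

theorem exists_isPath_of_reflTransGen {R : Type*} [Zero R] [Nonempty ι] {M : Matrix ι κ R}
    {p : ι → Prop} {j j' : κ} (h : Relation.ReflTransGen (IsLinked M p) j j') :
    ∃ r i v, IsPath M p r i v ∧ v 0 = j ∧ v r = j' := by
  induction h with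
  | refl => exact ⟨0, fun _ => Classical.arbitrary ι, fun _ => j, fun q hq => by omega, rfl, rfl⟩
  | @tail j' j'' _ h ih =>
    obtain ⟨r, i, v, hp, h0, hr⟩ := ih
    obtain ⟨l, hl, hl1, hl2⟩ := h
    refine ⟨r + 1, fun q => if q < r then i q else l, fun q => if q ≤ r then v q else j'', ?_,
      by simpa using h0, by simp⟩
    intro q hq
    rcases (Nat.lt_succ_iff.1 hq).lt_or_eq with h | rfl
    · simp only [if_pos h, if_pos h.le, if_pos (Nat.succ_le_of_lt h)]
      exact hp q h
    · simp only [lt_irrefl, if_false, le_refl, if_true, if_neg (Nat.not_succ_le_self q), hr]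
      exact ⟨hl, hl1, hl2⟩

/-- A matrix with homogeneous minors has row and column degrees. -/
theorem exists_hasDegrees [Finite ι]
    (hM : ∀ (r : ℕ) (f : Fin r → ι) (g : Fin r → κ),
      ∃ d : ℕ, (M.submatrix f g).det.IsHomogeneous d) :
    ∃ a b, HasDegrees M a b := by
  classical
  have hM1 : ∀ i j, ∃ d : ℕ, (M i j).IsHomogeneous d := fun i j => by
    simpa using hM 1 (fun _ => i) (fun _ => j)
  choose D hD using hM1
  suffices h : ∀ s : Set ι, s.Finite → ∃ (a : ι → ℤ) (b : κ → ℤ), ∀ i, i ∈ s → ∀ j, M i j ≠ 0 →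
      (D i j : ℤ) = b j - a i by
    obtain ⟨a, b, hab⟩ := h Set.univ Set.finite_univ
    exact ⟨a, b, fun i j hij => ⟨D i j, hab i trivial j hij, hD i j⟩⟩
  intro s hs
  induction s, hs using Set.Finite.induction_on with
  | empty => exact ⟨0, 0, by simp⟩
  | @insert x s hx _ ih =>
    obtain ⟨a, b, hab⟩ := ih
    have : Std.Symm (IsLinked M (· ∈ s)) := ⟨fun j j' ⟨i, h1, h2, h3⟩ => ⟨i, h1, h3, h2⟩⟩
    have key : ∀ j j', Relation.ReflTransGen (IsLinked M (· ∈ s)) j j' → M x j ≠ 0 → M x j' ≠ 0 →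
        (D x j : ℤ) - b j = D x j' - b j' := by
      intro j j' h hj hj'
      have : Nonempty ι := ⟨x⟩
      obtain ⟨r, i, v, hp, rfl, rfl⟩ := exists_isPath_of_reflTransGen h
      exact hp.degree_sub_eq hM hD hab r hj hj'
    -- The new row x prescribes degrees on the columns it meets. The discrepancy with the old
    -- degrees is constant on each component linked by old rows, so shifting whole components
    -- repairs it; components not met by x stay fixed.
    let S : κ → ℤ := fun j =>
      if h : ∃ j₀, M x j₀ ≠ 0 ∧ Relation.ReflTransGen (IsLinked M (· ∈ s)) j₀ j then
        D x h.choose - b h.choose else 0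
    have hS : ∀ j₀ j, M x j₀ ≠ 0 → Relation.ReflTransGen (IsLinked M (· ∈ s)) j₀ j →
        S j = D x j₀ - b j₀ := by
      intro j₀ j h1 h2
      have h : ∃ j₀, M x j₀ ≠ 0 ∧ Relation.ReflTransGen (IsLinked M (· ∈ s)) j₀ j := ⟨j₀, h1, h2⟩
      simp only [S]
      rw [dif_pos h]
      exact key _ _ (h.choose_spec.2.trans (Std.Symm.symm _ _ h2)) h.choose_spec.1 h1
    have hS' : ∀ i ∈ s, ∀ j j', M i j ≠ 0 → M i j' ≠ 0 → S j = S j' := by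
      intro i hi j j' hj hj'
      by_cases h : ∃ j₀, M x j₀ ≠ 0 ∧ Relation.ReflTransGen (IsLinked M (· ∈ s)) j₀ j
      · obtain ⟨j₀, h1, h2⟩ := h
        rw [hS j₀ j h1 h2, hS j₀ j' h1 (h2.tail ⟨i, hi, hj, hj'⟩)]
      · have h' : ¬ ∃ j₀, M x j₀ ≠ 0 ∧ Relation.ReflTransGen (IsLinked M (· ∈ s)) j₀ j' := by
          rintro ⟨j₀, h1, h2⟩
          exact h ⟨j₀, h1, h2.tail ⟨i, hi, hj', hj⟩⟩
        simp only [S]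
        rw [dif_neg h, dif_neg h']
    refine ⟨fun i => if i = x then 0 else
      if h : ∃ j, M i j ≠ 0 then a i + S h.choose else a i, fun j => b j + S j, ?_⟩
    rintro i (rfl | hi) j hj
    · simp only [if_true]
      rw [hS j j hj .refl]
      ring
    · have hix : i ≠ x := fun h => hx (h ▸ hi)
      have h : ∃ j, M i j ≠ 0 := ⟨j, hj⟩
      simp only [if_neg hix, dif_pos h]
      rw [hab i hi j hj, hS' i hi j _ hj h.choose_spec]
      ring

theorem isHomMatrix_iff_exists_hasDegrees {n t m : ℕ} {M : Matrix (Fin t) (Fin m) (CoordRing k n)} :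
    IsHomMatrix M ↔ ∃ a b, HasDegrees M a b :=
  ⟨fun h => exists_hasDegrees h, fun ⟨_, _, h⟩ _ f g => h.exists_isHomogeneous_det f g⟩

end Degrees

/-! ### Raising codimension by avoiding components -/

section Height

variable {A : Type u} [CommRing A]

/-- A prime over J either lies strictly above a minimal prime of I, or is itself one, and then its
height cannot be at most e. -/
theorem add_one_le_height_of_forall_minimalPrimes {I J : Ideal A} {e : ℕ} (hIJ : I ≤ J)
    (hI : ∀ P : Ideal A, P.IsPrime → I ≤ P → (e : ℕ∞) ≤ P.height)
    (h : ∀ P ∈ I.minimalPrimes, P.height < ((e + 1 : ℕ) : ℕ∞) → ¬ J ≤ P) (P : Ideal A)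
    (hP : P.IsPrime) (hJP : J ≤ P) : ((e + 1 : ℕ) : ℕ∞) ≤ P.height := by
  obtain ⟨Q, hQ, hQP⟩ := Ideal.exists_minimalPrimes_le (hIJ.trans hJP)
  rcases hQP.eq_or_lt with rfl | hQP
  · by_contra! hlt
    exact h _ hQ hlt hJP
  · have := hQ.1.1
    refine le_trans ?_ (Ideal.height_add_one_le_of_lt_of_isPrime hQP)
    push_cast
    gcongr
    exact hI Q hQ.1.1 hQ.1.2

theorem le_height_of_height_eq {I : Ideal A} {e : ℕ} (h : I.height = e) (P : Ideal A)
    (_ : P.IsPrime) (hP : I ≤ P) : (e : ℕ∞) ≤ P.height :=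
  h ▸ Ideal.height_mono hP

theorem le_height_of_forall {I : Ideal A} {e : ℕ}
    (h : ∀ P : Ideal A, P.IsPrime → I ≤ P → (e : ℕ∞) ≤ P.height) : (e : ℕ∞) ≤ I.height := by
  rw [Ideal.height_eq_inf_minimalPrimes]
  exact le_iInf₂ fun P hP => h P hP.1.1 hP.1.2

theorem ne_top_of_height_eq {I : Ideal A} {e : ℕ} (h : I.height = e) : I ≠ ⊤ := by
  rintro rfl
  simp at h

end Height

/-! ### The irrelevant ideal and saturation -/

section Irrelevant

variable {k : Type u} [Field k] {n : ℕ}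

theorem mem_idealOfVars_iff {f : CoordRing k n} :
    f ∈ idealOfVars (Fin (n + 1)) k ↔ coeff 0 f = 0 := by
  have := mem_pow_idealOfVars_iff' (R := k) (σ := Fin (n + 1)) 1 f
  rw [pow_one] at this
  rw [this]
  constructor
  · intro h
    exact h 0 (by simp)
  · intro h x hx
    have : x = 0 := (Finsupp.degree_eq_zero_iff x).1 (Nat.lt_one_iff.1 hx)
    rw [this, h]

theorem idealOfVars_isMaximal : (idealOfVars (Fin (n + 1)) k).IsMaximal := by
  have : idealOfVars (Fin (n + 1)) k = RingHom.ker (constantCoeff (R := k) (σ := Fin (n + 1))) := by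
    ext f
    rw [mem_idealOfVars_iff, RingHom.mem_ker, constantCoeff_eq]
  rw [this]
  exact RingHom.ker_isMaximal_of_surjective _ fun c => ⟨C c, constantCoeff_C _ c⟩

theorem le_idealOfVars_of_isHomIdeal {I : Ideal (CoordRing k n)} (hI : IsHomIdeal I)
    (hne : I ≠ ⊤) : I ≤ idealOfVars (Fin (n + 1)) k := by
  intro f hf
  rw [mem_idealOfVars_iff]
  by_contra h0
  have := (isHomIdeal_iff I).1 hI f hf 0
  rw [homogeneousComponent_zero] at this
  exact hne (Ideal.eq_top_of_isUnit_mem _ this ((IsUnit.mk0 _ h0).map C))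

theorem isUnit_of_isHomogeneous_of_notMem {f : CoordRing k n} {d : ℕ} (hf : f.IsHomogeneous d)
    (h : f ∉ idealOfVars (Fin (n + 1)) k) : d = 0 ∧ IsUnit f ∧ ∃ c, f = C c := by
  rw [mem_idealOfVars_iff] at h
  have h1 := homogeneousComponent_of_mem (m := 0) hf
  rw [homogeneousComponent_zero] at h1
  have hd : 0 = d := by
    by_contra hne
    rw [if_neg hne] at h1
    exact h (by simpa using h1)
  rw [if_pos hd] at h1
  exact ⟨hd.symm, h1 ▸ (IsUnit.mk0 _ h).map C, _, h1.symm⟩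

/-- The irrelevant ideal is not associated to a saturated ideal. -/
theorem IsSaturated.not_idealOfVars_le {I : Ideal (CoordRing k n)} (hsat : IsSaturated I)
    {P : Ideal (CoordRing k n)} (hP : P ∈ I.minimalPrimes) :
    ¬ idealOfVars (Fin (n + 1)) k ≤ P := by
  intro hle
  have hmax := idealOfVars_isMaximal (k := k) (n := n)
  have hPeq := hmax.eq_of_le hP.1.1.ne_top hle
  subst hPeq
  obtain ⟨b, hb⟩ := mem_associatedPrimes_quotient_iff.1
    (minimalPrimes_subset_associatedPrimes_quotient hP)
  have h1 : b ∈ I := hsat b fun i => (hb _).1 (Ideal.subset_span (Set.mem_range_self i))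
  exact hmax.ne_top ((Ideal.eq_top_iff_one _).2 ((hb 1).2 (by rwa [one_mul])))

/-- The ideal of a projective scheme has smaller height than the irrelevant ideal. -/
theorem add_one_le_height_idealOfVars {I : Ideal (CoordRing k n)} {e : ℕ} (hht : I.height = e)
    (hhom : IsHomIdeal I) (hsat : IsSaturated I) :
    ((e + 1 : ℕ) : ℕ∞) ≤ (idealOfVars (Fin (n + 1)) k).height :=
  add_one_le_height_of_forall_minimalPrimes
    (le_idealOfVars_of_isHomIdeal hhom (ne_top_of_height_eq hht)) (le_height_of_height_eq hht)
    (fun _ hP _ => hsat.not_idealOfVars_le hP) _ idealOfVars_isMaximal.isPrime le_rfl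

theorem saturation_eq_self {J : Ideal (CoordRing k n)} (h : IsSaturated J) : saturation J = J := by
  refine le_antisymm ?_ fun f hf => ⟨0, fun g _ => J.mul_mem_left g hf⟩
  rintro f ⟨N, hN⟩
  induction N generalizing f with
  | zero => simpa using hN 1 (by simp)
  | succ N ih =>
    refine h f fun i => ih fun g hg => ?_
    rw [← mul_assoc]
    refine hN _ ?_
    rw [pow_succ]
    exact Ideal.mul_mem_mul hg (Ideal.subset_span (Set.mem_range_self i))

/-- Determinantal ideals of the expected codimension are saturated, unless that codimension is the
height of the irrelevant ideal. -/
theorem isSaturated_maximalMinors [Infinite k] {t m e : ℕ}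
    (M : Matrix (Fin t) (Fin m) (CoordRing k n)) (hm : e + t = m + 1)
    (hM : ∀ P : Ideal (CoordRing k n), P.IsPrime → maximalMinors M ≤ P → (e : ℕ∞) ≤ P.height)
    (he : ((e + 1 : ℕ) : ℕ∞) ≤ (idealOfVars (Fin (n + 1)) k).height) :
    IsSaturated (maximalMinors M) := by
  intro f hf
  have hU := codepthLE_quotient_maximalMinors k (isCM_mvPolynomial k (n + 1)) hm M hM
  refine hU.mem_of_forall_mul_mem (J := idealOfVars (Fin (n + 1)) k)
    (fun P hP _ hle => lt_of_lt_of_le (by exact_mod_cast Nat.lt_succ_self e)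
      (he.trans (Ideal.height_mono hle))) fun x hx => ?_
  refine Submodule.span_induction (p := fun x _ => x * f ∈ maximalMinors M) ?_ (by simp)
    (fun x y _ _ hx hy => by rw [add_mul]; exact Ideal.add_mem _ hx hy)
    (fun c x _ hx => by rw [smul_eq_mul, mul_assoc]; exact Ideal.mul_mem_left _ _ hx) hx
  rintro _ ⟨i, rfl⟩
  exact hf i

theorem exists_X_notMem {P : Ideal (CoordRing k n)} (h : ¬ idealOfVars (Fin (n + 1)) k ≤ P) :
    ∃ i, (X i : CoordRing k n) ∉ P := by
  by_contra! hall
  refine h (Ideal.span_le.2 ?_)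
  rintro _ ⟨i, rfl⟩
  exact hall i

end Irrelevant

/-! ### Generic forms -/

section Generic

variable {k : Type u} [Field k] {n : ℕ}

theorem sum_coeff_mul_eq {d : ℕ} (L : CoordRing k n →ₗ[k] k) (F : Forms k n d) :
    eval (fun s => coeff s (F : CoordRing k n))
      (∑ s ∈ Finset.finsuppAntidiag (Finset.univ : Finset (Fin (n + 1))) d,
        C (L (monomial s 1)) * X s : MvPolynomial (Fin (n + 1) →₀ ℕ) k) = L F := by
  have hsub : (F : CoordRing k n).support ⊆
      Finset.finsuppAntidiag (Finset.univ : Finset (Fin (n + 1))) d := by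
    intro s hs
    have h1 := (mem_homogeneousSubmodule d (F : CoordRing k n)).1 F.2 (mem_support_iff.1 hs)
    rw [Finset.mem_finsuppAntidiag]
    refine ⟨?_, Finset.subset_univ _⟩
    rw [← h1, Finsupp.weight_apply, Finsupp.sum_fintype _ _ (by simp)]
    simp
  have hF : (F : CoordRing k n) =
      ∑ s ∈ Finset.finsuppAntidiag (Finset.univ : Finset (Fin (n + 1))) d,
        monomial s (coeff s (F : CoordRing k n)) := by
    conv_lhs => rw [(F : CoordRing k n).as_sum]
    refine Finset.sum_subset hsub fun s _ hs => ?_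
    rw [notMem_support_iff.1 hs, monomial_zero]
  conv_rhs => rw [hF]
  rw [map_sum, map_sum]
  refine Finset.sum_congr rfl fun s _ => ?_
  have : monomial s (coeff s (F : CoordRing k n)) =
      coeff s (F : CoordRing k n) • (monomial s 1 : CoordRing k n) := by
    rw [smul_monomial, smul_eq_mul, mul_one]
  rw [this, map_smul]
  simp [mul_comm]

/-- A generic form avoids finitely many relevant primes. -/
theorem holdsForGenericForm_of_forall_notMem [Infinite k] {d : ℕ} {Ps : Set (Ideal (CoordRing k n))}
    (hfin : Ps.Finite) (hPs : ∀ P ∈ Ps, P.IsPrime ∧ ¬ idealOfVars (Fin (n + 1)) k ≤ P)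
    {Q : Forms k n d → Prop} (hQ : ∀ F : Forms k n d, (∀ P ∈ Ps, (F : CoordRing k n) ∉ P) → Q F) :
    HoldsForGenericForm d Q := by
  have h1 : ∀ P : Ps, ∃ L : CoordRing k n →ₗ[k] k, (∃ F : Forms k n d, L F ≠ 0) ∧
      ∀ x ∈ P.1, L x = 0 := by
    rintro ⟨P, hP⟩
    obtain ⟨i, hi⟩ := exists_X_notMem (hPs P hP).2
    have hid : (X i : CoordRing k n) ^ d ∉ P := fun h => hi ((hPs P hP).1.mem_of_pow_mem d h)
    -- A linear functional that vanishes on P but not on X_i^d; its nonvanishing on F certifies F ∉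
    -- P. The product of these functionals, written in the coefficients of F, defines the open set.
    obtain ⟨L, hL, hle⟩ := Submodule.exists_le_ker_of_notMem (p := P.restrictScalars k) hid
    refine ⟨L, ⟨⟨X i ^ d, ?_⟩, hL⟩, fun x hx => hle hx⟩
    rw [mem_homogeneousSubmodule]
    exact isHomogeneous_X_pow i d
  choose L hL hL0 using h1
  have := hfin.fintype
  refine ⟨∏ P : Ps, ∑ s ∈ Finset.finsuppAntidiag (Finset.univ : Finset (Fin (n + 1))) d,
        C (L P (monomial s 1)) * X s, ?_, fun F hF => hQ F fun P hP hFP => ?_⟩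
  · obtain ⟨F, hF⟩ := exists_forall_notMem_of_finite (k := k) (E := Forms k n d)
      (Set.range fun P : Ps => LinearMap.ker ((L P) ∘ₗ (Forms k n d).subtype)) (Set.finite_range _)
      (by
        rintro _ ⟨P, rfl⟩ htop
        obtain ⟨F, hF⟩ := hL P
        have : F ∈ LinearMap.ker ((L P) ∘ₗ (Forms k n d).subtype) := by
          change F ∈ (fun P : Ps => LinearMap.ker ((L P) ∘ₗ (Forms k n d).subtype)) P
          rw [htop]; trivial
        exact hF (by simpa using this))
    refine ⟨F, ?_⟩
    rw [map_prod, Finset.prod_ne_zero_iff]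
    intro P _
    rw [sum_coeff_mul_eq]
    exact fun h => hF _ ⟨P, rfl⟩ (by simpa using h)
  · rw [map_prod, Finset.prod_ne_zero_iff] at hF
    have := hF ⟨P, hP⟩ (Finset.mem_univ _)
    rw [sum_coeff_mul_eq] at this
    exact this (hL0 _ _ hFP)

end Generic

/-! ### The matrix of the basic double link -/

section LinkMatrix

variable {k : Type u} [Field k] {n t m : ℕ}

theorem HasDegrees.snocCol {σ : Type*} {N : Matrix (Fin t) (Fin m) (MvPolynomial σ k)}
    {a : Fin t → ℤ}
    {b : Fin m → ℤ} (h : HasDegrees N a b) {v : Fin t → MvPolynomial σ k} {l : ℤ}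
    (hv : ∀ i, v i ≠ 0 → ∃ d : ℕ, (d : ℤ) = l - a i ∧ (v i).IsHomogeneous d) :
    HasDegrees (DetLinkage.snocCol N v) a (Fin.snoc b l) := by
  intro i j
  refine Fin.lastCases ?_ (fun j => ?_) j
  · simpa using hv i
  · simpa using h i j

theorem span_range_mul {R : Type*} [CommRing R] {X : Type*} (F : R) (β : X → R) :
    Ideal.span (Set.range fun x => F * β x) = Ideal.span {F} * Ideal.span (Set.range β) := by
  rw [Ideal.span_mul_span', Set.singleton_mul, ← Set.range_comp]
  rfl

/-- A matrix defining `S` and, for every form, a matrix whose maximal minors define the basic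
double link. -/
theorem HaveRelatedMatrices.exists_matrix {C S : ProjSubscheme k n} (h : HaveRelatedMatrices C S) :
    ∃ (t m c : ℕ) (N : Matrix (Fin (t + 1)) (Fin m) (CoordRing k n)), IsHomMatrix N ∧
      S.ideal = maximalMinors N ∧ S.ideal.height = c ∧ m = t + c ∧ C.ideal ≤ minorIdeal t N ∧
      ∀ (d : ℕ) (F : Forms k n d), ∃ D : Matrix (Fin (t + 1)) (Fin (m + 1)) (CoordRing k n),
        IsHomMatrix D ∧
          maximalMinors D = S.ideal ⊔ Ideal.span {(F : CoordRing k n)} * C.ideal := by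
  rcases h with ⟨t, m, M, N, i, ⟨-, -, hMC, -⟩, ⟨-, hN, hNS, c, hc, hm⟩, hMN⟩ |
    ⟨t, m, M, N, j, ⟨ht, hM, hMC, -⟩, ⟨-, hN, hNS, c, hc, hm⟩, hMN⟩
  · have hC : C.ideal = maximalMinors (N.submatrix i.succAbove id) := by
      rw [hMC, hMN]; rfl
    refine ⟨t, m, c, N, hN, hNS, hc, by omega, ?_, fun d F => ?_⟩
    · rw [hC]
      exact minorIdeal_le_iff_succAbove.1 le_rfl i
    · obtain ⟨a, b, hab⟩ := isHomMatrix_iff_exists_hasDegrees.1 hN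
      -- The new column F·e_i has degree d + a_i. Its bordered minors are, up to sign, F times the
      -- maximal minors of N without row i.
      refine ⟨snocCol N (Pi.single i F), isHomMatrix_iff_exists_hasDegrees.2
        ⟨a, _, hab.snocCol (l := d + a i) fun i' hi' => ?_⟩, ?_⟩
      · obtain rfl : i' = i := by
          by_contra hne
          exact hi' (Pi.single_eq_of_ne hne _)
        refine ⟨d, by ring, ?_⟩
        rw [Pi.single_eq_same]
        exact F.2
      · rw [maximalMinors_snocCol, hC, hNS, maximalMinors, maximalMinors, ← span_range_mul]
        congr 1
        refine le_antisymm (Ideal.span_le.2 ?_) (Ideal.span_le.2 ?_)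
        · rintro _ ⟨f, rfl⟩
          simp only [borderedMinor_single, mul_assoc]
          exact Ideal.mul_mem_left _ _ (Ideal.subset_span ⟨f, rfl⟩)
        · rintro _ ⟨f, rfl⟩
          have hu : IsUnit ((-1 : CoordRing k n) ^ (i + t : ℕ)) := IsUnit.pow _ isUnit_one.neg
          refine (Ideal.unit_mul_mem_iff_mem _ hu).1 (Ideal.subset_span ⟨f, ?_⟩)
          simp only [borderedMinor_single, mul_assoc]
          rfl
  · obtain ⟨t, rfl⟩ : ∃ t', t = t' + 1 := ⟨t - 1, by omega⟩
    obtain ⟨a, b, hab⟩ := isHomMatrix_iff_exists_hasDegrees.1 hM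
    let v : Fin (t + 1) → CoordRing k n := fun i => M i j
    have hNM : N = M.submatrix id j.succAbove := hMN
    have hC : C.ideal = maximalMinors (snocCol N v) := by
      have h1 : snocCol N v =
          M.submatrix id ((finSuccEquiv' (Fin.last m)).trans (finSuccEquiv' j).symm) := by
        refine Matrix.ext fun p q => ?_
        refine Fin.lastCases ?_ (fun q => ?_) q
        · simp [v]
        · rw [snocCol_castSucc, hNM, Matrix.submatrix_apply, Matrix.submatrix_apply,
            Equiv.trans_apply, ← Fin.succAbove_last_apply, finSuccEquiv'_succAbove,
            finSuccEquiv'_symm_some]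
      rw [hMC, h1]
      exact (maximalMinors_submatrix_equiv M _).symm
    rw [maximalMinors_snocCol] at hC
    refine ⟨t, m, c, N, hN, hNS, hc, by omega, ?_, fun d F => ?_⟩
    · rw [hC, sup_le_iff, Ideal.span_le]
      constructor
      · refine (maximalMinors_le_submatrix_succAbove N 0).trans ?_
        exact minorIdeal_le_iff_succAbove.1 le_rfl 0
      · rintro _ ⟨f, rfl⟩
        exact borderedMinor_mem_minorIdeal _ _ _
    -- The deleted column is put back multiplied by F. The part of F·I_C coming from F·I_S is
    -- absorbed by I_S.
    · refine ⟨snocCol N ((F : CoordRing k n) • v), isHomMatrix_iff_exists_hasDegrees.2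
        ⟨a, _, (show HasDegrees N a (b ∘ j.succAbove) from hNM ▸ hab.submatrix id _).snocCol
          (l := d + b j) fun i hi => ?_⟩, ?_⟩
      · obtain ⟨d', hd', h⟩ := hab i j fun h0 => hi (by simp [v, h0])
        refine ⟨d + d', by push_cast; rw [hd']; ring, ?_⟩
        exact IsHomogeneous.mul F.2 h
      · have h1 : Ideal.span {(F : CoordRing k n)} * maximalMinors N ≤ maximalMinors N :=
          Ideal.mul_le_right
        rw [maximalMinors_snocCol, hC, show S.ideal = maximalMinors N from hNS, Ideal.mul_sup,
          ← sup_assoc, sup_eq_left.2 h1, ← span_range_mul]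
        simp only [map_smul, smul_eq_mul]

variable {C S : ProjSubscheme k n}

/-- A prime over the link ideal contains I_C, or contains I_S and F and is therefore not minimal
over I_S. The upper bound holds because the link ideal lies in I_C. -/
theorem height_linkIdeal (hCS : C.IsSubscheme S) {c : ℕ} (hS : S.ideal.height = c)
    (hC : C.ideal.height = ((c + 1 : ℕ) : ℕ∞)) {d : ℕ} {F : Forms k n d}
    (hF : ProjSubscheme.MeetsProperly F S) :
    (S.ideal ⊔ Ideal.span {(F : CoordRing k n)} * C.ideal).height = ((c + 1 : ℕ) : ℕ∞) := by
  refine le_antisymm ?_ (le_height_of_forall ?_)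
  · rw [← hC]
    exact Ideal.height_mono (sup_le hCS Ideal.mul_le_right)
  · intro P hP hle
    rw [sup_le_iff, Ideal.IsPrime.mul_le hP, Ideal.span_singleton_le_iff_mem] at hle
    rcases hle with ⟨hSP, hFP | hCP⟩
    · refine add_one_le_height_of_forall_minimalPrimes (I := S.ideal)
        (J := S.ideal ⊔ Ideal.span {(F : CoordRing k n)}) le_sup_left (le_height_of_height_eq hS)
        (fun Q hQ _ hle => hF Q hQ (hle (Ideal.mem_sup_right (Ideal.mem_span_singleton_self _))))
        P hP (sup_le hSP ((Ideal.span_singleton_le_iff_mem _).2 hFP))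
    · exact le_height_of_height_eq hC P hP hCP

/-- The link ideal has the expected codimension c + 1 of D, and the irrelevant ideal has larger
height because C is a projective scheme of that codimension; so taking the saturation changes
nothing. -/
theorem ideal_basicDoubleLink [Infinite k] (hCS : C.IsSubscheme S) {t m c : ℕ}
    (hS : S.ideal.height = c)
    (hC : C.ideal.height = ((c + 1 : ℕ) : ℕ∞)) {d : ℕ} {F : Forms k n d}
    (hF : ProjSubscheme.MeetsProperly F S) {D : Matrix (Fin (t + 1)) (Fin (m + 1)) (CoordRing k n)}
    (hm : m = t + c)
    (hD : maximalMinors D = S.ideal ⊔ Ideal.span {(F : CoordRing k n)} * C.ideal) :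
    (basicDoubleLink C S F).ideal = maximalMinors D := by
  change saturation _ = _
  rw [← hD]
  refine saturation_eq_self (isSaturated_maximalMinors (e := c + 1) D (by omega) ?_
    (add_one_le_height_idealOfVars hC C.homogeneous C.saturated))
  rw [hD]
  exact le_height_of_height_eq (height_linkIdeal hCS hS hC hF)

end LinkMatrix

/-! ### Good determinantal ideals and generic complete intersections -/

section GenericCompleteIntersection

/-- At the primes of height at most `e`, the ideal `I` is generated by at most `e` elements. -/
def IsCIUpTo {A : Type*} [CommRing A] (e : ℕ) (I : Ideal A) : Prop :=
  ∀ (P : Ideal A) [P.IsPrime], I ≤ P → P.height ≤ e →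
    ∃ s : Finset (Localization.AtPrime P), s.card ≤ e ∧
      Ideal.span (s : Set (Localization.AtPrime P)) = I.map (algebraMap A (Localization.AtPrime P))

theorem exists_finset_span_eq_map_of_not_le {A : Type*} [CommRing A] {t m e : ℕ}
    (M : Matrix (Fin (t + 1)) (Fin m) A) (hm : m = t + e) (P : Ideal A) [P.IsPrime]
    (h : ¬ minorIdeal t M ≤ P) :
    ∃ s : Finset (Localization.AtPrime P), s.card ≤ e ∧
      Ideal.span (s : Set (Localization.AtPrime P)) =
        (maximalMinors M).map (algebraMap A (Localization.AtPrime P)) := by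
  rw [minorIdeal_le] at h
  push Not at h
  obtain ⟨f, g, hfg⟩ := h
  have hu : IsUnit ((M.map (algebraMap A (Localization.AtPrime P))).submatrix f g).det := by
    have := (IsLocalization.AtPrime.isUnit_to_map_iff (Localization.AtPrime P) P
      (M.submatrix f g).det).2 hfg
    rwa [RingHom.map_det] at this
  obtain ⟨s, hs, hspan⟩ := exists_finset_span_eq_maximalMinors hu
  exact ⟨s, by omega, by rw [hspan, map_maximalMinors]⟩

variable {k : Type u} [Field k] {n : ℕ}

/-- The matrix with a row deleted has minors of height e + 1, so at a prime of height at most e some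
submaximal minor is a unit and e bordered minors generate. For a single row the empty minor plays
this role. -/
theorem IsGoodDetIdeal.isCIUpTo {I : Ideal (CoordRing k n)} (h : IsGoodDetIdeal I) {e : ℕ}
    (he : I.height = e) : IsCIUpTo e I := by
  obtain ⟨t, m, M, ⟨-, -, hI, c, hc, hm⟩, h⟩ := h
  obtain rfl : c = e := by exact_mod_cast hc.symm.trans he
  replace hI : I = maximalMinors M := hI
  intro P _ _ hPe
  rcases h with rfl | ⟨Q, i, -, -, -, -, c', hc', hm'⟩
  · rw [hI]
    refine exists_finset_span_eq_map_of_not_le M (by omega) P ?_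
    rw [minorIdeal_zero, top_le_iff]
    exact Ideal.IsPrime.ne_top'
  · have hQ : I = maximalMinors (Q.val * M) := by
      rw [maximalMinors_mul_left_of_mul_eq_one (P' := (Q⁻¹).val) (by
        rw [← Units.val_mul, inv_mul_cancel, Units.val_one]), hI]
    rw [hQ]
    refine exists_finset_span_eq_map_of_not_le _ (by omega) P fun hle => ?_
    have h1 := Ideal.height_mono (minorIdeal_le_iff_succAbove.1 hle i)
    change (maxMinors (deleteRow (Q.val * M) i)).height ≤ _ at h1
    rw [hc'] at h1
    have h2 := h1.trans hPe
    norm_cast at h2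
    omega

/-- At the primes containing the ideal of maximal minors, of height at most its codimension, there
is a submaximal minor. -/
theorem IsCIUpTo.not_minorIdeal_le [Infinite k] {t m e : ℕ}
    {M : Matrix (Fin (t + 1)) (Fin m) (CoordRing k n)} (hm : m = t + e) (he : 2 ≤ e)
    (hM : ∀ P : Ideal (CoordRing k n), P.IsPrime → maximalMinors M ≤ P → (e : ℕ∞) ≤ P.height)
    (h : IsCIUpTo e (maximalMinors M)) (P : Ideal (CoordRing k n)) [P.IsPrime]
    (hP : maximalMinors M ≤ P) (hPe : P.height ≤ e) : ¬ minorIdeal t M ≤ P := by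
  intro hle
  obtain ⟨s, hs, hspan⟩ := h P hP hPe
  rw [map_maximalMinors] at hspan
  let B := Localization.AtPrime P
  have hB : IsCM B := (isCM_mvPolynomial k (n + 1)).of_isLocalization P.primeCompl B
  refine not_minorIdeal_le_maximalIdeal k hB he hs (by omega) _ (fun Q hQ hQle => ?_) hspan ?_
  · rw [← IsLocalization.height_under P.primeCompl Q]
    refine hM _ inferInstance ?_
    rw [← map_maximalMinors, Ideal.map_le_iff_le_comap] at hQle
    exact hQle
  · refine minorIdeal_le.2 fun f g => ?_
    have h1 : (M.submatrix f g).det ∈ (IsLocalRing.maximalIdeal B).under (CoordRing k n) := by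
      rw [IsLocalization.AtPrime.under_maximalIdeal B P]
      exact hle (det_mem_minorIdeal M f g)
    have h2 : algebraMap (CoordRing k n) B (M.submatrix f g).det ∈ IsLocalRing.maximalIdeal B := h1
    rwa [RingHom.map_det] at h2

theorem HasDegrees.schur {t m : ℕ} {M : Matrix (Fin (t + 1)) (Fin (m + 1)) (CoordRing k n)}
    {a : Fin (t + 1) → ℤ} {b : Fin (m + 1) → ℤ} (h : HasDegrees M a b) {p : Fin (t + 1)}
    {q : Fin (m + 1)} (hpq : b q = a p) (c : k) :
    HasDegrees (DetLinkage.schur M p q (C c)) (a ∘ p.succAbove) (b ∘ q.succAbove) := by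
  intro i j hij
  have key : ∀ {x : CoordRing k n} {l : ℤ}, (x ≠ 0 → ∃ d : ℕ, (d : ℤ) = l ∧ x.IsHomogeneous d) →
      0 ≤ l → x.IsHomogeneous l.toNat := by
    intro x l hx hl
    by_cases h0 : x = 0
    · rw [h0]; exact isHomogeneous_zero _ _ _
    · obtain ⟨d, rfl, hd⟩ := hx h0
      exact hd
  have h1 := h (p.succAbove i) (q.succAbove j)
  have h2 : C c * M (p.succAbove i) q * M p (q.succAbove j) ≠ 0 → ∃ d : ℕ,
      (d : ℤ) = b (q.succAbove j) - a (p.succAbove i) ∧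
      (C c * M (p.succAbove i) q * M p (q.succAbove j)).IsHomogeneous d := by
    intro h0
    obtain ⟨d, hd, hd'⟩ := h (p.succAbove i) q fun hz => h0 (by rw [hz]; ring)
    obtain ⟨d2, hd2, hd2'⟩ := h p (q.succAbove j) fun hz => h0 (by rw [hz]; ring)
    exact ⟨0 + d + d2, by push_cast; rw [hd, hd2, hpq]; ring,
      ((isHomogeneous_C _ _).mul hd').mul hd2'⟩
  have hl : 0 ≤ b (q.succAbove j) - a (p.succAbove i) := by
    by_cases h0 : M (p.succAbove i) (q.succAbove j) = 0
    · have : C c * M (p.succAbove i) q * M p (q.succAbove j) ≠ 0 := fun hz => hij (by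
        simp [DetLinkage.schur, h0, hz])
      obtain ⟨d, hd, -⟩ := h2 this
      omega
    · obtain ⟨d, hd, -⟩ := h1 h0
      omega
  exact ⟨_, Int.toNat_of_nonneg hl, (key h1 hl).sub (key h2 hl)⟩

theorem HasDegrees.elimRow_mul {t m : ℕ} {M : Matrix (Fin (t + 1)) (Fin m) (CoordRing k n)}
    {a : Fin (t + 1) → ℤ} {b : Fin m → ℤ} (h : HasDegrees M a b) (ha : ∀ i, a i ≤ a (Fin.last t))
    {c : Fin (t + 1) → CoordRing k n}
    (hc : ∀ i, (c i).IsHomogeneous (a (Fin.last t) - a i).toNat) :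
    HasDegrees (elimRow c * M) a b := by
  intro i j hij
  rw [elimRow_mul_apply] at hij ⊢
  split_ifs at hij ⊢ with hi
  · exact h i j hij
  have h2 : M (Fin.last t) j ≠ 0 → ∃ d : ℕ, (d : ℤ) = b j - a i ∧
      (c i * M (Fin.last t) j).IsHomogeneous d := by
    intro h0
    obtain ⟨d, hd, hd'⟩ := h _ j h0
    refine ⟨_, ?_, (hc i).mul hd'⟩
    push_cast
    rw [Int.toNat_of_nonneg (sub_nonneg.2 (ha i)), hd]
    ring
  by_cases h0 : M (Fin.last t) j = 0
  · rw [h0, mul_zero, sub_zero] at hij ⊢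
    exact h i j hij
  obtain ⟨d, hd, hd'⟩ := h2 h0
  refine ⟨d, hd, IsHomogeneous.sub ?_ hd'⟩
  have := h.isHomogeneous i j
  rwa [← hd, Int.toNat_natCast] at this

/-- A homogeneous entry outside the irrelevant ideal is a nonzero constant, and its Schur complement
removes one row and one column without changing the ideal or the expected codimension. -/
theorem exists_minimal_matrix {t m : ℕ} (M : Matrix (Fin (t + 1)) (Fin m) (CoordRing k n))
    (hM : IsHomMatrix M) : ∃ (t' m' : ℕ) (M' : Matrix (Fin (t' + 1)) (Fin m') (CoordRing k n)),
      IsHomMatrix M' ∧ maximalMinors M' = maximalMinors M ∧ m' + t = m + t' ∧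
      (t' = 0 ∨ ∀ i j, M' i j ∈ idealOfVars (Fin (n + 1)) k) := by
  induction t generalizing m with
  | zero => exact ⟨0, m, M, hM, rfl, rfl, Or.inl rfl⟩
  | succ t ih =>
    by_cases hmem : ∀ i j, M i j ∈ idealOfVars (Fin (n + 1)) k
    · exact ⟨t + 1, m, M, hM, rfl, rfl, Or.inr hmem⟩
    push Not at hmem
    obtain ⟨p, q, hpq⟩ := hmem
    obtain ⟨a, b, hab⟩ := isHomMatrix_iff_exists_hasDegrees.1 hM
    obtain _ | m := m
    · exact q.elim0
    have h0 : M p q ≠ 0 := fun h => hpq (h ▸ Ideal.zero_mem _)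
    obtain ⟨d, hd, hd'⟩ := hab p q h0
    obtain ⟨rfl, -, c, hc⟩ := isUnit_of_isHomogeneous_of_notMem hd' hpq
    have hc0 : c ≠ 0 := by
      rintro rfl
      exact h0 (by rw [hc, C_0])
    have hu : C c⁻¹ * M p q = 1 := by
      rw [hc, ← C_mul, inv_mul_cancel₀ hc0, C_1]
    obtain ⟨t', m', M', hM', hI, hm, h⟩ := ih (schur M p q (C c⁻¹))
      (isHomMatrix_iff_exists_hasDegrees.2 ⟨_, _, hab.schur (by push_cast at hd; omega) _⟩)
    exact ⟨t', m', M', hM', by rw [hI, maximalMinors_schur M hu], by omega, h⟩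

theorem height_maximalMinors_eq [Infinite k] {t m e : ℕ}
    (M : Matrix (Fin t) (Fin m) (CoordRing k n)) (hm : e + t = m + 1)
    (hM : ∀ P : Ideal (CoordRing k n), P.IsPrime → maximalMinors M ≤ P → (e : ℕ∞) ≤ P.height)
    (hne : maximalMinors M ≠ ⊤) : (maximalMinors M).height = e := by
  refine le_antisymm ?_ (le_height_of_forall hM)
  have hU := codepthLE_quotient_maximalMinors k (isCM_mvPolynomial k (n + 1)) hm M hM
  obtain ⟨P, hP⟩ := (Ideal.nonempty_minimalPrimes hne)
  exact (Ideal.height_mono hP.1.2).trans (hU.height_le_of_minimalPrimes hP)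

/-- At the components of codimension e some submaximal minor survives, so general row elimination
with homogeneous coefficients moves the minors of all but the last row off these components, and the
codimension rises to e + 1. Minimality of the matrix keeps that ideal proper. -/
theorem isGoodDetIdeal_maximalMinors [Infinite k] {t m e : ℕ}
    (M : Matrix (Fin (t + 1)) (Fin m) (CoordRing k n)) (hM : IsHomMatrix M) (hm : m = t + e)
    (he : 2 ≤ e) (hht : (maximalMinors M).height = e)
    (hlt : ((e + 1 : ℕ) : ℕ∞) ≤ (idealOfVars (Fin (n + 1)) k).height)
    (h : IsCIUpTo e (maximalMinors M)) : IsGoodDetIdeal (maximalMinors M) := by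
  obtain ⟨t, m, M, hM', hI, hm', hmem⟩ := exists_minimal_matrix M hM
  obtain rfl : m = t + e := by omega
  rw [← hI] at hht h ⊢
  rcases hmem with rfl | hmem
  · exact ⟨0, _, M, ⟨le_rfl, hM', rfl, e, hht, by omega⟩, Or.inl rfl⟩
  obtain _ | t := t
  · exact ⟨0, _, M, ⟨le_rfl, hM', rfl, e, hht, by omega⟩, Or.inl rfl⟩
  obtain ⟨a₀, b, hab₀⟩ := isHomMatrix_iff_exists_hasDegrees.1 hM'
  obtain ⟨i₀, hi₀⟩ := Finite.exists_max a₀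
  -- The row with the largest a, hence with entries of smallest degree, is moved to the end, so that
  -- its multiples by forms of degree a_last - a_i ≥ 0 can be subtracted from row i.
  let σ := Equiv.swap i₀ (Fin.last (t + 1))
  set N := M.submatrix σ id with hN
  set a := a₀ ∘ σ with ha
  have hab : HasDegrees N a b := hab₀.submatrix σ id
  have hmax : ∀ i, a i ≤ a (Fin.last (t + 1)) := fun i => by
    simp only [ha, Function.comp, σ, Equiv.swap_apply_right]
    exact hi₀ _
  have hNI : maximalMinors N = maximalMinors M := by
    rw [← minorIdeal_eq_maximalMinors, ← minorIdeal_eq_maximalMinors]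
    refine le_antisymm (minorIdeal_submatrix_le _ _ _) ?_
    have h1 := minorIdeal_submatrix_le (r := t + 1 + 1) N σ.symm id
    have h2 : N.submatrix σ.symm id = M := by
      ext1 i j
      simp [hN]
    rwa [h2] at h1
  have hNmem : ∀ i j, N i j ∈ idealOfVars (Fin (n + 1)) k := fun i j => hmem _ _
  rw [← hNI] at hht h ⊢
  have hge := le_height_of_height_eq hht
  have hlt' : ∀ P : Ideal (CoordRing k n), P.height < ((e + 1 : ℕ) : ℕ∞) →
      ¬ idealOfVars (Fin (n + 1)) k ≤ P := fun P hP hle =>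
    (hlt.trans (Ideal.height_mono hle)).not_gt hP
  have hle_of_lt : ∀ P : Ideal (CoordRing k n), P.height < ((e + 1 : ℕ) : ℕ∞) →
      P.height ≤ e := fun P hP => by
    rw [Nat.cast_succ] at hP
    exact ENat.lt_add_one_iff (by simp) |>.1 hP
  obtain ⟨c, hcV, hc1, hc⟩ := exists_elimRow_forall_not_le (k := k) N
    {P | P ∈ (maximalMinors N).minimalPrimes ∧ P.height < ((e + 1 : ℕ) : ℕ∞)}
    ((Ideal.finite_minimalPrimes_of_isNoetherianRing _ (maximalMinors N)).subset fun P hP => hP.1)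
    (fun P hP => by
      have := hP.1.1.1
      exact ⟨this, h.not_minorIdeal_le rfl he hge P hP.1.1.2 (hle_of_lt _ hP.2)⟩)
    -- Vectors whose coordinates are forms of these degrees. The last coordinate has degree 0, so it
    -- is a scalar; a power of a variable outside P gives the required x·e_i.
    (Submodule.pi Set.univ fun i => homogeneousSubmodule (Fin (n + 1)) k
      (a (Fin.last (t + 1)) - a i).toNat)
    (fun P hP i => by
      obtain ⟨l, hl⟩ := exists_X_notMem (hlt' P hP.2)
      refine ⟨X l ^ (a (Fin.last (t + 1)) - a i).toNat, fun h => hl (hP.1.1.1.mem_of_pow_mem _ h),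
        ?_⟩
      intro j _
      by_cases hj : j = i
      · subst hj
        rw [Pi.single_eq_same]
        exact isHomogeneous_X_pow l _
      · rw [Pi.single_eq_of_ne hj]
        exact Submodule.zero_mem _)
    (by
      intro j _
      by_cases hj : j = Fin.last (t + 1)
      · subst hj
        rw [Pi.single_eq_same]
        change (1 : CoordRing k n) ∈ homogeneousSubmodule (Fin (n + 1)) k
          (a (Fin.last (t + 1)) - a (Fin.last (t + 1))).toNat
        rw [sub_self]
        exact isHomogeneous_one _ _
      · rw [Pi.single_eq_of_ne hj]
        exact Submodule.zero_mem _)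
    (fun c hc => by
      have h1 : c (Fin.last (t + 1)) ∈ homogeneousSubmodule (Fin (n + 1)) k
          (a (Fin.last (t + 1)) - a (Fin.last (t + 1))).toNat := hc (Fin.last (t + 1)) trivial
      rw [sub_self] at h1
      have h2 := totalDegree_eq_zero_iff_eq_C.1
        (Nat.le_zero.1 (IsHomogeneous.totalDegree_le (n := 0) h1))
      exact ⟨_, h2⟩)
  have hdeg : HasDegrees (elimRow c * N) a b := hab.elimRow_mul hmax fun i => hcV i trivial
  have hNI' : maximalMinors (elimRow c * N) = maximalMinors N := maximalMinors_elimRow_mul _ _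
  set ψ := (elimRow c * N).submatrix (Fin.last (t + 1)).succAbove id with hψ
  have hψge := add_one_le_height_of_forall_minimalPrimes
    (hNI'.symm.le.trans (maximalMinors_le_submatrix_succAbove (elimRow c * N) (Fin.last (t + 1))))
    hge (fun P hP hPe => hc P ⟨hP, hPe⟩)
  have hψne : maximalMinors ψ ≠ ⊤ := by
    have hmax := idealOfVars_isMaximal (k := k) (n := n)
    refine fun htop => hmax.ne_top (top_le_iff.1 (htop ▸ maximalMinors_le.2 fun g => ?_))
    rw [Matrix.det_succ_row_zero]
    refine Ideal.sum_mem _ fun j _ => Ideal.mul_mem_right _ _ (Ideal.mul_mem_left _ _ ?_)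
    rw [Matrix.submatrix_apply, hψ, Matrix.submatrix_apply, Matrix.mul_apply]
    exact Ideal.sum_mem _ fun l _ => Ideal.mul_mem_left _ _ (hNmem _ _)
  let P : GL (Fin (t + 1 + 1)) (CoordRing k n) :=
    Matrix.nonsingInvUnit (elimRow c) (by rw [det_elimRow]; exact isUnit_one)
  refine ⟨t + 1, _, N, ⟨by omega, isHomMatrix_iff_exists_hasDegrees.2 ⟨_, _, hab⟩, rfl, e, hht,
    by omega⟩, Or.inr ⟨P, Fin.last (t + 1), isHomMatrix_iff_exists_hasDegrees.2 ⟨_, _, hdeg⟩,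
    by omega, isHomMatrix_iff_exists_hasDegrees.2 ⟨_, _, hdeg.submatrix _ _⟩, rfl, e + 1,
    height_maximalMinors_eq ψ (by omega) hψge hψne, by omega⟩⟩

/-- A form of positive codimension is good determinantal. -/
theorem isGoodDetIdeal_span_singleton {f : CoordRing k n} {d : ℕ} (hf : f.IsHomogeneous d)
    (hht : (Ideal.span {f}).height = 1) : IsGoodDetIdeal (Ideal.span {f}) := by
  refine ⟨0, 1, Matrix.of fun _ _ => f, ⟨le_rfl, isHomMatrix_iff_exists_hasDegrees.2
    ⟨fun _ => 0, fun _ => d, fun i j _ => ⟨d, by simp, hf⟩⟩, ?_, 1, by simpa using hht, rfl⟩,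
    Or.inl rfl⟩
  have : (fun g : Fin (0 + 1) → Fin 1 =>
      ((Matrix.of fun (_ : Fin (0 + 1)) (_ : Fin 1) => f).submatrix id g).det) = fun _ => f := by
    funext g
    simp
  rw [maxMinors, this, Set.range_const]

/-- Let P have height at most c + 1. If f ∉ P, the ideal agrees with J at P. If f ∈ P, then J ⊄ P
since f avoids the minimal primes of J; hence a submaximal minor of N is a unit at P, I has c local
generators, and f is one more. -/
theorem isCIUpTo_linkIdeal {I J : Ideal (CoordRing k n)} {f : CoordRing k n} {t m c : ℕ}
    {N : Matrix (Fin (t + 1)) (Fin m) (CoordRing k n)} (hI : I = maximalMinors N) (hm : m = t + c)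
    (hIJ : I ≤ J) (hJN : J ≤ minorIdeal t N) (hJ : IsCIUpTo (c + 1) J)
    (hJht : J.height = ((c + 1 : ℕ) : ℕ∞))
    (hf : ∀ P ∈ J.minimalPrimes, f ∉ P) : IsCIUpTo (c + 1) (I ⊔ Ideal.span {f} * J) := by
  classical
  intro P hP hle hPc
  rw [sup_le_iff, Ideal.IsPrime.mul_le hP, Ideal.span_singleton_le_iff_mem] at hle
  obtain ⟨hIP, hfJ⟩ := hle
  by_cases hfP : f ∈ P
  · have hJP : ¬ J ≤ P := by
      intro hJP
      obtain ⟨Q, hQ, hQP⟩ := Ideal.exists_minimalPrimes_le hJP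
      rcases hQP.eq_or_lt with rfl | hQP
      · exact hf _ hQ hfP
      · have := hQ.1.1
        have h1 := Ideal.height_add_one_le_of_lt_of_isPrime hQP
        have h2 := (add_le_add_left (le_height_of_height_eq hJht Q this hQ.1.2) 1).trans
          (h1.trans hPc)
        norm_cast at h2
        omega
    obtain ⟨s, hs, hspan⟩ := exists_finset_span_eq_map_of_not_le N hm P fun h => hJP (hJN.trans h)
    refine ⟨insert (algebraMap _ _ f) s, (Finset.card_insert_le _ _).trans (by omega), ?_⟩
    have hJtop : J.map (algebraMap _ (Localization.AtPrime P)) = ⊤ := by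
      obtain ⟨x, hx, hxP⟩ := SetLike.not_le_iff_exists.1 hJP
      exact Ideal.eq_top_of_isUnit_mem _ (Ideal.mem_map_of_mem _ hx)
        ((IsLocalization.AtPrime.isUnit_to_map_iff (Localization.AtPrime P) P x).2 hxP)
    rw [Finset.coe_insert, Ideal.span_insert, hspan, ← hI, Ideal.map_sup, Ideal.map_mul, hJtop,
      Ideal.mul_top, Ideal.map_span, Set.image_singleton, sup_comm]
  · have hJP : J ≤ P := hfJ.resolve_left hfP
    obtain ⟨s, hs, hspan⟩ := hJ P hJP hPc
    refine ⟨s, hs, ?_⟩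
    have hftop : (Ideal.span {f}).map (algebraMap _ (Localization.AtPrime P)) = ⊤ :=
      Ideal.eq_top_of_isUnit_mem _
        (Ideal.mem_map_of_mem _ (Ideal.mem_span_singleton_self f))
        ((IsLocalization.AtPrime.isUnit_to_map_iff (Localization.AtPrime P) P f).2 hfP)
    rw [hspan, Ideal.map_sup, Ideal.map_mul, hftop, Ideal.top_mul,
      sup_eq_right.2 (Ideal.map_mono hIJ)]

end GenericCompleteIntersection

/-! ### Square matrices -/

section Square

theorem maximalMinors_square {R : Type*} [CommRing R] {t : ℕ} (M : Matrix (Fin t) (Fin t) R) :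
    maximalMinors M = Ideal.span {M.det} := by
  refine le_antisymm (maximalMinors_le.2 fun g => ?_) ?_
  · by_cases hg : Function.Injective g
    · have : M.submatrix id g = M.submatrix id
          (Equiv.ofBijective g (Finite.injective_iff_bijective.1 hg)) := rfl
      rw [this, Matrix.det_permute']
      exact Ideal.mul_mem_left _ _ (Ideal.mem_span_singleton_self _)
    · simp only [Function.Injective, not_forall] at hg
      obtain ⟨x, y, hxy, hne⟩ := hg
      have h0 : (M.submatrix id g).det = 0 :=
        Matrix.det_zero_of_column_eq hne fun l => by simp [hxy]
      rw [h0]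
      exact Ideal.zero_mem _
  · rw [Ideal.span_singleton_le_iff_mem]
    simpa using det_mem_maximalMinors M id

end Square

end DetLinkage

theorem theorem3 {k : Type*} [Field k] [IsAlgClosed k] {n : ℕ}
    (C S : DetLinkage.ProjSubscheme k n)
    (hC : C.IsStandardDet) (hS : S.IsStandardDet)
    (hCS : C.IsSubscheme S) (hcodim : C.codim = S.codim + 1)
    (hMN : DetLinkage.HaveRelatedMatrices C S) :
    (∀ (d : ℕ), 1 ≤ d → ∀ F : DetLinkage.Forms k n d,
      DetLinkage.ProjSubscheme.MeetsProperly F S →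
        (DetLinkage.basicDoubleLink C S F).IsStandardDet) ∧
    (C.IsGoodDet → ∀ (d : ℕ), 1 ≤ d →
      DetLinkage.HoldsForGenericForm d fun F : DetLinkage.Forms k n d =>
        DetLinkage.ProjSubscheme.MeetsProperly F S ∧
          (DetLinkage.basicDoubleLink C S F).IsGoodDet) := by
  have : Infinite k := IsAlgClosed.instInfinite
  obtain ⟨t, m, c, N, hN, hSN, hSc, hm, hCN, hD⟩ := hMN.exists_matrix
  have hCc : C.ideal.height = ((c + 1 : ℕ) : ℕ∞) := by
    change C.ideal.height = S.ideal.height + 1 at hcodim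
    rw [hcodim, hSc]
    push_cast
    rfl
  have hirr := DetLinkage.add_one_le_height_idealOfVars hCc C.homogeneous C.saturated
  refine ⟨fun d _ F hF => ?_, fun hgood d _ => ?_⟩
  · obtain ⟨D, hDhom, hDI⟩ := hD d F
    have hlink := DetLinkage.ideal_basicDoubleLink hCS hSc hCc hF hm hDI
    refine ⟨t + 1, m + 1, D, by omega, hDhom, hlink, c + 1, ?_, by omega⟩
    rw [hlink, hDI]
    exact DetLinkage.height_linkIdeal hCS hSc hCc hF
  -- Avoiding the minimal primes of S means meeting S properly; avoiding those of C preserves the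
  -- local complete intersection property.
  · have hfin : (S.ideal.minimalPrimes ∪ C.ideal.minimalPrimes).Finite :=
      (Ideal.finite_minimalPrimes_of_isNoetherianRing _ _).union
        (Ideal.finite_minimalPrimes_of_isNoetherianRing _ _)
    refine DetLinkage.holdsForGenericForm_of_forall_notMem hfin ?_ fun F hF => ?_
    · rintro P (hP | hP)
      · exact ⟨hP.1.1, S.saturated.not_idealOfVars_le hP⟩
      · exact ⟨hP.1.1, C.saturated.not_idealOfVars_le hP⟩
    · have hFS : DetLinkage.ProjSubscheme.MeetsProperly F S := fun p hp => hF p (Or.inl hp)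
      refine ⟨hFS, ?_⟩
      obtain ⟨D, hDhom, hDI⟩ := hD d F
      have hlink := DetLinkage.ideal_basicDoubleLink hCS hSc hCc hFS hm hDI
      have hht := DetLinkage.height_linkIdeal hCS hSc hCc hFS
      change DetLinkage.IsGoodDetIdeal (DetLinkage.basicDoubleLink C S F).ideal
      rw [hlink]
      rw [← hDI] at hht
      -- If S has codimension 0, then D is square and the link is cut out by its determinant, which
      -- serves as a defining matrix with one entry. Otherwise e = c + 1 with c ≥ 1, as the
      -- criterion for goodness requires.
      obtain _ | c := c
      · obtain rfl : m = t := by omega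
        obtain ⟨d', hd'⟩ := hDhom (m + 1) id id
        rw [DetLinkage.maximalMinors_square] at hht ⊢
        exact DetLinkage.isGoodDetIdeal_span_singleton hd' (by simpa using hht)
      · refine DetLinkage.isGoodDetIdeal_maximalMinors D hDhom (by omega) (by omega) hht hirr ?_
        rw [hDI]
        exact DetLinkage.isCIUpTo_linkIdeal hSN hm hCS hCN (hgood.isCIUpTo hCc) hCc
          fun P hP => hF P (Or.inr hP)
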